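/- Let $ST=\{(x,y,z)\in[0,1]^3\}\setminus\{\tfrac14<x<\tfrac34,\ \tfrac14<y<\tfrac34\}$ be the solid torus, with meridional disc $\{x\in[\tfrac34,1],\,y=\tfrac12,\,z\in[0,1]\}$. A framed $\mu$-string string link $T$ in $ST$ is a smooth proper embedding of $\mu$ framed intervals, the $i$-th one running from $(\tfrac{i}{\mu+1},0,\tfrac12)$ to $(\tfrac{i}{\mu+1},1,\tfrac12)$, with standard framing at the end points; string links are considered up to framed isotopy in $ST$. Assume that every component of $T$ has algebraic intersection number zero with the meridional disc (for diagrams in general position with respect to the disc; intersections count $+1$ where $y$ increases and $-1$ where $y$ decreases). Winding matrix. Let $D$ be a blackboard-framed diagram of $T$ (projection to the $x$-$y$ plane) in general position, also with respect to the meridional disc. For a crossing $c$ of strings $i$ and $j$ let $\operatorname{sgn}(c)$ be its sign, and let $\epsilon(i,j,c)$ be the algebraic intersection with the meridional disc of the path that follows $i$ from the base $y=0$ to $c$ and then $j$ from $c$ to the top $y=1$ (if $i=j$, one changes strands the first time $c$ is met). Put $$W_{ij}(D,t)=\sum_{c\text{ crossing of }i,j}\tfrac12\operatorname{sgn}(c)\,t^{\epsilon(i,j,c)}\quad(i\ne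 j),\qquad W_{ii}(D,t)=\sum_{c\text{ self-crossing of }i}\tfrac12\operatorname{sgn}(c)\bigl(t^{\epsilon(i,i,c)}+t^{-\epsilon(i,i,c)}\bigr).$$ Equivariant linking matrix. Close $T$ on the left by disjoint planar arcs (with blackboard framing) that run outside the cube, to obtain a framed link $K_1,\dots,K_\mu$ in the solid torus (enlarged by a collar). Let $\widetilde{ST}\to ST$ be the universal cyclic cover, with $t$ generating the deck group so that a path crossing the meridional disc once, in the direction of increasing $y$, and returning to its starting point lifts to a path from a point $q$ to $tq$. Since the intersection numbers vanish, the $K_i$ lift to closed curves $\widetilde K_i$; choose the lifts so that all closing arcs lift to the same sheet. Then $$\widetilde{\mathrm{Lk}}_{ij}(T)=\sum_{m\in\mathbb Z}t^m\,lk(\widetilde K_i,t^m\widetilde K_j),$$ where the linking number $lk(\widetilde K_i,\widetilde K_i)$ (the case $i=j$, $m=0$) is the self-linking number given by the lifted framing. Claim. Such lifts exist, and for all such lifts and for every such diagram $D$ of $T$, the matrix $\widetilde{\mathrm{Lk}}(T)$ is a well-defined matrix over $\mathbb Z[t,t^{-1}]$ and $$W(D,t)=\widetilde{\mathrm{Lk}}(T).$$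 In particular $W(T,t)$ is an isotopy invariant: if $T$ and $T'$ are isotopic as framed string links in $ST$ and $D,D'$ are diagrams of $T,T'$, then $W(D,t)=W(D',t)$. -/

import Mathlib

open scoped ContDiff

noncomputable section

/-- Euclidean three-space, with coordinates `p 0 = x`, `p 1 = y`, `p 2 = z`. -/
abbrev E3 : Type := EuclideanSpace ℝ (Fin 3)

/-! ### String links in the solid torus -/

/-- The solid torus: the unit cube with the hole `1/4 < x < 3/4, 1/4 < y < 3/4` removed. -/
def solidTorus : Set E3 :=
  {p | ∀ k, 0 ≤ p k ∧ p k ≤ 1} \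
    {p | 1 / 4 < p 0 ∧ p 0 < 3 / 4 ∧ 1 / 4 < p 1 ∧ p 1 < 3 / 4}

/-- The meridional disc `3/4 ≤ x ≤ 1, y = 1/2, 0 ≤ z ≤ 1`. -/
def meridionalDisc : Set E3 :=
  {p | 3 / 4 ≤ p 0 ∧ p 0 ≤ 1 ∧ p 1 = 1 / 2 ∧ 0 ≤ p 2 ∧ p 2 ≤ 1}

/-- The `x`-coordinate of the end points of the `i`-th string (strings are numbered from `0`). -/
def endX (μ : ℕ) (i : Fin μ) : ℝ := ((i : ℝ) + 1) / ((μ : ℝ) + 1)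

/-- The unit vector in the `z`-direction. -/
def ez : E3 := !₂[0, 0, 1]

/-- The velocity of a curve that is parametrised by `[0,1]` (one-sided at the end points). -/
def velocity (γ : ℝ → E3) (t : ℝ) : E3 := derivWithin γ (Set.Icc 0 1) t

/-- A framed `μ`-string string link in the solid torus: a smooth proper embedding of
`[0,1] ⊔ ⋯ ⊔ [0,1]` that joins the prescribed points of the base `y = 0` to those of the
top `y = 1`, together with a framing, that is, a smooth vector field along the strings that is
nowhere tangent to them and takes a standard value at the end points.
Only the values at parameters in `[0,1]` are relevant. -/
structure FramedStringLink (μ : ℕ) where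
  /-- the strings -/
  strand : Fin μ → ℝ → E3
  /-- the framing vector field along the strings -/
  framing : Fin μ → ℝ → E3
  smooth_strand : ∀ i, ContDiffOn ℝ ∞ (strand i) (Set.Icc 0 1)
  smooth_framing : ∀ i, ContDiffOn ℝ ∞ (framing i) (Set.Icc 0 1)
  injective : ∀ i j, ∀ s ∈ Set.Icc (0 : ℝ) 1, ∀ t ∈ Set.Icc (0 : ℝ) 1,
    strand i s = strand j t → i = j ∧ s = t
  mem_solidTorus : ∀ i, ∀ t ∈ Set.Icc (0 : ℝ) 1, strand i t ∈ solidTorus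
  mem_interior : ∀ i, ∀ t ∈ Set.Ioo (0 : ℝ) 1, strand i t ∈ interior solidTorus
  strand_zero : ∀ i, strand i 0 = !₂[endX μ i, 0, 1 / 2]
  strand_one : ∀ i, strand i 1 = !₂[endX μ i, 1, 1 / 2]
  immersed_framed : ∀ i, ∀ t ∈ Set.Icc (0 : ℝ) 1,
    LinearIndependent ℝ ![velocity (strand i) t, framing i t]
  framing_zero : ∀ i, framing i 0 = ez
  framing_one : ∀ i, framing i 1 = ez

namespace FramedStringLink

variable {μ : ℕ}

/-- Framed isotopy in the solid torus: a smooth one-parameter family of framed string links. -/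
def Isotopic (T T' : FramedStringLink μ) : Prop :=
  ∃ F : ℝ → FramedStringLink μ,
    (∀ i, ContDiffOn ℝ ∞ (fun p : ℝ × ℝ => (F p.1).strand i p.2)
      (Set.Icc (0 : ℝ) 1 ×ˢ Set.Icc (0 : ℝ) 1)) ∧
    (∀ i, ContDiffOn ℝ ∞ (fun p : ℝ × ℝ => (F p.1).framing i p.2)
      (Set.Icc (0 : ℝ) 1 ×ˢ Set.Icc (0 : ℝ) 1)) ∧
    (∀ i, ∀ t ∈ Set.Icc (0 : ℝ) 1,
      (F 0).strand i t = T.strand i t ∧ (F 0).framing i t = T.framing i t) ∧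
    (∀ i, ∀ t ∈ Set.Icc (0 : ℝ) 1,
      (F 1).strand i t = T'.strand i t ∧ (F 1).framing i t = T'.framing i t)

/-! ### Diagrams -/

/-- The points `(i, s)` and `(j, t)` of the strings have the same projection to the
`x`-`y` plane. -/
def SameProjection (D : FramedStringLink μ) (a b : Fin μ × ℝ) : Prop :=
  D.strand a.1 a.2 0 = D.strand b.1 b.2 0 ∧ D.strand a.1 a.2 1 = D.strand b.1 b.2 1

/-- The determinant of the projections to the `x`-`y` plane of the velocities at `(i, s)` and
at `(j, t)`. -/
def projDet (D : FramedStringLink μ) (a b : Fin μ × ℝ) : ℝ :=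
  velocity (D.strand a.1) a.2 0 * velocity (D.strand b.1) b.2 1 -
    velocity (D.strand a.1) a.2 1 * velocity (D.strand b.1) b.2 0

/-- Ordered pairs of distinct points of the strings with the same projection. -/
def doublePoints (D : FramedStringLink μ) : Set ((Fin μ × ℝ) × (Fin μ × ℝ)) :=
  {q | q.1.2 ∈ Set.Icc (0 : ℝ) 1 ∧ q.2.2 ∈ Set.Icc (0 : ℝ) 1 ∧ q.1 ≠ q.2 ∧
    D.SameProjection q.1 q.2}

/-- `D` is (the link given by) a blackboard-framed diagram in general position, also with respect
to the meridional disc. The blackboard framing is the vertical one, pointing at the viewer (the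
parallels that it defines agree, up to a rotation about the strings, with those in the plane of
projection); since a framing is nowhere tangent, the projected strings are then immersed. -/
structure IsDiagram (D : FramedStringLink μ) : Prop where
  blackboard : ∀ i, ∀ t ∈ Set.Icc (0 : ℝ) 1, D.framing i t = ez
  finite_doublePoints : D.doublePoints.Finite
  transverse : ∀ q ∈ D.doublePoints, D.projDet q.1 q.2 ≠ 0
  no_triple : ∀ a b c, (a, b) ∈ D.doublePoints → (a, c) ∈ D.doublePoints → b = c
  finite_disc : ∀ i, {t ∈ Set.Icc (0 : ℝ) 1 | D.strand i t ∈ meridionalDisc}.Finite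
  transverse_disc : ∀ i, ∀ t ∈ Set.Icc (0 : ℝ) 1, D.strand i t ∈ meridionalDisc →
    velocity (D.strand i) t 1 ≠ 0
  double_notMem_disc : ∀ q ∈ D.doublePoints, D.strand q.1.1 q.1.2 ∉ meridionalDisc

/-- `D` is a diagram (as above) of the framed string link `T`. -/
def IsDiagramOf (D T : FramedStringLink μ) : Prop := D.IsDiagram ∧ D.Isotopic T

/-- The algebraic intersection with the meridional disc of the part of the `i`-th string with
parameters between `a` and `b`: intersections are counted with `+1` where `y` increases and
with `-1` where `y` decreases. -/
def discIntersection (D : FramedStringLink μ) (i : Fin μ) (a b : ℝ) : ℤ :=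
  ∑ᶠ t ∈ {t ∈ Set.Ioo a b | D.strand i t ∈ meridionalDisc},
    (SignType.sign (velocity (D.strand i) t 1) : ℤ)

/-- The string links that lift to the universal cyclic cover: every component has algebraic
intersection zero with the meridional disc, for diagrams in general position. -/
def IsSpecial (T : FramedStringLink μ) : Prop :=
  ∀ D : FramedStringLink μ, D.IsDiagramOf T → ∀ i, D.discIntersection i 0 1 = 0

/-- The crossings of the strings `i` and `j`, as pairs of parameters. For a self-crossing
the first passage through the crossing comes first. -/
def crossings (D : FramedStringLink μ) (i j : Fin μ) : Set (ℝ × ℝ) :=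
  {c | c.1 ∈ Set.Icc (0 : ℝ) 1 ∧ c.2 ∈ Set.Icc (0 : ℝ) 1 ∧ (i = j → c.1 < c.2) ∧
    D.SameProjection (i, c.1) (j, c.2)}

/-- The sign of a crossing: positive if the direction of the upper string is turned to that of
the lower one counter-clockwise (by an angle less than `π`). -/
def crossingSign (D : FramedStringLink μ) (i j : Fin μ) (c : ℝ × ℝ) : ℤ :=
  SignType.sign ((D.strand i c.1 2 - D.strand j c.2 2) * D.projDet (i, c.1) (j, c.2))

/-- `ε(i, j, c)`: the algebraic intersection with the meridional disc of the path along `i` from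
the base to `c` and then along `j` from `c` to the top. -/
def crossingExponent (D : FramedStringLink μ) (i j : Fin μ) (c : ℝ × ℝ) : ℤ :=
  D.discIntersection i 0 c.1 + D.discIntersection j c.2 1

open LaurentPolynomial in
/-- The winding matrix of a diagram. -/
def windingMatrix (D : FramedStringLink μ) : Matrix (Fin μ) (Fin μ) (LaurentPolynomial ℚ) :=
  Matrix.of fun i j =>
    if i ≠ j then
      ∑ᶠ c ∈ D.crossings i j,
        C ((1 / 2 : ℚ) * (D.crossingSign i j c : ℚ)) * T (D.crossingExponent i j c)
    else
      ∑ᶠ c ∈ D.crossings i i,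
        C ((1 / 2 : ℚ) * (D.crossingSign i i c : ℚ)) *
          (T (D.crossingExponent i i c) + T (-D.crossingExponent i i c))

/-! ### Closure of a string link on the left -/

/-- The closing arc of the `i`-th string, with parameter `u` in `[0,1]`: the arc of the circle with
centre `(0, 1/2)` in the plane `z = 1/2` that leads counter-clockwise from the upper end point
`(endX μ i, 1)`, outside the cube and around its left side, to the lower end point
`(endX μ i, 0)`. Arcs of different strings are concentric, hence disjoint. -/
def closingArc (μ : ℕ) (i : Fin μ) (u : ℝ) : E3 :=
  let R := √((endX μ i) ^ 2 + (1 / 2) ^ 2)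
  let α := Real.arctan ((1 / 2) / endX μ i)
  let φ := α + u * (2 * Real.pi - 2 * α)
  !₂[R * Real.cos φ, 1 / 2 + R * Real.sin φ, 1 / 2]

/-- The closed components `K_i`, with parameter in `[0,2]`: the string for parameters in `[0,1]`,
the closing arc for parameters in `[1,2]`. They lie in the solid torus `(ℝ² ∖ axis) × ℝ`, which
is the given solid torus enlarged by an open collar. -/
def closedStrand (T : FramedStringLink μ) (i : Fin μ) (t : ℝ) : E3 :=
  if t ≤ 1 then T.strand i t else closingArc μ i (t - 1)

/-- The framing of the closed component: the blackboard framing on the closing arc. -/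
def closedFraming (T : FramedStringLink μ) (i : Fin μ) (t : ℝ) : E3 :=
  if t ≤ 1 then T.framing i t else ez

end FramedStringLink

/-! ### The universal cyclic cover and linking numbers -/

/-- The universal cyclic cover `ℝ³ → ℝ³ ∖ {x = y = 1/2}` of the (enlarged) solid torus, in
logarithmic polar coordinates `q = (log r, θ, z)` about the axis `x = y = 1/2` of the hole. It
preserves orientations. The preimages of the half-plane that contains the meridional disc are the
planes `θ = 2πk`, `k ∈ ℤ`. -/
def coverMap (q : E3) : E3 :=
  !₂[1 / 2 + Real.exp (q 0) * Real.cos (q 1), 1 / 2 + Real.exp (q 0) * Real.sin (q 1), q 2]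

/-- The action of `t ^ m`: a path that crosses the meridional disc once, in the direction of
increasing `y`, and returns to its starting point lifts to a path from a point `q` to `t q`. -/
def deckTranslate (m : ℤ) (q : E3) : E3 := !₂[q 0, q 1 + 2 * Real.pi * (m : ℝ), q 2]

/-- The lift of a tangent vector `v` at `coverMap q` to a tangent vector at `q`. -/
def liftVector (q v : E3) : E3 :=
  !₂[Real.exp (-q 0) * (Real.cos (q 1) * v 0 + Real.sin (q 1) * v 1),
    Real.exp (-q 0) * (-Real.sin (q 1) * v 0 + Real.cos (q 1) * v 1), v 2]

/-- `liftVector q v` is mapped to `v` by the differential of the covering. -/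
theorem hasDerivAt_coverMap_liftVector (q v : E3) :
    HasDerivAt (fun ε : ℝ => coverMap (q + ε • liftVector q v)) v 0 := by
  rw [hasDerivAt_iff_hasFDerivAt, ← hasFDerivWithinAt_univ, hasFDerivWithinAt_euclidean]
  have h0 : HasDerivAt (fun ε : ℝ => q 0 + ε * liftVector q v 0) (liftVector q v 0) 0 := by
    simpa using ((hasDerivAt_id (0 : ℝ)).mul_const (liftVector q v 0)).const_add (q 0)
  have h1 : HasDerivAt (fun ε : ℝ => q 1 + ε * liftVector q v 1) (liftVector q v 1) 0 := by
    simpa using ((hasDerivAt_id (0 : ℝ)).mul_const (liftVector q v 1)).const_add (q 1)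
  have h2 : HasDerivAt (fun ε : ℝ => q 2 + ε * liftVector q v 2) (liftVector q v 2) 0 := by
    simpa using ((hasDerivAt_id (0 : ℝ)).mul_const (liftVector q v 2)).const_add (q 2)
  have hc := Real.sin_sq_add_cos_sq (q 1)
  have he : Real.exp (q 0) * Real.exp (-q 0) = 1 := by rw [← Real.exp_add]; simp
  intro k
  suffices h : HasDerivAt (fun ε : ℝ => coverMap (q + ε • liftVector q v) k) (v k) 0 by
    rw [hasFDerivWithinAt_univ]
    refine h.hasFDerivAt.congr_fderiv ?_
    ext
    simp
  fin_cases k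
  · have h := (h0.exp.mul h1.cos).const_add (1 / 2)
    refine (h.congr_deriv ?_).congr_of_eventuallyEq (Filter.Eventually.of_forall fun ε => ?_)
    · simp only [liftVector, PiLp.toLp_apply, Matrix.cons_val_zero, Matrix.cons_val_one,
        zero_mul, add_zero]
      simp only [Fin.zero_eta]
      linear_combination (v 0 * Real.exp (q 0) * Real.exp (-q 0)) * hc + v 0 * he
    · simp [coverMap]
  · have h := (h0.exp.mul h1.sin).const_add (1 / 2)
    refine (h.congr_deriv ?_).congr_of_eventuallyEq (Filter.Eventually.of_forall fun ε => ?_)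
    · simp only [liftVector, PiLp.toLp_apply, Matrix.cons_val_zero, Matrix.cons_val_one,
        zero_mul, add_zero]
      simp only [Fin.mk_one]
      linear_combination (v 1 * Real.exp (q 0) * Real.exp (-q 0)) * hc + v 1 * he
    · simp [coverMap]
  · refine (h2.congr_deriv ?_).congr_of_eventuallyEq (Filter.Eventually.of_forall fun ε => ?_)
    · simp [liftVector]
    · simp [coverMap]

/-- The Gauss linking integral
`(1 / 4π) ∮ ∮ det (α s - β t, α' s, β' t) / |α s - β t|³` of two piecewise smooth closed curves
that are parametrised by `[0,2]`. -/
def gaussIntegral (α β : ℝ → E3) : ℝ :=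
  (1 / (4 * Real.pi)) * ∫ s in (0 : ℝ)..2, ∫ t in (0 : ℝ)..2,
    (Matrix.of ![(α s - β t).ofLp, (deriv α s).ofLp, (deriv β t).ofLp]).det / ‖α s - β t‖ ^ 3

/-- `n` is the linking number of the disjoint closed curves `α` and `β` in `ℝ³`. -/
def IsLinkingNumber (α β : ℝ → E3) (n : ℤ) : Prop :=
  α 2 = α 0 ∧ β 2 = β 0 ∧
    (∀ s ∈ Set.Icc (0 : ℝ) 2, ∀ t ∈ Set.Icc (0 : ℝ) 2, α s ≠ β t) ∧
    gaussIntegral α β = (n : ℝ)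

/-- `n` is the self-linking number of the closed curve `α` with the framing `v`: its linking number
with all sufficiently close parallels `α + ε v`. -/
def IsFramedSelfLinkingNumber (α v : ℝ → E3) (n : ℤ) : Prop :=
  ∃ ε₀ > 0, ∀ ε : ℝ, 0 < ε → ε < ε₀ → IsLinkingNumber α (fun t => α t + ε • v t) n

namespace FramedStringLink

variable {μ : ℕ}

/-- `K` consists of simultaneous lifts of the closed components to the universal cyclic cover. The
freedom in the choice is that of one common translation: all closing arcs are lifted to the same
sheet `2πk < θ < 2π(k + 1)` of the complement of the lifted half-planes (each arc is disjoint
from the half-plane that contains the meridional disc). -/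
def IsLift (T : FramedStringLink μ) (k : ℤ) (K : Fin μ → ℝ → E3) : Prop :=
  ∀ i, ContinuousOn (K i) (Set.Icc 0 2) ∧
    (∀ t ∈ Set.Icc (0 : ℝ) 2, coverMap (K i t) = T.closedStrand i t) ∧
    K i 0 1 ∈ Set.Ioo (2 * Real.pi * (k : ℝ)) (2 * Real.pi * ((k : ℝ) + 1))

/-- `L` is the equivariant linking matrix of the lifted components `K`: the coefficient of `t ^ m`
in `L i j` is the linking number of `K i` and `t ^ m (K j)`. For `i = j`, `m = 0` this is the
self-linking number given by the lifted framing. -/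
def IsEquivariantLinkingMatrix (T : FramedStringLink μ) (K : Fin μ → ℝ → E3)
    (L : Matrix (Fin μ) (Fin μ) (LaurentPolynomial ℤ)) : Prop :=
  ∀ (i j : Fin μ) (m : ℤ),
    (¬(i = j ∧ m = 0) →
      IsLinkingNumber (K i) (fun t => deckTranslate m (K j t)) ((L i j).coeff m)) ∧
    (i = j ∧ m = 0 →
      IsFramedSelfLinkingNumber (K i) (fun t => liftVector (K i t) (T.closedFraming i t))
        ((L i j).coeff m))

end FramedStringLink

end

/-!
# The winding matrix of a string link is its equivariant linking matrix

The winding matrix counts crossings of a planar diagram, each with a power of `t` that records how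
the two strands wind around the hole. In logarithmic polar coordinates around the hole the cyclic
cover is `ℝ³` (with the deck transformations `θ ↦ θ + 2πm`), and the covering maps planar crossings
of a lift `K i` with a translated lift `t ^ m K j` bijectively, with their signs, to the crossings
of the strings `i` and `j` with exponent `m`. So the coefficient of `t ^ m` on both sides is half a
sum of signs of crossings, once linking numbers are known to be computed by planar crossings.

*Linking numbers.* They are given by Gauss integrals. The solid angle form is closed
(`gaussKernel_closed`), so by Stokes' theorem the Gauss integral does not change during a homotopy
of disjoint closed curves (`IsLoopHomotopy.gaussIntegral_eq`). In particular it does not change when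
heights are multiplied by `l`. As `l` tends to `0` the integrand concentrates at the planar
crossings, each of which contributes half its sign (`IsSmoothLoop.gaussIntegral_eq_sum_sign`). The
result is an integer, since two closed plane curves have algebraic intersection number zero
(`IsSmoothLoop.even_sum_sign`).

*Self-linking.* Near the diagonal the flattened integrand for a curve and its vertical parallel is
not dominated by an integrable function. But the parallels above and below the curve have the same
linking number with it, and the leading singular terms of the two integrands cancel in their sum
(`abs_symm_flatKernel_le`). Hence the self-linking number of a blackboard-framed closed curve is its
writhe (`HasPlanarDoublePoints.gaussIntegral_parallel`). The components of the closure have corners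
where the closing arcs are attached, and these are allowed throughout.

*Lifts.* Lifts exist because the exponential is a covering. The sheet that contains a point of a
lift changes by the algebraic intersection with the meridional disc (`IsDiagram.sheet_eq`). This
shows that the lifts are closed exactly when all intersection numbers vanish
(`IsDiagram.liftClosed_iff`), and identifies the exponent of a crossing (`IsLift.doublePoint`,
`IsLift.planar_eq`). A self-crossing of `i` with exponent `ε` appears as two ordered pairs, with
exponents `ε` and `-ε` (`IsDiagram.signSum_self`), which accounts for the diagonal entries of the
winding matrix. Together this proves the theorem for the blackboard framed diagram itself
(`IsLift.exists_matrix`).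

*Isotopy.* An isotopy lifts to a homotopy of the lifted components
(`IsSmoothFamily.exists_familyLift`), during which distinct translates remain disjoint. By
compactness, the components are also separated from their small parallels, uniformly in time
(`IsFramedLoopHomotopy.exists_separated`). So all linking and self-linking numbers are preserved
(`IsEquivariantLinkingMatrix.of_isotopic`), which carries the theorem from a diagram to every string
link isotopic to it and shows that the winding matrix is an isotopy invariant.
-/

section

open Set Filter Topology MeasureTheory

noncomputable section

/-! ### The Gauss kernel -/

/-- The determinant with rows `a`, `b`, `c`. -/
def tripleProd (a b c : E3) : ℝ :=
  a 0 * (b 1 * c 2 - b 2 * c 1) - a 1 * (b 0 * c 2 - b 2 * c 0) + a 2 * (b 0 * c 1 - b 1 * c 0)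

/-- The solid angle form `det (r, a, b) / |r|³` at `r`. -/
def gaussKernel (r a b : E3) : ℝ := tripleProd r a b / ‖r‖ ^ 3

theorem det_eq_tripleProd (a b c : E3) :
    (Matrix.of ![a.ofLp, b.ofLp, c.ofLp]).det = tripleProd a b c := by
  rw [Matrix.det_fin_three]
  simp [tripleProd]
  ring

theorem gaussIntegral_eq (α β : ℝ → E3) :
    gaussIntegral α β = (1 / (4 * Real.pi)) * ∫ s in (0 : ℝ)..2, ∫ t in (0 : ℝ)..2,
      gaussKernel (α s - β t) (deriv α s) (deriv β t) := by
  simp only [gaussIntegral, gaussKernel, det_eq_tripleProd]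

theorem norm_sq_eq_coords (r : E3) : ‖r‖ ^ 2 = r 0 ^ 2 + r 1 ^ 2 + r 2 ^ 2 := by
  rw [EuclideanSpace.real_norm_sq_eq, Fin.sum_univ_three]

theorem continuous_tripleProd :
    Continuous fun p : E3 × E3 × E3 => tripleProd p.1 p.2.1 p.2.2 := by
  unfold tripleProd; fun_prop

theorem ContinuousOn.gaussKernel {X : Type*} [TopologicalSpace X] {S : Set X} {f g h : X → E3}
    (hf : ContinuousOn f S) (hg : ContinuousOn g S) (hh : ContinuousOn h S)
    (h0 : ∀ x ∈ S, f x ≠ 0) : ContinuousOn (fun x => gaussKernel (f x) (g x) (h x)) S := by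
  refine ContinuousOn.div ?_ (by fun_prop) fun x hx => ?_
  · exact continuous_tripleProd.comp_continuousOn (hf.prodMk (hg.prodMk hh))
  · exact pow_ne_zero _ (norm_ne_zero_iff.2 (h0 x hx))

theorem HasDerivAt.coord {f : ℝ → E3} {f' : E3} {x : ℝ} (h : HasDerivAt f f' x) (i : Fin 3) :
    HasDerivAt (fun y => f y i) (f' i) x :=
  ((EuclideanSpace.proj (𝕜 := ℝ) i).hasFDerivAt (x := f x)).comp_hasDerivAt x h

theorem HasDerivAt.tripleProd {f g h : ℝ → E3} {f' g' h' : E3} {x : ℝ} (hf : HasDerivAt f f' x)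
    (hg : HasDerivAt g g' x) (hh : HasDerivAt h h' x) :
    HasDerivAt (fun y => tripleProd (f y) (g y) (h y))
      (tripleProd f' (g x) (h x) + tripleProd (f x) g' (h x) + tripleProd (f x) (g x) h') x := by
  have e := (((hf.coord 0).mul (((hg.coord 1).mul (hh.coord 2)).sub
    ((hg.coord 2).mul (hh.coord 1)))).sub ((hf.coord 1).mul (((hg.coord 0).mul (hh.coord 2)).sub
    ((hg.coord 2).mul (hh.coord 0))))).add ((hf.coord 2).mul (((hg.coord 0).mul (hh.coord 1)).sub
    ((hg.coord 1).mul (hh.coord 0))))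
  refine e.congr_deriv ?_
  simp only [_root_.tripleProd, Pi.mul_apply, Pi.sub_apply]
  ring

/-- The Euclidean inner product in coordinates. -/
def dot3 (a b : E3) : ℝ := a 0 * b 0 + a 1 * b 1 + a 2 * b 2

theorem HasDerivAt.norm3 {f : ℝ → E3} {f' : E3} {x : ℝ} (hf : HasDerivAt f f' x) (h0 : f x ≠ 0) :
    HasDerivAt (fun y => ‖f y‖) (dot3 (f x) f' / ‖f x‖) x := by
  have h := hf.norm_sq.sqrt (by positivity)
  simp only [Real.sqrt_sq (norm_nonneg _)] at h
  refine h.congr_deriv ?_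
  have : Inner.inner ℝ (f x) f' = dot3 (f x) f' := by
    rw [PiLp.inner_apply, Fin.sum_univ_three]; simp [dot3]; ring
  rw [this]
  field_simp

theorem HasDerivAt.gaussKernel {f g h : ℝ → E3} {f' g' h' : E3} {x : ℝ} (hf : HasDerivAt f f' x)
    (hg : HasDerivAt g g' x) (hh : HasDerivAt h h' x) (h0 : f x ≠ 0) :
    HasDerivAt (fun y => gaussKernel (f y) (g y) (h y))
      ((_root_.tripleProd f' (g x) (h x) + _root_.tripleProd (f x) g' (h x) +
        _root_.tripleProd (f x) (g x) h') / ‖f x‖ ^ 3 -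
        3 * dot3 (f x) f' * _root_.tripleProd (f x) (g x) (h x) / ‖f x‖ ^ 5) x := by
  have hn : ‖f x‖ ≠ 0 := norm_ne_zero_iff.2 h0
  refine ((hf.tripleProd hg hh).div ((hf.norm3 h0).pow 3) (pow_ne_zero _ hn)).congr_deriv ?_
  simp only [Pi.pow_apply]
  field_simp
  norm_num
  ring

/-- The solid angle form is closed; here `m₁`, `m₂`, `m₃` stand for the mixed second derivatives
of `r`. -/
theorem gaussKernel_closed (r a b c m₁ m₂ m₃ : E3) (h0 : r ≠ 0) :
    ((tripleProd a b c + tripleProd r m₃ c + tripleProd r b m₂) / ‖r‖ ^ 3 -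
        3 * dot3 r a * tripleProd r b c / ‖r‖ ^ 5) +
      ((tripleProd b c a + tripleProd r m₁ a + tripleProd r c m₃) / ‖r‖ ^ 3 -
        3 * dot3 r b * tripleProd r c a / ‖r‖ ^ 5) +
      ((tripleProd c a b + tripleProd r m₂ b + tripleProd r a m₁) / ‖r‖ ^ 3 -
        3 * dot3 r c * tripleProd r a b / ‖r‖ ^ 5) = 0 := by
  have hn : ‖r‖ ≠ 0 := norm_ne_zero_iff.2 h0
  have h2 := norm_sq_eq_coords r
  have key : dot3 r a * tripleProd r b c + dot3 r b * tripleProd r c a +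
      dot3 r c * tripleProd r a b = ‖r‖ ^ 2 * tripleProd a b c := by
    rw [h2]; simp only [dot3, tripleProd]; ring
  have e1 : tripleProd b c a = tripleProd a b c := by simp only [tripleProd]; ring
  have e2 : tripleProd c a b = tripleProd a b c := by simp only [tripleProd]; ring
  have e3 : tripleProd r c m₃ = - tripleProd r m₃ c := by simp only [tripleProd]; ring
  have e4 : tripleProd r a m₁ = - tripleProd r m₁ a := by simp only [tripleProd]; ring
  have e5 : tripleProd r m₂ b = - tripleProd r b m₂ := by simp only [tripleProd]; ring
  rw [e1, e2, e3, e4, e5]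
  field_simp
  linear_combination (-3 : ℝ) * key

/-! ### Invariance of the Gauss integral under homotopies of disjoint curves -/

/-- The patch `[0,1] × [a,b]`, with the time of a homotopy as first coordinate. -/
def patch (a b : ℝ) : Set (ℝ × ℝ) := Icc (0 : ℝ) 1 ×ˢ Icc a b

theorem uniqueDiffOn_patch {a b : ℝ} (hab : a < b) : UniqueDiffOn ℝ (patch a b) :=
  (uniqueDiffOn_Icc zero_lt_one).prod (uniqueDiffOn_Icc hab)

/-- The time derivative of a homotopy, within a patch. -/
def timeDeriv (a b : ℝ) (A : ℝ × ℝ → E3) (p : ℝ × ℝ) : E3 := fderivWithin ℝ A (patch a b) p (1, 0)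

/-- The velocity of the curves of a homotopy, within a patch. -/
def curveDeriv (a b : ℝ) (A : ℝ × ℝ → E3) (p : ℝ × ℝ) : E3 := fderivWithin ℝ A (patch a b) p (0, 1)

section Patch

variable {a b : ℝ} {A : ℝ × ℝ → E3}

theorem contDiffOn_timeDeriv (hab : a < b) (hA : ContDiffOn ℝ ∞ A (patch a b)) :
    ContDiffOn ℝ ∞ (timeDeriv a b A) (patch a b) :=
  (hA.fderivWithin (m := ∞) (uniqueDiffOn_patch hab) (by simp)).clm_apply contDiffOn_const

theorem contDiffOn_curveDeriv (hab : a < b) (hA : ContDiffOn ℝ ∞ A (patch a b)) :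
    ContDiffOn ℝ ∞ (curveDeriv a b A) (patch a b) :=
  (hA.fderivWithin (m := ∞) (uniqueDiffOn_patch hab) (by simp)).clm_apply contDiffOn_const

theorem hasDerivWithinAt_timeDeriv (hA : ContDiffOn ℝ ∞ A (patch a b))
    {u s : ℝ} (h : (u, s) ∈ patch a b) :
    HasDerivWithinAt (fun v => A (v, s)) (timeDeriv a b A (u, s)) (Icc 0 1) u := by
  have h1 := ((hA.differentiableOn (by simp)) (u, s) h).hasFDerivWithinAt
  have h2 : HasDerivWithinAt (fun v : ℝ => (v, s)) ((1 : ℝ), (0 : ℝ)) (Icc 0 1) u :=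
    ((hasDerivAt_id u).prodMk (hasDerivAt_const u s)).hasDerivWithinAt
  exact HasFDerivWithinAt.comp_hasDerivWithinAt (f := fun v => (v, s)) u h1 h2
    fun v hv => ⟨hv, h.2⟩

theorem hasDerivWithinAt_curveDeriv (hA : ContDiffOn ℝ ∞ A (patch a b))
    {u s : ℝ} (h : (u, s) ∈ patch a b) :
    HasDerivWithinAt (fun v => A (u, v)) (curveDeriv a b A (u, s)) (Icc a b) s := by
  have h1 := ((hA.differentiableOn (by simp)) (u, s) h).hasFDerivWithinAt
  have h2 : HasDerivWithinAt (fun v : ℝ => (u, v)) ((0 : ℝ), (1 : ℝ)) (Icc a b) s :=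
    ((hasDerivAt_const s u).prodMk (hasDerivAt_id s)).hasDerivWithinAt
  exact HasFDerivWithinAt.comp_hasDerivWithinAt (f := fun v => (u, v)) s h1 h2
    fun v hv => ⟨h.1, hv⟩

theorem deriv_eq_curveDeriv (hA : ContDiffOn ℝ ∞ A (patch a b))
    {u s : ℝ} (hu : u ∈ Icc (0 : ℝ) 1) (hs : s ∈ Ioo a b) :
    deriv (fun v => A (u, v)) s = curveDeriv a b A (u, s) :=
  ((hasDerivWithinAt_curveDeriv hA ⟨hu, Ioo_subset_Icc_self hs⟩).hasDerivAt
    (Icc_mem_nhds hs.1 hs.2)).deriv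

theorem patch_mem_nhds {p : ℝ × ℝ} (hp : p ∈ Ioo (0 : ℝ) 1 ×ˢ Ioo a b) : patch a b ∈ 𝓝 p :=
  prod_mem_nhds (Icc_mem_nhds hp.1.1 hp.1.2) (Icc_mem_nhds hp.2.1 hp.2.2)

/-- At interior points the two mixed second derivatives of a homotopy exist and agree. -/
theorem exists_mixedDeriv (hA : ContDiffOn ℝ ∞ A (patch a b)) {u s : ℝ} (hu : u ∈ Ioo (0 : ℝ) 1)
    (hs : s ∈ Ioo a b) : ∃ M : E3, HasDerivAt (fun v => curveDeriv a b A (v, s)) M u ∧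
      HasDerivAt (fun v => timeDeriv a b A (u, v)) M s := by
  have hp : patch a b ∈ 𝓝 (u, s) := patch_mem_nhds ⟨hu, hs⟩
  have hc : ContDiffAt ℝ ∞ A (u, s) := hA.contDiffAt hp
  have hsymm : IsSymmSndFDerivAt ℝ A (u, s) := hc.isSymmSndFDerivAt (by simp; norm_cast)
  have hd : DifferentiableAt ℝ (fderiv ℝ A) (u, s) :=
    (hc.fderiv_right (m := 1) (by norm_cast)).differentiableAt (by simp)
  have hev : ∀ᶠ q in 𝓝 (u, s), fderivWithin ℝ A (patch a b) q = fderiv ℝ A q := by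
    filter_upwards [eventually_mem_nhds_iff.2 hp] with q hq using fderivWithin_of_mem_nhds hq
  have hh : ∀ v : ℝ × ℝ, HasFDerivAt (fun q => fderivWithin ℝ A (patch a b) q v)
      ((fderiv ℝ (fderiv ℝ A) (u, s)).flip v) (u, s) := by
    intro v
    have := hd.hasFDerivAt.clm_apply (hasFDerivAt_const v (u, s))
    refine (this.congr_of_eventuallyEq ?_).congr_fderiv ?_
    · filter_upwards [hev] with q hq using by rw [hq]
    · ext w; all_goals simp
  refine ⟨fderiv ℝ (fderiv ℝ A) (u, s) (1, 0) (0, 1), ?_, ?_⟩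
  · exact (hh (0, 1)).comp_hasDerivAt u (f := fun v => (v, s))
      ((hasDerivAt_id u).prodMk (hasDerivAt_const u s))
  · rw [hsymm.eq]
    exact (hh (1, 0)).comp_hasDerivAt s (f := fun v => (u, v))
      ((hasDerivAt_const s u).prodMk (hasDerivAt_id s))

end Patch

/-- The three components of the pulled back solid angle form on the box of the `(u, s, t)` with
`(u, s)` and `(u, t)` in the patches: the coefficients of `ds ∧ dt`, `dt ∧ du` and `du ∧ ds`. -/
def boxField (a b c d : ℝ) (A B : ℝ × ℝ → E3) : Fin 3 → (Fin 3 → ℝ) → ℝ :=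
  ![fun x => gaussKernel (A (x 0, x 1) - B (x 0, x 2))
      (curveDeriv a b A (x 0, x 1)) (-curveDeriv c d B (x 0, x 2)),
    fun x => gaussKernel (A (x 0, x 1) - B (x 0, x 2)) (-curveDeriv c d B (x 0, x 2))
      (timeDeriv a b A (x 0, x 1) - timeDeriv c d B (x 0, x 2)),
    fun x => gaussKernel (A (x 0, x 1) - B (x 0, x 2))
      (timeDeriv a b A (x 0, x 1) - timeDeriv c d B (x 0, x 2)) (curveDeriv a b A (x 0, x 1))]

theorem mem_Icc_fin3 {a b c d : ℝ} {x : Fin 3 → ℝ} :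
    x ∈ Icc (![0, a, c] : Fin 3 → ℝ) ![1, b, d] ↔
      (x 0, x 1) ∈ patch a b ∧ (x 0, x 2) ∈ patch c d := by
  simp [Set.mem_Icc, Pi.le_def, Fin.forall_fin_succ, patch]
  tauto

theorem continuousOn_boxField {a b c d : ℝ} {A B : ℝ × ℝ → E3} (hab : a < b) (hcd : c < d)
    (hA : ContDiffOn ℝ ∞ A (patch a b)) (hB : ContDiffOn ℝ ∞ B (patch c d))
    (h0 : ∀ u ∈ Icc (0 : ℝ) 1, ∀ s ∈ Icc a b, ∀ t ∈ Icc c d, A (u, s) ≠ B (u, t)) (i : Fin 3) :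
    ContinuousOn (boxField a b c d A B i) (Icc ![0, a, c] ![1, b, d]) := by
  have l1 : ContinuousOn (fun x : Fin 3 → ℝ => (x 0, x 1)) (Icc ![0, a, c] ![1, b, d]) := by
    fun_prop
  have l2 : ContinuousOn (fun x : Fin 3 → ℝ => (x 0, x 2)) (Icc ![0, a, c] ![1, b, d]) := by
    fun_prop
  have m1 : MapsTo (fun x : Fin 3 → ℝ => (x 0, x 1)) (Icc ![0, a, c] ![1, b, d]) (patch a b) :=
    fun x hx => (mem_Icc_fin3.1 hx).1
  have m2 : MapsTo (fun x : Fin 3 → ℝ => (x 0, x 2)) (Icc ![0, a, c] ![1, b, d]) (patch c d) :=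
    fun x hx => (mem_Icc_fin3.1 hx).2
  have cr := (hA.continuousOn.comp l1 m1).sub (hB.continuousOn.comp l2 m2)
  have cs := (contDiffOn_curveDeriv hab hA).continuousOn.comp l1 m1
  have ct := ((contDiffOn_curveDeriv hcd hB).continuousOn.comp l2 m2).neg
  have cu := ((contDiffOn_timeDeriv hab hA).continuousOn.comp l1 m1).sub
    ((contDiffOn_timeDeriv hcd hB).continuousOn.comp l2 m2)
  have hne : ∀ x ∈ Icc (![0, a, c] : Fin 3 → ℝ) ![1, b, d],
      A (x 0, x 1) - B (x 0, x 2) ≠ 0 := fun x hx => by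
    obtain ⟨h1, h2⟩ := mem_Icc_fin3.1 hx
    exact sub_ne_zero.2 (h0 _ h1.1 _ h1.2 _ h2.2)
  fin_cases i
  · exact cr.gaussKernel cs ct hne
  · exact cr.gaussKernel ct cu hne
  · exact cr.gaussKernel cu cs hne

theorem HasFDerivAt.hasDerivAt_update {f : (Fin 3 → ℝ) → ℝ} {f' : (Fin 3 → ℝ) →L[ℝ] ℝ}
    {x : Fin 3 → ℝ} (h : HasFDerivAt f f' x) (i : Fin 3) :
    HasDerivAt (fun v => f (Function.update x i v)) (f' (Pi.single i 1)) (x i) := by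
  have h1 := _root_.hasDerivAt_update x i (x i)
  have h2 : HasFDerivAt f f' (Function.update x i (x i)) := by simpa using h
  exact h2.comp_hasDerivAt (x i) h1

theorem differentiableAt_boxField {a b c d : ℝ} {A B : ℝ × ℝ → E3} (hab : a < b) (hcd : c < d)
    (hA : ContDiffOn ℝ ∞ A (patch a b)) (hB : ContDiffOn ℝ ∞ B (patch c d))
    (h0 : ∀ u ∈ Icc (0 : ℝ) 1, ∀ s ∈ Icc a b, ∀ t ∈ Icc c d, A (u, s) ≠ B (u, t)) (i : Fin 3)
    {x : Fin 3 → ℝ} (hu : x 0 ∈ Ioo (0 : ℝ) 1) (hs : x 1 ∈ Ioo a b) (ht : x 2 ∈ Ioo c d) :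
    DifferentiableAt ℝ (boxField a b c d A B i) x := by
  have p1 : patch a b ∈ 𝓝 (x 0, x 1) := patch_mem_nhds ⟨hu, hs⟩
  have p2 : patch c d ∈ 𝓝 (x 0, x 2) := patch_mem_nhds ⟨hu, ht⟩
  have l1 : DifferentiableAt ℝ (fun x : Fin 3 → ℝ => (x 0, x 1)) x := by fun_prop
  have l2 : DifferentiableAt ℝ (fun x : Fin 3 → ℝ => (x 0, x 2)) x := by fun_prop
  have key1 : ∀ {F : ℝ × ℝ → E3}, ContDiffOn ℝ ∞ F (patch a b) →
      DifferentiableAt ℝ (fun x : Fin 3 → ℝ => F (x 0, x 1)) x := fun hF =>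
    DifferentiableAt.comp (f := fun x : Fin 3 → ℝ => (x 0, x 1)) x
      ((hF.contDiffAt p1).differentiableAt (by simp)) l1
  have key2 : ∀ {F : ℝ × ℝ → E3}, ContDiffOn ℝ ∞ F (patch c d) →
      DifferentiableAt ℝ (fun x : Fin 3 → ℝ => F (x 0, x 2)) x := fun hF =>
    DifferentiableAt.comp (f := fun x : Fin 3 → ℝ => (x 0, x 2)) x
      ((hF.contDiffAt p2).differentiableAt (by simp)) l2
  have cr := (key1 hA).sub (key2 hB)
  have cs := key1 (contDiffOn_curveDeriv hab hA)
  have ct := (key2 (contDiffOn_curveDeriv hcd hB)).neg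
  have cu := (key1 (contDiffOn_timeDeriv hab hA)).sub (key2 (contDiffOn_timeDeriv hcd hB))
  have hne : A (x 0, x 1) - B (x 0, x 2) ≠ 0 :=
    sub_ne_zero.2 (h0 _ (Ioo_subset_Icc_self hu) _ (Ioo_subset_Icc_self hs) _
      (Ioo_subset_Icc_self ht))
  have main : ∀ {f g h : (Fin 3 → ℝ) → E3}, DifferentiableAt ℝ f x → DifferentiableAt ℝ g x →
      DifferentiableAt ℝ h x → f x ≠ 0 →
      DifferentiableAt ℝ (fun x => gaussKernel (f x) (g x) (h x)) x := by
    intro f g h hf hg hh hf0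
    have co : ∀ {f : (Fin 3 → ℝ) → E3}, DifferentiableAt ℝ f x → ∀ i,
      DifferentiableAt ℝ (fun y => f y i) x := fun hf i =>
        ((EuclideanSpace.proj (𝕜 := ℝ) i).differentiableAt (x := _)).comp x hf
    have := co hf; have := co hg; have := co hh
    have h1 : DifferentiableAt ℝ (fun x => tripleProd (f x) (g x) (h x)) x := by
      unfold tripleProd; fun_prop
    have h2 : DifferentiableAt ℝ (fun x => ‖f x‖ ^ 3) x := (hf.norm ℝ hf0).fun_pow 3
    simp only [gaussKernel, div_eq_mul_inv]
    exact h1.mul (h2.fun_inv (pow_ne_zero _ (norm_ne_zero_iff.2 hf0)))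
  fin_cases i
  · exact main cr cs ct hne
  · exact main cr ct cu hne
  · exact main cr cu cs hne

/-- The divergence of `boxField` vanishes: the solid angle form is closed, and the mixed second
derivatives of the homotopies are symmetric. -/
theorem boxField_divergence {a b c d : ℝ} {A B : ℝ × ℝ → E3} (hab : a < b) (hcd : c < d)
    (hA : ContDiffOn ℝ ∞ A (patch a b)) (hB : ContDiffOn ℝ ∞ B (patch c d))
    (h0 : ∀ u ∈ Icc (0 : ℝ) 1, ∀ s ∈ Icc a b, ∀ t ∈ Icc c d, A (u, s) ≠ B (u, t))
    {x : Fin 3 → ℝ} (hu : x 0 ∈ Ioo (0 : ℝ) 1) (hs : x 1 ∈ Ioo a b) (ht : x 2 ∈ Ioo c d) :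
    ∑ i, fderiv ℝ (boxField a b c d A B i) x (Pi.single i 1) = 0 := by
  have hd := fun i => (differentiableAt_boxField hab hcd hA hB h0 i hu hs ht).hasFDerivAt
  have hd0 := (hd 0).hasDerivAt_update 0
  have hd1 := (hd 1).hasDerivAt_update 1
  have hd2 := (hd 2).hasDerivAt_update 2
  have hu' := Ioo_subset_Icc_self hu
  have hs' := Ioo_subset_Icc_self hs
  have ht' := Ioo_subset_Icc_self ht
  obtain ⟨M, hM1, hM2⟩ := exists_mixedDeriv hA hu hs
  obtain ⟨N, hN1, hN2⟩ := exists_mixedDeriv hB hu ht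
  have au := (hasDerivWithinAt_timeDeriv hA (u := x 0) (s := x 1) ⟨hu', hs'⟩).hasDerivAt
    (Icc_mem_nhds hu.1 hu.2)
  have ds := (hasDerivWithinAt_curveDeriv hA (u := x 0) (s := x 1) ⟨hu', hs'⟩).hasDerivAt
    (Icc_mem_nhds hs.1 hs.2)
  have bu := (hasDerivWithinAt_timeDeriv hB (u := x 0) (s := x 2) ⟨hu', ht'⟩).hasDerivAt
    (Icc_mem_nhds hu.1 hu.2)
  have bt := (hasDerivWithinAt_curveDeriv hB (u := x 0) (s := x 2) ⟨hu', ht'⟩).hasDerivAt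
    (Icc_mem_nhds ht.1 ht.2)
  have hne : A (x 0, x 1) - B (x 0, x 2) ≠ 0 := sub_ne_zero.2 (h0 _ hu' _ hs' _ ht')
  have e0 := (au.sub bu).gaussKernel hM1 hN1.neg hne
  have e1 := (ds.sub_const (B (x 0, x 2))).gaussKernel
    (hasDerivAt_const (x 1) (-curveDeriv c d B (x 0, x 2)))
    (hM2.sub_const (timeDeriv c d B (x 0, x 2))) hne
  have e2 := (bt.const_sub (A (x 0, x 1))).gaussKernel (hN2.const_sub (timeDeriv a b A (x 0, x 1)))
    (hasDerivAt_const (x 2) (curveDeriv a b A (x 0, x 1))) hne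
  have f0 := hd0.unique e0
  have f1 := hd1.unique e1
  have f2 := hd2.unique e2
  rw [Fin.sum_univ_three, f0, f1, f2]
  have := gaussKernel_closed (A (x 0, x 1) - B (x 0, x 2))
    (timeDeriv a b A (x 0, x 1) - timeDeriv c d B (x 0, x 2))
    (curveDeriv a b A (x 0, x 1)) (-curveDeriv c d B (x 0, x 2)) 0 (-N) M hne
  rw [← this]
  rfl

/-- The integral of `h` over a rectangle, in the form in which it occurs on the faces of a box. -/
def rectIntegral (a b c d : ℝ) (h : ℝ → ℝ → ℝ) : ℝ :=
  ∫ x in Icc (![a, c] : Fin 2 → ℝ) ![b, d], h (x 0) (x 1)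

/-- Stokes' theorem for the solid angle form on a box. -/
theorem boxField_stokes {a b c d : ℝ} {A B : ℝ × ℝ → E3} (hab : a < b) (hcd : c < d)
    (hA : ContDiffOn ℝ ∞ A (patch a b)) (hB : ContDiffOn ℝ ∞ B (patch c d))
    (h0 : ∀ u ∈ Icc (0 : ℝ) 1, ∀ s ∈ Icc a b, ∀ t ∈ Icc c d, A (u, s) ≠ B (u, t)) :
    (rectIntegral a b c d (fun s t => boxField a b c d A B 0 ![1, s, t]) -
        rectIntegral a b c d (fun s t => boxField a b c d A B 0 ![0, s, t])) +
      (rectIntegral 0 1 c d (fun u t => boxField a b c d A B 1 ![u, b, t]) -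
        rectIntegral 0 1 c d (fun u t => boxField a b c d A B 1 ![u, a, t])) +
      (rectIntegral 0 1 a b (fun u s => boxField a b c d A B 2 ![u, s, d]) -
        rectIntegral 0 1 a b (fun u s => boxField a b c d A B 2 ![u, s, c])) = 0 := by
  have hle : (![0, a, c] : Fin 3 → ℝ) ≤ ![1, b, d] := by
    intro i; fin_cases i <;> simp [hab.le, hcd.le]
  have hint : ∀ x ∈ (Set.pi univ fun i => Ioo ((![0, a, c] : Fin 3 → ℝ) i) (![1, b, d] i)),
      x 0 ∈ Ioo (0 : ℝ) 1 ∧ x 1 ∈ Ioo a b ∧ x 2 ∈ Ioo c d := by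
    intro x hx
    exact ⟨hx 0 trivial, hx 1 trivial, hx 2 trivial⟩
  have hae : ∀ᵐ x ∂(volume.restrict (Icc (![0, a, c] : Fin 3 → ℝ) ![1, b, d])),
      ∑ i, fderiv ℝ (boxField a b c d A B i) x (Pi.single i 1) = 0 := by
    have e : (Set.pi univ fun i => Ioo ((![0, a, c] : Fin 3 → ℝ) i) (![1, b, d] i))
      =ᵐ[volume] Icc (![0, a, c] : Fin 3 → ℝ) ![1, b, d] := Measure.univ_pi_Ioo_ae_eq_Icc
    rw [← Measure.restrict_congr_set e]
    refine (ae_restrict_iff' (MeasurableSet.univ_pi fun i => measurableSet_Ioo)).2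
      (Eventually.of_forall fun x hx => ?_)
    obtain ⟨h1, h2, h3⟩ := hint x hx
    exact boxField_divergence hab hcd hA hB h0 h1 h2 h3
  have hi : IntegrableOn (fun x => ∑ i, fderiv ℝ (boxField a b c d A B i) x (Pi.single i 1))
      (Icc (![0, a, c] : Fin 3 → ℝ) ![1, b, d]) :=
    (integrable_zero _ ℝ _).congr (hae.mono fun x hx => hx.symm)
  have main := integral_divergence_of_hasFDerivAt_off_countable' _ _ hle (boxField a b c d A B)
    (fun i => fderiv ℝ (boxField a b c d A B i)) ∅ countable_empty
    (continuousOn_boxField hab hcd hA hB h0)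
    (fun x hx i => by
      obtain ⟨h1, h2, h3⟩ := hint x hx.1
      exact (differentiableAt_boxField hab hcd hA hB h0 i h1 h2 h3).hasFDerivAt) hi
  rw [integral_eq_zero_of_ae hae, Fin.sum_univ_three] at main
  refine Eq.trans ?_ main.symm
  have s0 : (![0, a, c] : Fin 3 → ℝ) ∘ Fin.succAbove 0 = ![a, c] := by
    ext i; fin_cases i <;> rfl
  have s0' : (![1, b, d] : Fin 3 → ℝ) ∘ Fin.succAbove 0 = ![b, d] := by
    ext i; fin_cases i <;> rfl
  have s1 : (![0, a, c] : Fin 3 → ℝ) ∘ Fin.succAbove 1 = ![0, c] := by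
    ext i; fin_cases i <;> rfl
  have s1' : (![1, b, d] : Fin 3 → ℝ) ∘ Fin.succAbove 1 = ![1, d] := by
    ext i; fin_cases i <;> rfl
  have s2 : (![0, a, c] : Fin 3 → ℝ) ∘ Fin.succAbove 2 = ![0, a] := by
    ext i; fin_cases i <;> rfl
  have s2' : (![1, b, d] : Fin 3 → ℝ) ∘ Fin.succAbove 2 = ![1, b] := by
    ext i; fin_cases i <;> rfl
  rw [s0, s0', s1, s1', s2, s2']
  have i0 : ∀ (v : ℝ) (x : Fin 2 → ℝ), (Fin.insertNth (α := fun _ => ℝ) 0 v x : Fin 3 → ℝ) =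
      ![v, x 0, x 1] := by
    intro v x; ext i; fin_cases i <;> rfl
  have i1 : ∀ (v : ℝ) (x : Fin 2 → ℝ), (Fin.insertNth (α := fun _ => ℝ) 1 v x : Fin 3 → ℝ) =
      ![x 0, v, x 1] := by
    intro v x; ext i; fin_cases i <;> rfl
  have i2 : ∀ (v : ℝ) (x : Fin 2 → ℝ), (Fin.insertNth (α := fun _ => ℝ) 2 v x : Fin 3 → ℝ) =
      ![x 0, x 1, v] := by
    intro v x; ext i; fin_cases i <;> rfl
  simp only [i0, i1, i2]
  rfl

theorem rectIntegral_eq_setIntegral (a b c d : ℝ) (h : ℝ → ℝ → ℝ) :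
    rectIntegral a b c d h = ∫ p in Icc a b ×ˢ Icc c d, h p.1 p.2 := by
  have hm := volume_preserving_finTwoArrow ℝ
  have := hm.setIntegral_preimage_emb (MeasurableEquiv.measurableEmbedding _)
    (fun p : ℝ × ℝ => h p.1 p.2) (Icc a b ×ˢ Icc c d)
  rw [← this, rectIntegral]
  congr 1
  congr 1
  ext x
  simp [Set.mem_Icc, Pi.le_def, Fin.forall_fin_two, MeasurableEquiv.finTwoArrow]

/-- A closed curve, parametrised by `[0,2]`, that is smooth on `[0,1]` and on `[1,2]`. -/
structure IsSmoothLoop (α : ℝ → E3) : Prop where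
  left : ContDiffOn ℝ ∞ α (Icc 0 1)
  right : ContDiffOn ℝ ∞ α (Icc 1 2)
  closed : α 2 = α 0

/-- A homotopy, with time in `[0,1]` as first coordinate, of closed curves parametrised by `[0,2]`
that is smooth on `[0,1] × [0,1]` and on `[0,1] × [1,2]`. -/
structure IsLoopHomotopy (A : ℝ × ℝ → E3) : Prop where
  left : ContDiffOn ℝ ∞ A (patch 0 1)
  right : ContDiffOn ℝ ∞ A (patch 1 2)
  closed : ∀ u ∈ Icc (0 : ℝ) 1, A (u, 2) = A (u, 0)

theorem ContDiffOn.slice {a b : ℝ} {A : ℝ × ℝ → E3} (hA : ContDiffOn ℝ ∞ A (patch a b))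
    {u : ℝ} (hu : u ∈ Icc (0 : ℝ) 1) : ContDiffOn ℝ ∞ (fun s => A (u, s)) (Icc a b) :=
  hA.comp (f := fun s : ℝ => (u, s)) (by fun_prop) fun _ hs => ⟨hu, hs⟩

theorem IsLoopHomotopy.isSmoothLoop {A : ℝ × ℝ → E3} (hA : IsLoopHomotopy A) {u : ℝ}
    (hu : u ∈ Icc (0 : ℝ) 1) : IsSmoothLoop fun s => A (u, s) :=
  ⟨hA.left.slice hu, hA.right.slice hu, hA.closed u hu⟩

/-- The integrand of the Gauss integral over a rectangle on which both curves are smooth. -/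
def pieceKernel (a b c d : ℝ) (α β : ℝ → E3) (p : ℝ × ℝ) : ℝ :=
  gaussKernel (α p.1 - β p.2) (derivWithin α (Icc a b) p.1) (derivWithin β (Icc c d) p.2)

/-- The contribution of a rectangle to the Gauss integral, up to the factor `1 / 4π`. -/
def pieceIntegral (a b c d : ℝ) (α β : ℝ → E3) : ℝ :=
  ∫ p in Icc a b ×ˢ Icc c d, pieceKernel a b c d α β p

theorem continuousOn_derivWithin_Icc {a b : ℝ} (hab : a < b) {α : ℝ → E3}
    (hα : ContDiffOn ℝ ∞ α (Icc a b)) : ContinuousOn (derivWithin α (Icc a b)) (Icc a b) :=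
  hα.continuousOn_derivWithin (uniqueDiffOn_Icc hab) (by simp)

section Piece

variable {a b c d : ℝ} {α β : ℝ → E3}

theorem continuousOn_pieceKernel (hab : a < b) (hcd : c < d) (hα : ContDiffOn ℝ ∞ α (Icc a b))
    (hβ : ContDiffOn ℝ ∞ β (Icc c d)) (h0 : ∀ s ∈ Icc a b, ∀ t ∈ Icc c d, α s ≠ β t) :
    ContinuousOn (pieceKernel a b c d α β) (Icc a b ×ˢ Icc c d) := by
  have m1 : MapsTo Prod.fst (Icc a b ×ˢ Icc c d) (Icc a b) := fun p hp => hp.1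
  have m2 : MapsTo Prod.snd (Icc a b ×ˢ Icc c d) (Icc c d) := fun p hp => hp.2
  refine ContinuousOn.gaussKernel ?_ ?_ ?_ fun p hp => sub_ne_zero.2 (h0 _ hp.1 _ hp.2)
  · exact (hα.continuousOn.comp continuousOn_fst m1).sub (hβ.continuousOn.comp continuousOn_snd m2)
  · exact (continuousOn_derivWithin_Icc hab hα).comp continuousOn_fst m1
  · exact (continuousOn_derivWithin_Icc hcd hβ).comp continuousOn_snd m2

theorem Ioo_prod_ae_eq_Icc_prod (a b c d : ℝ) :
    (Ioo a b ×ˢ Ioo c d : Set (ℝ × ℝ)) =ᵐ[volume] Icc a b ×ˢ Icc c d :=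
  Measure.set_prod_ae_eq Ioo_ae_eq_Icc Ioo_ae_eq_Icc

theorem gaussKernel_deriv_eqOn_pieceKernel :
    EqOn (fun p : ℝ × ℝ => gaussKernel (α p.1 - β p.2) (deriv α p.1) (deriv β p.2))
      (pieceKernel a b c d α β) (Ioo a b ×ˢ Ioo c d) := fun p hp => by
  simp only [pieceKernel]
  rw [derivWithin_of_mem_nhds (Icc_mem_nhds hp.1.1 hp.1.2),
    derivWithin_of_mem_nhds (Icc_mem_nhds hp.2.1 hp.2.2)]

theorem integrableOn_gaussKernel_piece (hab : a < b) (hcd : c < d)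
    (hα : ContDiffOn ℝ ∞ α (Icc a b)) (hβ : ContDiffOn ℝ ∞ β (Icc c d))
    (h0 : ∀ s ∈ Icc a b, ∀ t ∈ Icc c d, α s ≠ β t) :
    IntegrableOn (fun p : ℝ × ℝ => gaussKernel (α p.1 - β p.2) (deriv α p.1) (deriv β p.2))
      (Icc a b ×ˢ Icc c d) := by
  have h := (continuousOn_pieceKernel hab hcd hα hβ h0).integrableOn_compact (μ := volume)
    (isCompact_Icc.prod isCompact_Icc)
  rw [integrableOn_congr_set_ae (Ioo_prod_ae_eq_Icc_prod a b c d).symm] at h ⊢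
  exact h.congr_fun gaussKernel_deriv_eqOn_pieceKernel.symm
    (measurableSet_Ioo.prod measurableSet_Ioo)

theorem setIntegral_gaussKernel_piece :
    ∫ p in Icc a b ×ˢ Icc c d, gaussKernel (α p.1 - β p.2) (deriv α p.1) (deriv β p.2) =
      pieceIntegral a b c d α β := by
  rw [pieceIntegral, ← setIntegral_congr_set (Ioo_prod_ae_eq_Icc_prod a b c d),
    ← setIntegral_congr_set (Ioo_prod_ae_eq_Icc_prod a b c d)]
  exact setIntegral_congr_fun (measurableSet_Ioo.prod measurableSet_Ioo)
    gaussKernel_deriv_eqOn_pieceKernel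

end Piece

theorem square_eq_union :
    (Icc 0 2 ×ˢ Icc 0 2 : Set (ℝ × ℝ)) = (Icc 0 1 ×ˢ Icc 0 1 ∪ Icc 0 1 ×ˢ Icc 1 2) ∪
      (Icc 1 2 ×ˢ Icc 0 1 ∪ Icc 1 2 ×ˢ Icc 1 2) := by
  rw [← prod_union, ← prod_union, ← union_prod, Icc_union_Icc_eq_Icc (by norm_num) (by norm_num)]

section Loop

variable {α β : ℝ → E3}

theorem IsSmoothLoop.integrableOn_gaussKernel (hα : IsSmoothLoop α) (hβ : IsSmoothLoop β)
    (h0 : ∀ s ∈ Icc (0 : ℝ) 2, ∀ t ∈ Icc (0 : ℝ) 2, α s ≠ β t) :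
    IntegrableOn (fun p : ℝ × ℝ => gaussKernel (α p.1 - β p.2) (deriv α p.1) (deriv β p.2))
      (Icc 0 2 ×ˢ Icc 0 2) := by
  have m1 : ∀ s ∈ Icc (0 : ℝ) 1, s ∈ Icc (0 : ℝ) 2 := fun s hs => ⟨hs.1, by linarith [hs.2]⟩
  have m2 : ∀ s ∈ Icc (1 : ℝ) 2, s ∈ Icc (0 : ℝ) 2 := fun s hs => ⟨by linarith [hs.1], hs.2⟩
  rw [square_eq_union]
  refine IntegrableOn.union (IntegrableOn.union ?_ ?_) (IntegrableOn.union ?_ ?_)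
  · exact integrableOn_gaussKernel_piece (by norm_num) (by norm_num) hα.left hβ.left
      fun s hs t ht => h0 s (m1 s hs) t (m1 t ht)
  · exact integrableOn_gaussKernel_piece (by norm_num) (by norm_num) hα.left hβ.right
      fun s hs t ht => h0 s (m1 s hs) t (m2 t ht)
  · exact integrableOn_gaussKernel_piece (by norm_num) (by norm_num) hα.right hβ.left
      fun s hs t ht => h0 s (m2 s hs) t (m1 t ht)
  · exact integrableOn_gaussKernel_piece (by norm_num) (by norm_num) hα.right hβ.right
      fun s hs t ht => h0 s (m2 s hs) t (m2 t ht)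

theorem IsSmoothLoop.gaussIntegral_eq_setIntegral (hα : IsSmoothLoop α) (hβ : IsSmoothLoop β)
    (h0 : ∀ s ∈ Icc (0 : ℝ) 2, ∀ t ∈ Icc (0 : ℝ) 2, α s ≠ β t) :
    gaussIntegral α β = 1 / (4 * Real.pi) * ∫ p in Icc (0 : ℝ) 2 ×ˢ Icc (0 : ℝ) 2,
      gaussKernel (α p.1 - β p.2) (deriv α p.1) (deriv β p.2) := by
  have hi := hα.integrableOn_gaussKernel hβ h0
  have hae : (Ioc 0 2 ×ˢ Ioc 0 2 : Set (ℝ × ℝ)) =ᵐ[volume] Icc 0 2 ×ˢ Icc 0 2 :=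
    Measure.set_prod_ae_eq Ioc_ae_eq_Icc Ioc_ae_eq_Icc
  rw [gaussIntegral_eq, ← setIntegral_congr_set hae]
  rw [← integrableOn_congr_set_ae hae] at hi
  rw [Measure.volume_eq_prod, setIntegral_prod _ hi,
    intervalIntegral.integral_of_le (by norm_num)]
  simp only [intervalIntegral.integral_of_le (show (0 : ℝ) ≤ 2 by norm_num)]

theorem aedisjoint_prod_left (X : Set ℝ) :
    AEDisjoint volume (Icc (0 : ℝ) 1 ×ˢ X) (Icc (1 : ℝ) 2 ×ˢ X) := by
  refine measure_mono_null (t := ({1} : Set ℝ) ×ˢ univ) ?_ ?_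
  · rintro ⟨s, t⟩ ⟨h1, h2⟩
    exact ⟨le_antisymm h1.1.2 h2.1.1, trivial⟩
  · rw [Measure.volume_eq_prod, Measure.prod_prod]; simp

theorem aedisjoint_prod_right (X : Set ℝ) :
    AEDisjoint volume (X ×ˢ Icc (0 : ℝ) 1) (X ×ˢ Icc (1 : ℝ) 2) := by
  refine measure_mono_null (t := univ ×ˢ ({1} : Set ℝ)) ?_ ?_
  · rintro ⟨s, t⟩ ⟨h1, h2⟩
    exact ⟨trivial, le_antisymm h1.2.2 h2.2.1⟩
  · rw [Measure.volume_eq_prod, Measure.prod_prod]; simp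

theorem IsSmoothLoop.gaussIntegral_eq_sum (hα : IsSmoothLoop α) (hβ : IsSmoothLoop β)
    (h0 : ∀ s ∈ Icc (0 : ℝ) 2, ∀ t ∈ Icc (0 : ℝ) 2, α s ≠ β t) :
    gaussIntegral α β = 1 / (4 * Real.pi) *
      ((pieceIntegral 0 1 0 1 α β + pieceIntegral 0 1 1 2 α β) +
        (pieceIntegral 1 2 0 1 α β + pieceIntegral 1 2 1 2 α β)) := by
  have hi := hα.integrableOn_gaussKernel hβ h0
  have hm : ∀ a b c d : ℝ, MeasurableSet (Icc a b ×ˢ Icc c d) := fun a b c d =>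
    measurableSet_Icc.prod measurableSet_Icc
  rw [hα.gaussIntegral_eq_setIntegral hβ h0]
  congr 1
  rw [square_eq_union] at hi ⊢
  have i1 := hi.left_of_union
  have i2 := hi.right_of_union
  rw [setIntegral_union₀ _ (((hm _ _ _ _).union (hm _ _ _ _)).nullMeasurableSet) i1 i2,
    setIntegral_union₀ (aedisjoint_prod_right _) (hm _ _ _ _).nullMeasurableSet
      i1.left_of_union i1.right_of_union,
    setIntegral_union₀ (aedisjoint_prod_right _) (hm _ _ _ _).nullMeasurableSet
      i2.left_of_union i2.right_of_union]
  · simp only [setIntegral_gaussKernel_piece]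
  · rw [← prod_union, ← prod_union]
    exact aedisjoint_prod_left _

end Loop

section Homotopy

variable {a b c d : ℝ} {A B : ℝ × ℝ → E3}

theorem curveDeriv_eq_derivWithin (hab : a < b) (hA : ContDiffOn ℝ ∞ A (patch a b)) {u s : ℝ}
    (h : (u, s) ∈ patch a b) :
    curveDeriv a b A (u, s) = derivWithin (fun v => A (u, v)) (Icc a b) s :=
  ((hasDerivWithinAt_curveDeriv hA h).derivWithin (uniqueDiffOn_Icc hab s h.2)).symm

theorem timeDeriv_eq_derivWithin (hA : ContDiffOn ℝ ∞ A (patch a b)) {u s : ℝ}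
    (h : (u, s) ∈ patch a b) :
    timeDeriv a b A (u, s) = derivWithin (fun v => A (v, s)) (Icc 0 1) u :=
  ((hasDerivWithinAt_timeDeriv hA h).derivWithin (uniqueDiffOn_Icc zero_lt_one u h.1)).symm

/-- The faces of the box at constant time contribute the Gauss integrals at that time. -/
theorem rectIntegral_boxField_zero (hab : a < b) (hcd : c < d)
    (hA : ContDiffOn ℝ ∞ A (patch a b)) (hB : ContDiffOn ℝ ∞ B (patch c d)) {u : ℝ}
    (hu : u ∈ Icc (0 : ℝ) 1) :
    rectIntegral a b c d (fun s t => boxField a b c d A B 0 ![u, s, t]) =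
      -pieceIntegral a b c d (fun s => A (u, s)) (fun t => B (u, t)) := by
  rw [rectIntegral_eq_setIntegral, pieceIntegral, ← integral_neg]
  refine setIntegral_congr_fun (measurableSet_Icc.prod measurableSet_Icc) fun p hp => ?_
  simp only [pieceKernel]
  rw [← curveDeriv_eq_derivWithin hab hA ⟨hu, hp.1⟩, ← curveDeriv_eq_derivWithin hcd hB ⟨hu, hp.2⟩]
  simp only [boxField, gaussKernel, tripleProd, Matrix.cons_val, PiLp.neg_apply]
  ring

/-- The contribution of a face at a constant parameter of the first curve depends only on the path of
the point with that parameter. Hence faces at a corner cancel. -/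
theorem rectIntegral_boxField_one_congr {a' b' x x' : ℝ} (hA : ContDiffOn ℝ ∞ A (patch a b))
    (hA' : ContDiffOn ℝ ∞ A (patch a' b')) (hx : x ∈ Icc a b) (hx' : x' ∈ Icc a' b')
    (h : ∀ u ∈ Icc (0 : ℝ) 1, A (u, x) = A (u, x')) :
    rectIntegral 0 1 c d (fun u t => boxField a b c d A B 1 ![u, x, t]) =
      rectIntegral 0 1 c d (fun u t => boxField a' b' c d A B 1 ![u, x', t]) := by
  rw [rectIntegral_eq_setIntegral, rectIntegral_eq_setIntegral]
  refine setIntegral_congr_fun (measurableSet_Icc.prod measurableSet_Icc) fun p hp => ?_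
  have e : timeDeriv a b A (p.1, x) = timeDeriv a' b' A (p.1, x') := by
    rw [timeDeriv_eq_derivWithin (u := p.1) (s := x) hA ⟨hp.1, hx⟩,
      timeDeriv_eq_derivWithin (u := p.1) (s := x') hA' ⟨hp.1, hx'⟩]
    exact derivWithin_congr h (h _ hp.1)
  simp only [boxField, Matrix.cons_val, e, h _ hp.1]

/-- The analogue of `rectIntegral_boxField_one_congr` for the second curve. -/
theorem rectIntegral_boxField_two_congr {c' d' x x' : ℝ} (hB : ContDiffOn ℝ ∞ B (patch c d))
    (hB' : ContDiffOn ℝ ∞ B (patch c' d')) (hx : x ∈ Icc c d) (hx' : x' ∈ Icc c' d')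
    (h : ∀ u ∈ Icc (0 : ℝ) 1, B (u, x) = B (u, x')) :
    rectIntegral 0 1 a b (fun u s => boxField a b c d A B 2 ![u, s, x]) =
      rectIntegral 0 1 a b (fun u s => boxField a b c' d' A B 2 ![u, s, x']) := by
  rw [rectIntegral_eq_setIntegral, rectIntegral_eq_setIntegral]
  refine setIntegral_congr_fun (measurableSet_Icc.prod measurableSet_Icc) fun p hp => ?_
  have e : timeDeriv c d B (p.1, x) = timeDeriv c' d' B (p.1, x') := by
    rw [timeDeriv_eq_derivWithin (u := p.1) (s := x) hB ⟨hp.1, hx⟩,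
      timeDeriv_eq_derivWithin (u := p.1) (s := x') hB' ⟨hp.1, hx'⟩]
    exact derivWithin_congr h (h _ hp.1)
  simp only [boxField, Matrix.cons_val, e, h _ hp.1]

/-- The Gauss integral of two closed curves does not change in a homotopy during which they remain
disjoint: by Stokes' theorem, since the solid angle form is closed. The contributions of the faces
at the ends of the parameter intervals cancel because the curves are closed. -/
theorem IsLoopHomotopy.gaussIntegral_eq (hA : IsLoopHomotopy A) (hB : IsLoopHomotopy B)
    (h0 : ∀ u ∈ Icc (0 : ℝ) 1, ∀ s ∈ Icc (0 : ℝ) 2, ∀ t ∈ Icc (0 : ℝ) 2, A (u, s) ≠ B (u, t)) :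
    gaussIntegral (fun s => A (0, s)) (fun t => B (0, t)) =
      gaussIntegral (fun s => A (1, s)) (fun t => B (1, t)) := by
  have z0 : (0 : ℝ) ∈ Icc (0 : ℝ) 1 := ⟨le_rfl, zero_le_one⟩
  have z1 : (1 : ℝ) ∈ Icc (0 : ℝ) 1 := ⟨zero_le_one, le_rfl⟩
  have m1 : ∀ s ∈ Icc (0 : ℝ) 1, s ∈ Icc (0 : ℝ) 2 := fun s hs => ⟨hs.1, by linarith [hs.2]⟩
  have m2 : ∀ s ∈ Icc (1 : ℝ) 2, s ∈ Icc (0 : ℝ) 2 := fun s hs => ⟨by linarith [hs.1], hs.2⟩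
  rw [(hA.isSmoothLoop z0).gaussIntegral_eq_sum (hB.isSmoothLoop z0) (h0 0 z0),
    (hA.isSmoothLoop z1).gaussIntegral_eq_sum (hB.isSmoothLoop z1) (h0 1 z1)]
  congr 1
  have p12 : (1 : ℝ) < 2 := by norm_num
  have s11 := boxField_stokes zero_lt_one zero_lt_one hA.left hB.left
    fun u hu s hs t ht => h0 u hu s (m1 s hs) t (m1 t ht)
  have s12 := boxField_stokes zero_lt_one p12 hA.left hB.right
    fun u hu s hs t ht => h0 u hu s (m1 s hs) t (m2 t ht)
  have s21 := boxField_stokes p12 zero_lt_one hA.right hB.left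
    fun u hu s hs t ht => h0 u hu s (m2 s hs) t (m1 t ht)
  have s22 := boxField_stokes p12 p12 hA.right hB.right
    fun u hu s hs t ht => h0 u hu s (m2 s hs) t (m2 t ht)
  rw [rectIntegral_boxField_zero zero_lt_one zero_lt_one hA.left hB.left z0,
    rectIntegral_boxField_zero zero_lt_one zero_lt_one hA.left hB.left z1] at s11
  rw [rectIntegral_boxField_zero zero_lt_one p12 hA.left hB.right z0,
    rectIntegral_boxField_zero zero_lt_one p12 hA.left hB.right z1] at s12
  rw [rectIntegral_boxField_zero p12 zero_lt_one hA.right hB.left z0,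
    rectIntegral_boxField_zero p12 zero_lt_one hA.right hB.left z1] at s21
  rw [rectIntegral_boxField_zero p12 p12 hA.right hB.right z0,
    rectIntegral_boxField_zero p12 p12 hA.right hB.right z1] at s22
  have k1 : ∀ c d, rectIntegral 0 1 c d (fun u t => boxField 0 1 c d A B 1 ![u, 1, t]) =
      rectIntegral 0 1 c d (fun u t => boxField 1 2 c d A B 1 ![u, 1, t]) := fun c d =>
    rectIntegral_boxField_one_congr hA.left hA.right (by norm_num) (by norm_num) fun _ _ => rfl
  have k2 : ∀ c d, rectIntegral 0 1 c d (fun u t => boxField 1 2 c d A B 1 ![u, 2, t]) =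
      rectIntegral 0 1 c d (fun u t => boxField 0 1 c d A B 1 ![u, 0, t]) := fun c d =>
    rectIntegral_boxField_one_congr hA.right hA.left (by norm_num) (by norm_num) hA.closed
  have k3 : ∀ a b, rectIntegral 0 1 a b (fun u s => boxField a b 0 1 A B 2 ![u, s, 1]) =
      rectIntegral 0 1 a b (fun u s => boxField a b 1 2 A B 2 ![u, s, 1]) := fun a b =>
    rectIntegral_boxField_two_congr hB.left hB.right (by norm_num) (by norm_num) fun _ _ => rfl
  have k4 : ∀ a b, rectIntegral 0 1 a b (fun u s => boxField a b 1 2 A B 2 ![u, s, 2]) =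
      rectIntegral 0 1 a b (fun u s => boxField a b 0 1 A B 2 ![u, s, 0]) := fun a b =>
    rectIntegral_boxField_two_congr hB.right hB.left (by norm_num) (by norm_num) hB.closed
  have := k1 0 1; have := k1 1 2; have := k2 0 1; have := k2 1 2
  have := k3 0 1; have := k3 1 2; have := k4 0 1; have := k4 1 2
  linarith

end Homotopy

/-! ### Concentration of flattened Gauss kernels at a transverse crossing -/

theorem integrable_inv_one_add_norm_sq :
    Integrable fun w : ℝ × ℝ => (1 + ‖w‖ ^ 2) ^ (-(3 : ℝ) / 2) :=
  integrable_rpow_neg_one_add_norm_sq (by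
    rw [Module.finrank_prod, Module.finrank_self]; norm_num)

/-- The flattened kernel of two perpendicular lines at unit speed and at height difference `z`,
integrated in polar coordinates. -/
theorem integral_radial {z : ℝ} (hz : z ≠ 0) :
    ∫ w : ℝ × ℝ, 1 / √(w.1 ^ 2 + w.2 ^ 2 + z ^ 2) ^ 3 = 2 * Real.pi / |z| := by
  have hz2 : 0 < z ^ 2 := by positivity
  rw [← integral_comp_polarCoord_symm]
  have e : ∀ p : ℝ × ℝ, p.1 • (1 / √((polarCoord.symm p).1 ^ 2 + (polarCoord.symm p).2 ^ 2 +
      z ^ 2) ^ 3) = (p.1 / √(p.1 ^ 2 + z ^ 2) ^ 3) * 1 := by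
    intro p
    have : (polarCoord.symm p).1 ^ 2 + (polarCoord.symm p).2 ^ 2 = p.1 ^ 2 := by
      simp only [polarCoord_symm_apply]
      linear_combination p.1 ^ 2 * Real.sin_sq_add_cos_sq p.2
    rw [this, smul_eq_mul]; ring
  simp only [e]
  have ht : polarCoord.target = Ioi (0 : ℝ) ×ˢ Ioo (-Real.pi) Real.pi := rfl
  rw [ht, Measure.volume_eq_prod,
    setIntegral_prod_mul (fun r : ℝ => r / √(r ^ 2 + z ^ 2) ^ 3) (fun _ : ℝ => (1 : ℝ))]
  have hd : ∀ r : ℝ, HasDerivAt (fun r => -(1 / √(r ^ 2 + z ^ 2)))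
      (r / √(r ^ 2 + z ^ 2) ^ 3) r := by
    intro r
    have hp : 0 < r ^ 2 + z ^ 2 := by positivity
    have h1 := (((hasDerivAt_pow 2 r).add_const (z ^ 2)).sqrt hp.ne').inv
      (Real.sqrt_pos.2 hp).ne'
    have h2 := h1.neg
    simp only [one_div]
    refine h2.congr_deriv ?_
    have : √(r ^ 2 + z ^ 2) ≠ 0 := (Real.sqrt_pos.2 hp).ne'
    field_simp
    norm_num
  have hlim : Tendsto (fun r : ℝ => -(1 / √(r ^ 2 + z ^ 2))) atTop (𝓝 0) := by
    have h1 : Tendsto (fun r : ℝ => √(r ^ 2 + z ^ 2)) atTop atTop :=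
      Real.tendsto_sqrt_atTop.comp (tendsto_atTop_add_const_right _ _
        (tendsto_pow_atTop two_ne_zero))
    simpa using (tendsto_inv_atTop_zero.comp h1).neg
  rw [integral_Ioi_of_hasDerivAt_of_nonneg' (fun r _ => hd r)
    (fun r hr => by have : (0 : ℝ) < r := hr; positivity) hlim]
  simp [Real.sqrt_sq_eq_abs, Real.pi_pos.le]
  ring

/-- A linear substitution reduces any pair of transverse lines to `integral_radial`. -/
theorem integral_linear_radial {a₀ a₁ b₀ b₁ z : ℝ} (hP : a₀ * b₁ - a₁ * b₀ ≠ 0) (hz : z ≠ 0) :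
    ∫ w : ℝ × ℝ, 1 / √((a₀ * w.1 - b₀ * w.2) ^ 2 + (a₁ * w.1 - b₁ * w.2) ^ 2 + z ^ 2) ^ 3 =
      2 * Real.pi / (|a₀ * b₁ - a₁ * b₀| * |z|) := by
  set L : ℝ × ℝ →L[ℝ] ℝ × ℝ :=
    (Matrix.toLin (Module.Basis.finTwoProd ℝ) (Module.Basis.finTwoProd ℝ)
      !![a₀, -b₀; a₁, -b₁]).toContinuousLinearMap with hL
  have hLa : ∀ w, L w = (a₀ * w.1 - b₀ * w.2, a₁ * w.1 - b₁ * w.2) := by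
    intro w
    simp [hL, Matrix.toLin_finTwoProd_apply, sub_eq_add_neg]
  have hdet : L.det = -(a₀ * b₁ - a₁ * b₀) := by
    simp only [hL, ContinuousLinearMap.det, LinearMap.coe_toContinuousLinearMap,
      LinearMap.det_toLin, Matrix.det_fin_two_of]
    ring
  have hinj : Function.Injective L := by
    intro v w h
    rw [hLa, hLa] at h
    simp only [Prod.mk.injEq] at h
    have e1 : (a₀ * b₁ - a₁ * b₀) * (v.1 - w.1) = 0 := by
      linear_combination b₁ * h.1 - b₀ * h.2
    have e2 : (a₀ * b₁ - a₁ * b₀) * (v.2 - w.2) = 0 := by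
      linear_combination a₁ * h.1 - a₀ * h.2
    exact Prod.ext (sub_eq_zero.1 ((mul_eq_zero.1 e1).resolve_left hP))
      (sub_eq_zero.1 ((mul_eq_zero.1 e2).resolve_left hP))
  have hsurj : Function.Surjective L :=
    LinearMap.surjective_of_injective (f := (L : ℝ × ℝ →ₗ[ℝ] ℝ × ℝ)) hinj
  have key := integral_image_eq_integral_abs_det_fderiv_smul volume MeasurableSet.univ
    (fun x _ => L.hasFDerivAt.hasFDerivWithinAt) hinj.injOn
    (fun w : ℝ × ℝ => 1 / √(w.1 ^ 2 + w.2 ^ 2 + z ^ 2) ^ 3)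
  rw [image_univ, hsurj.range_eq, Measure.restrict_univ, integral_radial hz] at key
  simp only [hdet, abs_neg, smul_eq_mul, hLa] at key
  rw [integral_const_mul] at key
  have hPa : |a₀ * b₁ - a₁ * b₀| ≠ 0 := abs_ne_zero.2 hP
  rw [← mul_right_inj' hPa, ← key]
  have : |z| ≠ 0 := abs_ne_zero.2 hz
  field_simp

/-- The flattened kernel `l D / (h₀² + h₁² + l² ζ²)^(3/2)`. -/
def flatKernel (D h₀ h₁ ζ : ℝ × ℝ → ℝ) (l : ℝ) (p : ℝ × ℝ) : ℝ :=
  l * D p / √(h₀ p ^ 2 + h₁ p ^ 2 + (l * ζ p) ^ 2) ^ 3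

/-- Near a transverse zero of `(h₀, h₁)` the sum of squares grows at least quadratically. -/
theorem eventually_linear_le {h₀ h₁ : ℝ × ℝ → ℝ} {c : ℝ × ℝ} {a₀ a₁ b₀ b₁ : ℝ}
    (hP : a₀ * b₁ - a₁ * b₀ ≠ 0) (z₀ : h₀ c = 0) (z₁ : h₁ c = 0)
    (d₀ : HasFDerivAt h₀
      (a₀ • ContinuousLinearMap.fst ℝ ℝ ℝ - b₀ • ContinuousLinearMap.snd ℝ ℝ ℝ) c)
    (d₁ : HasFDerivAt h₁
      (a₁ • ContinuousLinearMap.fst ℝ ℝ ℝ - b₁ • ContinuousLinearMap.snd ℝ ℝ ℝ) c) :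
    ∃ k > 0, ∀ᶠ p in 𝓝 c, k * ‖p - c‖ ^ 2 ≤ h₀ p ^ 2 + h₁ p ^ 2 := by
  set P := a₀ * b₁ - a₁ * b₀
  set M := |a₀| + |a₁| + |b₀| + |b₁| with hM
  have hPp : 0 < |P| := abs_pos.2 hP
  have hM0 : 0 ≤ M := by positivity
  have hMp : 0 < M := by
    rcases hM0.lt_or_eq with h | h
    · exact h
    · exfalso; apply hP
      have e₀ : a₀ = 0 := abs_eq_zero.1
        (by linarith [abs_nonneg a₀, abs_nonneg a₁, abs_nonneg b₀, abs_nonneg b₁])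
      have e₁ : a₁ = 0 := abs_eq_zero.1
        (by linarith [abs_nonneg a₀, abs_nonneg a₁, abs_nonneg b₀, abs_nonneg b₁])
      show a₀ * b₁ - a₁ * b₀ = 0
      rw [e₀, e₁]; ring
  set κ := |P| / (4 * M) with hκ
  have hκp : 0 < κ := by positivity
  have o₀ := d₀.isLittleO.def hκp
  have o₁ := d₁.isLittleO.def hκp
  refine ⟨κ ^ 2, by positivity, ?_⟩
  filter_upwards [o₀, o₁] with p q₀ q₁
  rw [z₀] at q₀
  rw [z₁] at q₁
  set w := p - c with hw
  simp only [sub_zero, sub_apply, smul_apply,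
    ContinuousLinearMap.coe_fst', ContinuousLinearMap.coe_snd', smul_eq_mul, Real.norm_eq_abs]
    at q₀ q₁
  -- Cramer's rule bounds the displacement by the values of the linear parts.
  have bl : |P| * ‖w‖ ≤ M * (|a₀ * w.1 - b₀ * w.2| + |a₁ * w.1 - b₁ * w.2|) := by
    set x := a₀ * w.1 - b₀ * w.2
    set y := a₁ * w.1 - b₁ * w.2
    have e1 : P * w.1 = b₁ * x - b₀ * y := by simp only [P, x, y]; ring
    have e2 : P * w.2 = a₁ * x - a₀ * y := by simp only [P, x, y]; ring
    have c1 : |P| * |w.1| ≤ M * (|x| + |y|) := by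
      rw [← abs_mul, e1]
      refine (abs_sub _ _).trans ?_
      rw [abs_mul, abs_mul]
      nlinarith [abs_nonneg x, abs_nonneg y, abs_nonneg a₀, abs_nonneg a₁, abs_nonneg b₀,
        abs_nonneg b₁, mul_nonneg (abs_nonneg b₀) (abs_nonneg x),
        mul_nonneg (abs_nonneg a₀) (abs_nonneg x), mul_nonneg (abs_nonneg a₁) (abs_nonneg x),
        mul_nonneg (abs_nonneg b₁) (abs_nonneg y),
        mul_nonneg (abs_nonneg a₀) (abs_nonneg y), mul_nonneg (abs_nonneg a₁) (abs_nonneg y)]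
    have c2 : |P| * |w.2| ≤ M * (|x| + |y|) := by
      rw [← abs_mul, e2]
      refine (abs_sub _ _).trans ?_
      rw [abs_mul, abs_mul]
      nlinarith [abs_nonneg x, abs_nonneg y, abs_nonneg a₀, abs_nonneg a₁, abs_nonneg b₀,
        abs_nonneg b₁, mul_nonneg (abs_nonneg b₀) (abs_nonneg x),
        mul_nonneg (abs_nonneg a₀) (abs_nonneg x), mul_nonneg (abs_nonneg b₁) (abs_nonneg x),
        mul_nonneg (abs_nonneg b₁) (abs_nonneg y),
        mul_nonneg (abs_nonneg b₀) (abs_nonneg y), mul_nonneg (abs_nonneg a₁) (abs_nonneg y)]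
    rw [Prod.norm_def, Real.norm_eq_abs, Real.norm_eq_abs]
    rcases max_cases |w.1| |w.2| with ⟨h, _⟩ | ⟨h, _⟩ <;> rw [h] <;> assumption
  have t₀ : |a₀ * w.1 - b₀ * w.2| ≤ |h₀ p| + κ * ‖w‖ := by
    have := abs_sub_abs_le_abs_sub (a₀ * w.1 - b₀ * w.2) (h₀ p)
    rw [abs_sub_comm] at q₀
    linarith
  have t₁ : |a₁ * w.1 - b₁ * w.2| ≤ |h₁ p| + κ * ‖w‖ := by
    have := abs_sub_abs_le_abs_sub (a₁ * w.1 - b₁ * w.2) (h₁ p)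
    rw [abs_sub_comm] at q₁
    linarith
  have hPM : |P| = 4 * κ * M := by rw [hκ]; field_simp
  have fin : 4 * κ * ‖w‖ ≤ |h₀ p| + |h₁ p| + 2 * κ * ‖w‖ := by
    rw [hPM] at bl
    have := mul_le_mul_of_nonneg_left (add_le_add t₀ t₁) hM0
    have h3 : M * (4 * κ * ‖w‖) ≤ M * (|h₀ p| + |h₁ p| + 2 * κ * ‖w‖) := by linarith
    exact le_of_mul_le_mul_left h3 hMp
  have hs : 2 * (κ * ‖w‖) ≤ |h₀ p| + |h₁ p| := by linarith
  have hn : 0 ≤ κ * ‖w‖ := by positivity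
  nlinarith [sq_abs (h₀ p), sq_abs (h₁ p), sq_nonneg (|h₀ p| - |h₁ p|), abs_nonneg (h₀ p),
    abs_nonneg (h₁ p)]

theorem flatKernel_rescale {D h₀ h₁ ζ : ℝ × ℝ → ℝ} {l : ℝ} (hl : 0 < l) (p : ℝ × ℝ) :
    l ^ 2 * flatKernel D h₀ h₁ ζ l p =
      D p / √((l⁻¹ * h₀ p) ^ 2 + (l⁻¹ * h₁ p) ^ 2 + ζ p ^ 2) ^ 3 := by
  have e : h₀ p ^ 2 + h₁ p ^ 2 + (l * ζ p) ^ 2 =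
      l ^ 2 * ((l⁻¹ * h₀ p) ^ 2 + (l⁻¹ * h₁ p) ^ 2 + ζ p ^ 2) := by field_simp
  rw [flatKernel, e, Real.sqrt_mul (by positivity), Real.sqrt_sq hl.le, mul_pow]
  by_cases h : √((l⁻¹ * h₀ p) ^ 2 + (l⁻¹ * h₁ p) ^ 2 + ζ p ^ 2) = 0
  · simp [h]
  · field_simp

/-- Near a transverse crossing `c`, where `(h₀, h₁)` vanishes and has an invertible derivative, the
flattened kernels concentrate at `c`: substitute `p = c + l w`. -/
theorem tendsto_flatKernel_ball {D h₀ h₁ ζ : ℝ × ℝ → ℝ} {c : ℝ × ℝ} {a₀ a₁ b₀ b₁ : ℝ}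
    (hP : a₀ * b₁ - a₁ * b₀ ≠ 0) (z₀ : h₀ c = 0) (z₁ : h₁ c = 0)
    (d₀ : HasFDerivAt h₀
      (a₀ • ContinuousLinearMap.fst ℝ ℝ ℝ - b₀ • ContinuousLinearMap.snd ℝ ℝ ℝ) c)
    (d₁ : HasFDerivAt h₁
      (a₁ • ContinuousLinearMap.fst ℝ ℝ ℝ - b₁ • ContinuousLinearMap.snd ℝ ℝ ℝ) c)
    (hζ0 : ζ c ≠ 0) (hD : ∀ᶠ p in 𝓝 c, ContinuousAt D p) (hζ : ∀ᶠ p in 𝓝 c, ContinuousAt ζ p)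
    (hh₀ : ∀ᶠ p in 𝓝 c, ContinuousAt h₀ p) (hh₁ : ∀ᶠ p in 𝓝 c, ContinuousAt h₁ p) :
    ∀ᶠ δ in 𝓝[>] (0 : ℝ), Tendsto
      (fun l => ∫ p in Metric.ball c δ, flatKernel D h₀ h₁ ζ l p) (𝓝[>] 0)
      (𝓝 (D c * (2 * Real.pi / (|a₀ * b₁ - a₁ * b₀| * |ζ c|)))) := by
  obtain ⟨k, hk, hkh⟩ := eventually_linear_le hP z₀ z₁ d₀ d₁
  have hζb : ∀ᶠ p in 𝓝 c, |ζ c| / 2 < |ζ p| :=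
    hζ.self_of_nhds.abs.eventually (lt_mem_nhds (by have := abs_pos.2 hζ0; linarith))
  have hDb : ∀ᶠ p in 𝓝 c, |D p| < |D c| + 1 :=
    hD.self_of_nhds.abs.eventually (gt_mem_nhds (by linarith))
  obtain ⟨δ₀, hδ₀, hδ⟩ := Metric.eventually_nhds_iff_ball.1
    (hkh.and (hζb.and (hDb.and (hD.and (hζ.and (hh₀.and hh₁))))))
  filter_upwards [Ioo_mem_nhdsGT hδ₀] with δ hδ'
  have hball : ∀ p ∈ Metric.ball c δ, p ∈ Metric.ball c δ₀ :=
    fun p hp => Metric.ball_subset_ball hδ'.2.le hp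
  set F : ℝ → ℝ × ℝ → ℝ := fun l => (Metric.ball c δ).indicator (flatKernel D h₀ h₁ ζ l) with hF
  -- The substitution `p = c + l w`, with Jacobian `l ^ 2`; the rescaled kernels are dominated by a
  -- multiple of the integrable function `(1 + ‖w‖ ^ 2) ^ (-3 / 2)`.
  have hsub : ∀ l > 0, ∫ p in Metric.ball c δ, flatKernel D h₀ h₁ ζ l p =
      ∫ w, l ^ 2 * F l (c + l • w) := by
    intro l hl
    rw [integral_const_mul, Measure.integral_comp_smul volume (fun v => F l (c + v)),
      integral_add_left_eq_self (μ := volume) (F l) c, hF,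
      integral_indicator Metric.isOpen_ball.measurableSet,
      Module.finrank_prod, Module.finrank_self, smul_eq_mul, abs_of_pos (by positivity)]
    field_simp
  set z := |ζ c| / 2 with hz
  have hzp : 0 < z := by have := abs_pos.2 hζ0; positivity
  set m := min k (z ^ 2) with hm
  have hmp : 0 < m := lt_min hk (by positivity)
  have hcont : ∀ l > 0, ContinuousOn (flatKernel D h₀ h₁ ζ l) (Metric.ball c δ) := by
    intro l hl p hp
    obtain ⟨q1, q2, q3, q4, q5, q6, q7⟩ := hδ p (hball p hp)
    refine ContinuousAt.continuousWithinAt ?_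
    have hpos : 0 < h₀ p ^ 2 + h₁ p ^ 2 + (l * ζ p) ^ 2 := by
      have : ζ p ≠ 0 := abs_pos.1 (hzp.trans q2)
      positivity
    unfold flatKernel
    refine ContinuousAt.div (by fun_prop) ?_ (pow_ne_zero _ (Real.sqrt_pos.2 hpos).ne')
    refine ContinuousAt.pow (ContinuousAt.sqrt ?_) 3
    fun_prop
  have hmeas : ∀ l > 0, AEStronglyMeasurable (fun w => l ^ 2 * F l (c + l • w)) volume := by
    intro l hl
    have h1 : StronglyMeasurable (F l) := by
      have : Measurable (F l) := by
        rw [hF]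
        classical
        beta_reduce
        rw [← Set.piecewise_eq_indicator]
        exact (hcont l hl).measurable_piecewise continuousOn_const Metric.isOpen_ball.measurableSet
      exact this.stronglyMeasurable
    exact ((h1.comp_measurable (g := fun w : ℝ × ℝ => c + l • w)
      (by fun_prop)).const_mul (l ^ 2)).aestronglyMeasurable
  have hlim := tendsto_integral_filter_of_dominated_convergence (μ := (volume : Measure (ℝ × ℝ)))
    (l := 𝓝[>] (0 : ℝ)) (F := fun l w => l ^ 2 * F l (c + l • w))
    (f := fun w => D c * (1 / √((a₀ * w.1 - b₀ * w.2) ^ 2 + (a₁ * w.1 - b₁ * w.2) ^ 2 +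
      ζ c ^ 2) ^ 3))
    (fun w => (|D c| + 1) * (m ^ (-(3 : ℝ) / 2) * (1 + ‖w‖ ^ 2) ^ (-(3 : ℝ) / 2)))
    (by filter_upwards [self_mem_nhdsWithin] with l hl using hmeas l hl)
    (by
      filter_upwards [self_mem_nhdsWithin] with l hl
      have hl : 0 < l := hl
      refine Eventually.of_forall fun w => ?_
      by_cases hp : c + l • w ∈ Metric.ball c δ
      · obtain ⟨q1, q2, q3, -⟩ := hδ _ (hball _ hp)
        simp only [hF, indicator_of_mem hp]
        rw [flatKernel_rescale hl, Real.norm_eq_abs, abs_div, div_eq_mul_inv]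
        refine mul_le_mul q3.le ?_ (by positivity) (by positivity)
        rw [← Real.mul_rpow hmp.le (by positivity), abs_of_nonneg (by positivity)]
        set q := c + l • w with hq
        have hw : q - c = l • w := by rw [hq]; abel
        rw [hw, norm_smul, Real.norm_eq_abs, abs_of_pos hl] at q1
        have hbig : m * (1 + ‖w‖ ^ 2) ≤ (l⁻¹ * h₀ q) ^ 2 + (l⁻¹ * h₁ q) ^ 2 + ζ q ^ 2 := by
          have e1 : m * ‖w‖ ^ 2 ≤ (l⁻¹ * h₀ q) ^ 2 + (l⁻¹ * h₁ q) ^ 2 := by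
            have e2 : k * ‖w‖ ^ 2 ≤ (l⁻¹ * h₀ q) ^ 2 + (l⁻¹ * h₁ q) ^ 2 := by
              have : (l⁻¹ * h₀ q) ^ 2 + (l⁻¹ * h₁ q) ^ 2 = (h₀ q ^ 2 + h₁ q ^ 2) / l ^ 2 := by
                field_simp
              rw [this, le_div_iff₀ (by positivity)]
              calc _ = k * (l * ‖w‖) ^ 2 := by ring
                _ ≤ _ := q1
            exact (mul_le_mul_of_nonneg_right (min_le_left _ _) (by positivity)).trans e2
          have e3 : m ≤ ζ q ^ 2 := (min_le_right _ _).trans (by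
            rw [← sq_abs (ζ q)]
            exact pow_le_pow_left₀ hzp.le q2.le 2)
          linarith
        have hpos : 0 < m * (1 + ‖w‖ ^ 2) := by positivity
        rw [Real.sqrt_eq_rpow, ← Real.rpow_natCast, ← Real.rpow_mul (by positivity),
          ← Real.rpow_neg (by positivity)]
        norm_num
        exact Real.rpow_le_rpow_of_nonpos hpos hbig (by norm_num)
      · simp only [hF, indicator_of_notMem hp, mul_zero, norm_zero]
        positivity)
    ((integrable_inv_one_add_norm_sq.const_mul _).const_mul _)
    (by
      refine Eventually.of_forall fun w => ?_
      have hcl : Tendsto (fun l : ℝ => c + l • w) (𝓝[>] 0) (𝓝 c) := by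
        have : Tendsto (fun l : ℝ => c + l • w) (𝓝 0) (𝓝 (c + (0 : ℝ) • w)) :=
          Continuous.tendsto (by fun_prop) 0
        rw [zero_smul, add_zero] at this
        exact this.mono_left nhdsWithin_le_nhds
      have hline : HasDerivAt (fun l : ℝ => c + l • w) w 0 := by
        simpa using ((hasDerivAt_id (0 : ℝ)).smul_const w).const_add c
      have slope : ∀ {h : ℝ × ℝ → ℝ} {a b : ℝ}, h c = 0 → HasFDerivAt h
          (a • ContinuousLinearMap.fst ℝ ℝ ℝ - b • ContinuousLinearMap.snd ℝ ℝ ℝ) c →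
          Tendsto (fun l : ℝ => l⁻¹ * h (c + l • w)) (𝓝[>] 0) (𝓝 (a * w.1 - b * w.2)) := by
        intro h a b h0 hd
        have hd' : HasFDerivAt h
          (a • ContinuousLinearMap.fst ℝ ℝ ℝ - b • ContinuousLinearMap.snd ℝ ℝ ℝ)
          (c + (0 : ℝ) • w) := by simpa using hd
        have := (hd'.comp_hasDerivAt (0 : ℝ) hline).tendsto_slope_zero_right
        simpa [h0] using this
      have t₀ := slope z₀ d₀
      have t₁ := slope z₁ d₁
      have tD := hD.self_of_nhds.tendsto.comp hcl
      have tζ := hζ.self_of_nhds.tendsto.comp hcl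
      have hin : ∀ᶠ l : ℝ in 𝓝[>] 0, c + l • w ∈ Metric.ball c δ :=
        hcl.eventually (Metric.ball_mem_nhds c hδ'.1)
      have hpos : 0 < (a₀ * w.1 - b₀ * w.2) ^ 2 + (a₁ * w.1 - b₁ * w.2) ^ 2 + ζ c ^ 2 := by
        positivity
      have tall := tD.div ((((t₀.pow 2).add (t₁.pow 2)).add (tζ.pow 2)).sqrt.pow 3)
        (pow_ne_zero _ (Real.sqrt_pos.2 hpos).ne')
      rw [mul_one_div]
      refine tall.congr' ?_
      filter_upwards [self_mem_nhdsWithin, hin] with l hl hp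
      simp only [hF, indicator_of_mem hp]
      rw [flatKernel_rescale hl]
      rfl)
  rw [integral_const_mul, integral_linear_radial hP hζ0] at hlim
  refine hlim.congr' ?_
  filter_upwards [self_mem_nhdsWithin] with l hl using (hsub l hl).symm

/-- If the integrals of `g l` over small balls about finitely many points have limits, and the
contribution of the complement of such balls tends to zero, then the integrals converge to the sum
of these limits. -/
theorem tendsto_setIntegral_of_concentrates {g : ℝ → ℝ × ℝ → ℝ} {S : Set (ℝ × ℝ)}
    (C : Finset (ℝ × ℝ)) (v : ℝ × ℝ → ℝ)
    (hg : ∀ l > 0, IntegrableOn (g l) S)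
    (hC : ∀ c ∈ C, ∀ᶠ δ in 𝓝[>] (0 : ℝ),
      Tendsto (fun l => ∫ p in Metric.ball c δ, g l p) (𝓝[>] 0) (𝓝 (v c)))
    (hint : ∀ c ∈ C, S ∈ 𝓝 c)
    (hrest : ∀ δ > 0, Tendsto (fun l => ∫ p in S \ ⋃ c ∈ C, Metric.ball c δ, g l p)
      (𝓝[>] 0) (𝓝 0)) :
    Tendsto (fun l => ∫ p in S, g l p) (𝓝[>] 0) (𝓝 (∑ c ∈ C, v c)) := by
  have e1 : ∀ᶠ δ in 𝓝[>] (0 : ℝ), ∀ c ∈ C, Metric.ball c δ ⊆ S := by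
    rw [Filter.eventually_all_finset]
    intro c hc
    obtain ⟨r, hr, hrS⟩ := Metric.mem_nhds_iff.1 (hint c hc)
    filter_upwards [Ioo_mem_nhdsGT hr] with δ hδ
    exact (Metric.ball_subset_ball hδ.2.le).trans hrS
  have e2 : ∀ᶠ δ in 𝓝[>] (0 : ℝ), ∀ c ∈ C, ∀ c' ∈ C, c ≠ c' →
      Disjoint (Metric.ball c δ) (Metric.ball c' δ) := by
    rw [Filter.eventually_all_finset]
    intro c hc
    rw [Filter.eventually_all_finset]
    intro c' hc'
    by_cases h : c = c'
    · exact Eventually.of_forall fun δ hn => absurd h hn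
    · have : 0 < dist c c' := dist_pos.2 h
      filter_upwards [Ioo_mem_nhdsGT (half_pos this)] with δ hδ _
      exact Metric.ball_disjoint_ball (by linarith [hδ.2])
  have e3 : ∀ᶠ δ in 𝓝[>] (0 : ℝ), ∀ c ∈ C,
      Tendsto (fun l => ∫ p in Metric.ball c δ, g l p) (𝓝[>] 0) (𝓝 (v c)) :=
    (Filter.eventually_all_finset C).2 hC
  obtain ⟨δ, h1, h2, h3, h4⟩ := (e1.and (e2.and (e3.and self_mem_nhdsWithin))).exists
  have hU : MeasurableSet (⋃ c ∈ C, Metric.ball c δ) :=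
    Finset.measurableSet_biUnion _ fun c _ => Metric.isOpen_ball.measurableSet
  have hUS : (⋃ c ∈ C, Metric.ball c δ) ⊆ S := iUnion₂_subset h1
  have hlim := (hrest δ h4).add (tendsto_finsetSum C h3)
  rw [zero_add] at hlim
  refine hlim.congr' ?_
  filter_upwards [self_mem_nhdsWithin] with l hl
  rw [← integral_biUnion_finset C (fun c _ => Metric.isOpen_ball.measurableSet)
    (fun c hc c' hc' hne => h2 c hc c' hc' hne) fun c hc => (hg l hl).mono_set (h1 c hc)]
  rw [setIntegral_sdiff hU (hg l hl) hUS]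
  ring

/-! ### Flattening a pair of curves -/

/-- The linear map that multiplies the height by `l`. -/
def flatten (l : ℝ) (p : E3) : E3 := !₂[p 0, p 1, l * p 2]

theorem flatten_one (p : E3) : flatten 1 p = p := by
  ext i; fin_cases i <;> simp [flatten]

theorem flatten_flatten (l m : ℝ) (p : E3) : flatten l (flatten m p) = flatten (l * m) p := by
  ext i; fin_cases i <;> simp [flatten, mul_assoc]

theorem flatten_injective {l : ℝ} (hl : l ≠ 0) : Function.Injective (flatten l) := by
  intro p q h
  rw [← flatten_one p, ← flatten_one q, ← inv_mul_cancel₀ hl, ← flatten_flatten, h,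
    flatten_flatten]

theorem contDiff_flatten : ContDiff ℝ ∞ fun x : ℝ × E3 => flatten x.1 x.2 := by
  have h : ∀ k : Fin 3, ContDiff ℝ ∞ fun x : ℝ × E3 => x.2 k := fun k =>
    (EuclideanSpace.proj (𝕜 := ℝ) k).contDiff.comp contDiff_snd
  rw [contDiff_euclidean]
  intro i
  fin_cases i
  · exact h 0
  · exact h 1
  · exact contDiff_fst.mul (h 2)

theorem hasDerivWithinAt_of_coord {f : ℝ → E3} {f' : E3} {S : Set ℝ} {x : ℝ}
    (h : ∀ i, HasDerivWithinAt (fun y => f y i) (f' i) S x) : HasDerivWithinAt f f' S x := by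
  rw [hasDerivWithinAt_iff_hasFDerivWithinAt, hasFDerivWithinAt_euclidean]
  intro i
  refine (h i).hasFDerivWithinAt.congr_fderiv ?_
  ext
  simp

theorem hasDerivAt_of_coord {f : ℝ → E3} {f' : E3} {x : ℝ}
    (h : ∀ i, HasDerivAt (fun y => f y i) (f' i) x) : HasDerivAt f f' x := by
  rw [← hasDerivWithinAt_univ]
  exact hasDerivWithinAt_of_coord fun i => (h i).hasDerivWithinAt

theorem HasDerivAt.flatten {α : ℝ → E3} {α' : E3} {s : ℝ} (h : HasDerivAt α α' s) (l : ℝ) :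
    HasDerivAt (fun s => flatten l (α s)) (flatten l α') s := by
  refine hasDerivAt_of_coord fun i => ?_
  fin_cases i
  · exact h.coord 0
  · exact h.coord 1
  · exact (h.coord 2).const_mul l

theorem deriv_flatten {l : ℝ} (hl : l ≠ 0) (α : ℝ → E3) (s : ℝ) :
    deriv (fun s => flatten l (α s)) s = flatten l (deriv α s) := by
  by_cases h : DifferentiableAt ℝ α s
  · exact (h.hasDerivAt.flatten l).deriv
  · have h' : ¬ DifferentiableAt ℝ (fun s => flatten l (α s)) s := by
      intro hd
      refine h ?_
      have := (hd.hasDerivAt.flatten l⁻¹).differentiableAt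
      simpa only [flatten_flatten, inv_mul_cancel₀ hl, flatten_one] using this
    rw [deriv_zero_of_not_differentiableAt h, deriv_zero_of_not_differentiableAt h']
    ext i; fin_cases i <;> simp [_root_.flatten]

/-- The numerator of the Gauss integrand. -/
def numer (α β : ℝ → E3) (p : ℝ × ℝ) : ℝ :=
  tripleProd (α p.1 - β p.2) (deriv α p.1) (deriv β p.2)

/-- The `i`-th coordinate of the difference of two curves. -/
def diffCoord (α β : ℝ → E3) (i : Fin 3) (p : ℝ × ℝ) : ℝ := α p.1 i - β p.2 i

theorem gaussKernel_flatten (α β : ℝ → E3) {l : ℝ} (hl : l ≠ 0) (p : ℝ × ℝ) :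
    gaussKernel (flatten l (α p.1) - flatten l (β p.2)) (deriv (fun s => flatten l (α s)) p.1)
      (deriv (fun s => flatten l (β s)) p.2) =
      flatKernel (numer α β) (diffCoord α β 0) (diffCoord α β 1) (diffCoord α β 2) l p := by
  rw [deriv_flatten hl, deriv_flatten hl, gaussKernel, flatKernel]
  congr 1
  · simp [tripleProd, flatten, numer]; ring
  · rw [← Real.sqrt_sq (norm_nonneg (flatten l (α p.1) - flatten l (β p.2))), norm_sq_eq_coords]
    congr 2
    simp [flatten, diffCoord]; ring

theorem IsSmoothLoop.continuousOn {α : ℝ → E3} (hα : IsSmoothLoop α) :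
    ContinuousOn α (Icc 0 2) := by
  rw [← Icc_union_Icc_eq_Icc (show (0 : ℝ) ≤ 1 by norm_num) (show (1 : ℝ) ≤ 2 by norm_num)]
  exact hα.left.continuousOn.union_of_isClosed hα.right.continuousOn isClosed_Icc isClosed_Icc

theorem IsSmoothLoop.comp {α : ℝ → E3} (hα : IsSmoothLoop α) {f : E3 → E3} (hf : ContDiff ℝ ∞ f) :
    IsSmoothLoop fun s => f (α s) :=
  ⟨hf.comp_contDiffOn hα.left, hf.comp_contDiffOn hα.right, by rw [hα.closed]⟩

/-- A smooth family of maps, applied to a closed curve. -/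
theorem IsSmoothLoop.isLoopHomotopy {α : ℝ → E3} (hα : IsSmoothLoop α) {f : ℝ × E3 → E3}
    (hf : ContDiff ℝ ∞ f) : IsLoopHomotopy fun x => f (x.1, α x.2) := by
  have key : ∀ {a b : ℝ}, ContDiffOn ℝ ∞ α (Icc a b) →
      ContDiffOn ℝ ∞ (fun x : ℝ × ℝ => f (x.1, α x.2)) (patch a b) := fun h =>
    hf.comp_contDiffOn (contDiffOn_fst.prodMk (h.comp contDiffOn_snd fun x hx => hx.2))
  exact ⟨key hα.left, key hα.right, fun u _ => by simp only [hα.closed]⟩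

section Pair

variable {α β : ℝ → E3}

/-- Flattening is a homotopy through pairs of disjoint curves. -/
theorem IsSmoothLoop.gaussIntegral_flatten (hα : IsSmoothLoop α) (hβ : IsSmoothLoop β)
    (h0 : ∀ s ∈ Icc (0 : ℝ) 2, ∀ t ∈ Icc (0 : ℝ) 2, α s ≠ β t) {l : ℝ} (hl : 0 < l) :
    gaussIntegral α β = gaussIntegral (fun s => flatten l (α s)) (fun t => flatten l (β t)) := by
  have hf : ContDiff ℝ ∞ fun x : ℝ × E3 => flatten (1 - x.1 + x.1 * l) x.2 :=
    contDiff_flatten.comp (((contDiff_const.sub contDiff_fst).add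
      (contDiff_fst.mul contDiff_const)).prodMk contDiff_snd)
  have := (hα.isLoopHomotopy hf).gaussIntegral_eq (hβ.isLoopHomotopy hf) (by
    intro u hu s hs t ht h
    have hpos : 0 < 1 - u + u * l := by
      rcases hu.1.eq_or_lt with h | h
      · rw [← h]; norm_num
      · have := mul_pos h hl; linarith [hu.2]
    exact h0 s hs t ht (flatten_injective hpos.ne' h))
  simpa [flatten_one] using this

theorem isSmoothLoop_flatten (hα : IsSmoothLoop α) (l : ℝ) :
    IsSmoothLoop fun s => flatten l (α s) :=
  hα.comp (contDiff_flatten.comp (contDiff_const.prodMk contDiff_id))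

theorem IsSmoothLoop.integrableOn_flatKernel (hα : IsSmoothLoop α) (hβ : IsSmoothLoop β)
    (h0 : ∀ s ∈ Icc (0 : ℝ) 2, ∀ t ∈ Icc (0 : ℝ) 2, α s ≠ β t) {l : ℝ} (hl : 0 < l) :
    IntegrableOn (flatKernel (numer α β) (diffCoord α β 0) (diffCoord α β 1) (diffCoord α β 2) l)
      (Icc 0 2 ×ˢ Icc 0 2) := by
  have := (isSmoothLoop_flatten hα l).integrableOn_gaussKernel (isSmoothLoop_flatten hβ l)
    fun s hs t ht h => h0 s hs t ht (flatten_injective hl.ne' h)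
  simpa only [gaussKernel_flatten α β hl.ne'] using this

theorem IsSmoothLoop.gaussIntegral_eq_flatKernel (hα : IsSmoothLoop α) (hβ : IsSmoothLoop β)
    (h0 : ∀ s ∈ Icc (0 : ℝ) 2, ∀ t ∈ Icc (0 : ℝ) 2, α s ≠ β t) {l : ℝ} (hl : 0 < l) :
    gaussIntegral α β = 1 / (4 * Real.pi) * ∫ p in Icc (0 : ℝ) 2 ×ˢ Icc (0 : ℝ) 2,
      flatKernel (numer α β) (diffCoord α β 0) (diffCoord α β 1) (diffCoord α β 2) l p := by
  rw [hα.gaussIntegral_flatten hβ h0 hl,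
    (isSmoothLoop_flatten hα l).gaussIntegral_eq_setIntegral (isSmoothLoop_flatten hβ l)
    fun s hs t ht h => h0 s hs t ht (flatten_injective hl.ne' h)]
  simp only [gaussKernel_flatten α β hl.ne']

theorem IsSmoothLoop.continuousOn_sub (hα : IsSmoothLoop α) (hβ : IsSmoothLoop β) :
    ContinuousOn (fun p : ℝ × ℝ => α p.1 - β p.2) (Icc 0 2 ×ˢ Icc 0 2) :=
  (hα.continuousOn.comp continuousOn_fst fun _ h => h.1).sub
    (hβ.continuousOn.comp continuousOn_snd fun _ h => h.2)

theorem IsSmoothLoop.continuousOn_diffCoord (hα : IsSmoothLoop α) (hβ : IsSmoothLoop β)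
    (i : Fin 3) : ContinuousOn (diffCoord α β i) (Icc 0 2 ×ˢ Icc 0 2) :=
  (EuclideanSpace.proj (𝕜 := ℝ) i).continuous.comp_continuousOn (hα.continuousOn_sub hβ)

theorem IsSmoothLoop.integrableOn_numer (hα : IsSmoothLoop α) (hβ : IsSmoothLoop β)
    (h0 : ∀ s ∈ Icc (0 : ℝ) 2, ∀ t ∈ Icc (0 : ℝ) 2, α s ≠ β t) :
    IntegrableOn (numer α β) (Icc 0 2 ×ˢ Icc 0 2) := by
  have h := (hα.integrableOn_gaussKernel hβ h0).mul_continuousOn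
    ((hα.continuousOn_sub hβ).norm.pow 3) (isCompact_Icc.prod isCompact_Icc)
  refine h.congr_fun (fun p hp => ?_) (measurableSet_Icc.prod measurableSet_Icc)
  have : ‖α p.1 - β p.2‖ ≠ 0 := norm_ne_zero_iff.2 (sub_ne_zero.2 (h0 _ hp.1 _ hp.2))
  simp only [gaussKernel, numer, Pi.pow_apply]
  field_simp

/-- The planar determinant of the velocities. -/
def planarDet (a b : E3) : ℝ := a 0 * b 1 - a 1 * b 0

theorem IsSmoothLoop.contDiffAt (hα : IsSmoothLoop α) {s : ℝ} (hs : s ∈ Ioo (0 : ℝ) 1) :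
    ContDiffAt ℝ ∞ α s := hα.left.contDiffAt (Icc_mem_nhds hs.1 hs.2)

theorem IsSmoothLoop.continuousAt_deriv (hα : IsSmoothLoop α) {s : ℝ} (hs : s ∈ Ioo (0 : ℝ) 1) :
    ContinuousAt (deriv α) s :=
  ((contDiffOn_infty_iff_deriv_of_isOpen isOpen_Ioo).1
    (hα.left.mono Ioo_subset_Icc_self)).2.continuousOn.continuousAt (Ioo_mem_nhds hs.1 hs.2)

theorem IsSmoothLoop.hasFDerivAt_diffCoord (hα : IsSmoothLoop α) (hβ : IsSmoothLoop β)
    {c : ℝ × ℝ} (hc : c ∈ Ioo (0 : ℝ) 1 ×ˢ Ioo (0 : ℝ) 1) (i : Fin 3) :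
    HasFDerivAt (diffCoord α β i) ((deriv α c.1 i) • ContinuousLinearMap.fst ℝ ℝ ℝ -
      (deriv β c.2 i) • ContinuousLinearMap.snd ℝ ℝ ℝ) c := by
  have h1 := (((hα.contDiffAt hc.1).differentiableAt (by simp)).hasDerivAt).coord i
  have h2 := (((hβ.contDiffAt hc.2).differentiableAt (by simp)).hasDerivAt).coord i
  have k1 := h1.comp_hasFDerivAt c (hasFDerivAt_fst (𝕜 := ℝ) (p := c))
  have k2 := h2.comp_hasFDerivAt c (hasFDerivAt_snd (𝕜 := ℝ) (p := c))
  exact k1.sub k2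

theorem IsSmoothLoop.continuousAt_numer (hα : IsSmoothLoop α) (hβ : IsSmoothLoop β)
    {c : ℝ × ℝ} (hc : c ∈ Ioo (0 : ℝ) 1 ×ˢ Ioo (0 : ℝ) 1) : ContinuousAt (numer α β) c := by
  have h1 := (hα.contDiffAt hc.1).continuousAt.comp (continuousAt_fst (p := c))
  have h2 := (hβ.contDiffAt hc.2).continuousAt.comp (continuousAt_snd (p := c))
  have h3 := (hα.continuousAt_deriv hc.1).comp (continuousAt_fst (p := c))
  have h4 := (hβ.continuousAt_deriv hc.2).comp (continuousAt_snd (p := c))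
  exact continuous_tripleProd.continuousAt.comp ((h1.sub h2).prodMk (h3.prodMk h4))

theorem mul_div_abs_eq_sign {P ζ : ℝ} :
    ζ * P * (2 * Real.pi / (|P| * |ζ|)) = 2 * Real.pi * SignType.sign (ζ * P) := by
  rw [mul_comm |P|, ← abs_mul]
  rcases lt_trichotomy (ζ * P) 0 with h | h | h
  · rw [abs_of_neg h, sign_neg h]
    rw [SignType.coe_neg_one]
    have := h.ne
    generalize ζ * P = x at *
    field_simp
  · simp [h]
  · rw [abs_of_pos h, sign_pos h]
    rw [SignType.coe_one]
    have := h.ne'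
    generalize ζ * P = x at *
    field_simp

/-- The flattened Gauss integral concentrates at a transverse crossing, whose contribution is `2π`
times its sign. -/
theorem IsSmoothLoop.tendsto_flatKernel_crossing (hα : IsSmoothLoop α) (hβ : IsSmoothLoop β)
    {c : ℝ × ℝ} (hc : c ∈ Ioo (0 : ℝ) 1 ×ˢ Ioo (0 : ℝ) 1) (z₀ : α c.1 0 = β c.2 0)
    (z₁ : α c.1 1 = β c.2 1) (z₂ : α c.1 2 ≠ β c.2 2)
    (hP : planarDet (deriv α c.1) (deriv β c.2) ≠ 0) :
    ∀ᶠ δ in 𝓝[>] (0 : ℝ), Tendsto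
      (fun l => ∫ p in Metric.ball c δ,
        flatKernel (numer α β) (diffCoord α β 0) (diffCoord α β 1) (diffCoord α β 2) l p) (𝓝[>] 0)
      (𝓝 (2 * Real.pi * (SignType.sign
        ((α c.1 2 - β c.2 2) * planarDet (deriv α c.1) (deriv β c.2)) : ℝ))) := by
  have ev : ∀ᶠ p in 𝓝 c, p ∈ Ioo (0 : ℝ) 1 ×ˢ Ioo (0 : ℝ) 1 :=
    (isOpen_Ioo.prod isOpen_Ioo).mem_nhds hc
  have hcd : ∀ i, ∀ᶠ p in 𝓝 c, ContinuousAt (diffCoord α β i) p := fun i =>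
    ev.mono fun p hp => (hα.hasFDerivAt_diffCoord hβ hp i).continuousAt
  have := tendsto_flatKernel_ball (D := numer α β) hP (sub_eq_zero.2 z₀) (sub_eq_zero.2 z₁)
    (hα.hasFDerivAt_diffCoord hβ hc 0) (hα.hasFDerivAt_diffCoord hβ hc 1)
    (ζ := diffCoord α β 2) (sub_ne_zero.2 z₂) (ev.mono fun p hp => hα.continuousAt_numer hβ hp)
    (hcd 2) (hcd 0) (hcd 1)
  have e : numer α β c = (α c.1 2 - β c.2 2) * planarDet (deriv α c.1) (deriv β c.2) := by
    simp only [numer, tripleProd, planarDet, PiLp.sub_apply, z₀, z₁]; ring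
  rw [e] at this
  rw [← mul_div_abs_eq_sign]
  exact this

/-- The Gauss integral of two closed curves whose projections to the plane intersect transversally,
away from the corners, is half the number of crossings, counted with signs. -/
theorem IsSmoothLoop.gaussIntegral_eq_sum_sign (hα : IsSmoothLoop α) (hβ : IsSmoothLoop β)
    (h0 : ∀ s ∈ Icc (0 : ℝ) 2, ∀ t ∈ Icc (0 : ℝ) 2, α s ≠ β t) (C : Finset (ℝ × ℝ))
    (hC : ∀ s ∈ Icc (0 : ℝ) 2, ∀ t ∈ Icc (0 : ℝ) 2, α s 0 = β t 0 → α s 1 = β t 1 → (s, t) ∈ C)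
    (hC' : ∀ c ∈ C, c ∈ Ioo (0 : ℝ) 1 ×ˢ Ioo (0 : ℝ) 1 ∧ α c.1 0 = β c.2 0 ∧ α c.1 1 = β c.2 1 ∧
      planarDet (deriv α c.1) (deriv β c.2) ≠ 0) :
    gaussIntegral α β = 1 / 2 * ∑ c ∈ C,
      (SignType.sign ((α c.1 2 - β c.2 2) * planarDet (deriv α c.1) (deriv β c.2)) : ℝ) := by
  have hsub : Ioo (0 : ℝ) 1 ×ˢ Ioo (0 : ℝ) 1 ⊆ Icc (0 : ℝ) 2 ×ˢ Icc (0 : ℝ) 2 := fun p hp =>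
    ⟨⟨hp.1.1.le, by linarith [hp.1.2]⟩, ⟨hp.2.1.le, by linarith [hp.2.2]⟩⟩
  have z2 : ∀ c ∈ C, α c.1 2 ≠ β c.2 2 := by
    intro c hc h
    obtain ⟨h1, h2, h3, -⟩ := hC' c hc
    refine h0 c.1 (hsub h1).1 c.2 (hsub h1).2 ?_
    ext i; fin_cases i
    exacts [h2, h3, h]
  have lim := tendsto_setIntegral_of_concentrates (S := Icc (0 : ℝ) 2 ×ˢ Icc (0 : ℝ) 2)
    (g := flatKernel (numer α β) (diffCoord α β 0) (diffCoord α β 1) (diffCoord α β 2))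
    C _
    (fun l hl => hα.integrableOn_flatKernel hβ h0 hl)
    (fun c hc => hα.tendsto_flatKernel_crossing hβ (hC' c hc).1 (hC' c hc).2.1 (hC' c hc).2.2.1
      (z2 c hc) (hC' c hc).2.2.2)
    (fun c hc => mem_of_superset ((isOpen_Ioo.prod isOpen_Ioo).mem_nhds (hC' c hc).1) hsub)
    (by
      intro δ hδ
      set K := (Icc (0 : ℝ) 2 ×ˢ Icc (0 : ℝ) 2) \ ⋃ c ∈ C, Metric.ball c δ with hK
      have hKs : K ⊆ Icc (0 : ℝ) 2 ×ˢ Icc (0 : ℝ) 2 := sdiff_subset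
      have hKc : IsCompact K := (isCompact_Icc.prod isCompact_Icc).diff
        (isOpen_biUnion fun c _ => Metric.isOpen_ball)
      -- Away from the crossings the planar distance is bounded below.
      obtain ⟨m, hm, hmK⟩ : ∃ m > 0, ∀ p ∈ K,
          m ≤ diffCoord α β 0 p ^ 2 + diffCoord α β 1 p ^ 2 := by
        refine hKc.exists_forall_le' (a := 0) ?_ ?_
        · exact (((hα.continuousOn_diffCoord hβ 0).pow 2).add
            ((hα.continuousOn_diffCoord hβ 1).pow 2)).mono hKs
        · intro p hp
          by_contra hcon
          have h1 : diffCoord α β 0 p = 0 := by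
            nlinarith [sq_nonneg (diffCoord α β 0 p), sq_nonneg (diffCoord α β 1 p)]
          have h2 : diffCoord α β 1 p = 0 := by
            nlinarith [sq_nonneg (diffCoord α β 0 p), sq_nonneg (diffCoord α β 1 p)]
          have := hC p.1 (hKs hp).1 p.2 (hKs hp).2 (sub_eq_zero.1 h1) (sub_eq_zero.1 h2)
          exact hp.2 (mem_biUnion this (Metric.mem_ball_self hδ))
      have hD := (hα.integrableOn_numer hβ h0).mono_set hKs
      refine squeeze_zero_norm' (a := fun l => l * ((∫ p in K, ‖numer α β p‖) / √m ^ 3)) ?_ ?_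
      · filter_upwards [self_mem_nhdsWithin] with l hl
        have hl : 0 < l := hl
        rw [← integral_div, ← integral_const_mul]
        refine norm_integral_le_of_norm_le ((hD.norm.div_const _).const_mul l) ?_
        refine (ae_restrict_iff' hKc.measurableSet).2 (Eventually.of_forall fun p hp => ?_)
        rw [flatKernel, norm_div, norm_mul, Real.norm_of_nonneg hl.le, mul_div_assoc]
        refine mul_le_mul_of_nonneg_left ?_ hl.le
        refine div_le_div_of_nonneg_left (norm_nonneg _) (by positivity) ?_
        rw [Real.norm_of_nonneg (by positivity)]
        refine pow_le_pow_left₀ (Real.sqrt_nonneg _) (Real.sqrt_le_sqrt ?_) 3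
        have := hmK p hp
        nlinarith [sq_nonneg (l * diffCoord α β 2 p)]
      · have : Tendsto (fun l : ℝ => l * ((∫ p in K, ‖numer α β p‖) / √m ^ 3)) (𝓝 0)
          (𝓝 (0 * ((∫ p in K, ‖numer α β p‖) / √m ^ 3))) := by
          exact Continuous.tendsto (by fun_prop) 0
        rw [zero_mul] at this
        exact this.mono_left nhdsWithin_le_nhds)
  have hconst := (lim.const_mul (1 / (4 * Real.pi))).congr' (f₂ := fun _ => gaussIntegral α β) (by
    filter_upwards [self_mem_nhdsWithin] with l hl
    exact (hα.gaussIntegral_eq_flatKernel hβ h0 hl).symm)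
  rw [tendsto_nhds_unique tendsto_const_nhds hconst, ← Finset.mul_sum]
  field_simp
  norm_num

end Pair

/-! ### Integrality of linking numbers -/

section Pair

variable {α β : ℝ → E3}

theorem IsSmoothLoop.add_const (hα : IsSmoothLoop α) (v : E3) : IsSmoothLoop fun s => α s + v :=
  hα.comp (f := fun p => p + v) (by fun_prop)

theorem IsSmoothLoop.exists_bound (hα : IsSmoothLoop α) :
    ∃ R : ℝ, ∀ s ∈ Icc (0 : ℝ) 2, ∀ i, |α s i| ≤ R := by
  obtain ⟨R, hR⟩ := isCompact_Icc.exists_bound_of_continuousOn hα.continuousOn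
  refine ⟨R, fun s hs i => ?_⟩
  have := PiLp.norm_apply_le (α s) i
  rw [Real.norm_eq_abs] at this
  exact this.trans (hR s hs)

theorem even_sign_mul_sub_sign {x y : ℝ} (hx : x ≠ 0) :
    Even ((SignType.sign (x * y) : ℤ) - (SignType.sign y : ℤ)) := by
  rw [sign_mul]
  rcases hx.lt_or_gt with h | h
  · rw [sign_neg h]
    exact ⟨-(SignType.sign y : ℤ), by simp; ring⟩
  · rw [sign_pos h]
    exact ⟨0, by simp⟩

/-- The crossings of two closed curves in general position are even in number: if one of the curves
is moved far below the other one, then the Gauss integral becomes half the algebraic intersection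
number of the plane curves; and it is zero, for one can now pull the curves apart sideways. -/
theorem IsSmoothLoop.even_sum_sign (hα : IsSmoothLoop α) (hβ : IsSmoothLoop β)
    (h0 : ∀ s ∈ Icc (0 : ℝ) 2, ∀ t ∈ Icc (0 : ℝ) 2, α s ≠ β t) (C : Finset (ℝ × ℝ))
    (hC : ∀ s ∈ Icc (0 : ℝ) 2, ∀ t ∈ Icc (0 : ℝ) 2, α s 0 = β t 0 → α s 1 = β t 1 → (s, t) ∈ C)
    (hC' : ∀ c ∈ C, c ∈ Ioo (0 : ℝ) 1 ×ˢ Ioo (0 : ℝ) 1 ∧ α c.1 0 = β c.2 0 ∧ α c.1 1 = β c.2 1 ∧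
      planarDet (deriv α c.1) (deriv β c.2) ≠ 0) :
    Even (∑ c ∈ C, (SignType.sign
      ((α c.1 2 - β c.2 2) * planarDet (deriv α c.1) (deriv β c.2)) : ℤ)) := by
  obtain ⟨R, hR⟩ := hα.exists_bound
  obtain ⟨R', hR'⟩ := hβ.exists_bound
  set M := R + R' + 1 with hM
  have hlow : ∀ s ∈ Icc (0 : ℝ) 2, ∀ t ∈ Icc (0 : ℝ) 2, 0 < α s 2 - (β t 2 - M) := by
    intro s hs t ht
    have h1 := (abs_le.1 (hR s hs 2)).1
    have h2 := (abs_le.1 (hR' t ht 2)).2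
    linarith
  set f : ℝ × E3 → E3 := fun x => x.2 + !₂[x.1 * M, 0, -M] with hf
  have hfs : ContDiff ℝ ∞ f := by
    refine contDiff_snd.add ?_
    rw [contDiff_euclidean]
    intro i
    fin_cases i
    · exact contDiff_fst.mul contDiff_const
    · exact contDiff_const
    · exact contDiff_const
  have hdis : ∀ u, ∀ s ∈ Icc (0 : ℝ) 2, ∀ t ∈ Icc (0 : ℝ) 2, α s ≠ f (u, β t) := by
    intro u s hs t ht h
    have h2 := hlow s hs t ht
    rw [h] at h2
    simp [hf] at h2
  have hinv := (hα.isLoopHomotopy (f := Prod.snd) contDiff_snd).gaussIntegral_eq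
    (hβ.isLoopHomotopy hfs) fun u _ => hdis u
  have hloop : ∀ u, IsSmoothLoop fun t => f (u, β t) := fun u =>
    hβ.comp (hfs.comp (contDiff_const.prodMk contDiff_id))
  have hder : ∀ u t, deriv (fun t => f (u, β t)) t = deriv β t := fun u t => by
    simp only [hf]; rw [deriv_add_const]
  have g0 := hα.gaussIntegral_eq_sum_sign (hloop 0) (hdis 0) C
    (by simpa [hf] using hC) (by
      intro c hc
      rw [hder]
      simpa [hf] using hC' c hc)
  have g1 := hα.gaussIntegral_eq_sum_sign (hloop 1) (hdis 1) ∅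
    (by
      intro s hs t ht h _
      exfalso
      have h1 := (abs_le.1 (hR s hs 0)).2
      have h2 := (abs_le.1 (hR' t ht 0)).1
      simp [hf] at h
      linarith) (by simp)
  have hz : ∑ c ∈ C, (SignType.sign (planarDet (deriv α c.1) (deriv β c.2)) : ℤ) = 0 := by
    simp only [Finset.sum_empty, mul_zero] at g1
    rw [hinv, g1] at g0
    have g2 : ∑ c ∈ C, (SignType.sign ((α c.1 2 - f (0, β c.2) 2) *
        planarDet (deriv α c.1) (deriv (fun t => f (0, β t)) c.2)) : ℝ) = 0 := by linarith
    have g3 : ((∑ c ∈ C, (SignType.sign (planarDet (deriv α c.1) (deriv β c.2)) : ℤ) : ℤ) : ℝ)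
        = 0 := by
      push_cast
      rw [← g2]
      refine Finset.sum_congr rfl fun c hc => ?_
      obtain ⟨hI, -⟩ := hC' c hc
      have h2 := hlow c.1 ⟨hI.1.1.le, by linarith [hI.1.2]⟩ c.2 ⟨hI.2.1.le, by linarith [hI.2.2]⟩
      have h3 : α c.1 2 - f (0, β c.2) 2 = α c.1 2 - (β c.2 2 - M) := by simp [hf]; ring
      rw [h3, sign_mul, sign_pos h2, hder]
      simp
    exact_mod_cast g3
  rw [← sub_zero (∑ c ∈ C, _), ← hz, ← Finset.sum_sub_distrib]
  refine Finset.even_sum _ fun c hc => even_sign_mul_sub_sign ?_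
  obtain ⟨hI, e0, e1, -⟩ := hC' c hc
  intro h
  refine h0 c.1 ⟨hI.1.1.le, by linarith [hI.1.2]⟩ c.2 ⟨hI.2.1.le, by linarith [hI.2.2]⟩ ?_
  ext i; fin_cases i
  exacts [e0, e1, sub_eq_zero.1 h]

/-! ### Symmetries of the Gauss integral -/

theorem IsSmoothLoop.gaussIntegral_comm (hα : IsSmoothLoop α) (hβ : IsSmoothLoop β)
    (h0 : ∀ s ∈ Icc (0 : ℝ) 2, ∀ t ∈ Icc (0 : ℝ) 2, α s ≠ β t) :
    gaussIntegral α β = gaussIntegral β α := by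
  rw [hα.gaussIntegral_eq_setIntegral hβ h0,
    hβ.gaussIntegral_eq_setIntegral hα fun s hs t ht => (h0 t ht s hs).symm]
  congr 1
  rw [Measure.volume_eq_prod, ← setIntegral_prod_swap]
  refine setIntegral_congr_fun (measurableSet_Icc.prod measurableSet_Icc) fun p _ => ?_
  simp only [gaussKernel, Prod.fst_swap, Prod.snd_swap]
  rw [norm_sub_rev]
  congr 1
  simp only [tripleProd, PiLp.sub_apply]
  ring

theorem gaussIntegral_add_const (α β : ℝ → E3) (v : E3) :
    gaussIntegral (fun s => α s + v) (fun t => β t + v) = gaussIntegral α β := by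
  simp only [gaussIntegral_eq, deriv_add_const, add_sub_add_right_eq_sub]

end Pair

/-! ### Integrable weights for the self-linking integral -/

theorem integrableOn_abs_sub_rpow {r : ℝ} (hr : r < 1) (a b c : ℝ) :
    IntegrableOn (fun x : ℝ => |x - a| ^ (-r)) (Icc b c) := by
  have h0 : LocallyIntegrable (fun x : ℝ => |x| ^ (-r)) volume := by
    refine locallyIntegrable_of_norm_le_rpow (C := 1) (α := r) (by simp) (by simpa using hr) ?_ ?_
    · refine Eventually.of_forall fun x => ?_
      rw [Real.norm_of_nonneg (by positivity), Real.norm_eq_abs, one_mul]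
    · exact (by fun_prop : Measurable fun x : ℝ => |x| ^ (-r)).aestronglyMeasurable
  have h1 : IntegrableOn (fun x : ℝ => |x| ^ (-r)) (Icc (b - a) (c - a)) :=
    h0.integrableOn_isCompact isCompact_Icc
  have h2 := (measurePreserving_sub_right (volume : Measure ℝ) a).integrableOn_comp_preimage
    (MeasurableEquiv.subRight a).measurableEmbedding
    (f := fun x : ℝ => |x| ^ (-r)) (s := Icc (b - a) (c - a))
  have h3 := h2.2 h1
  simpa [Function.comp_def] using h3

/-- A weight on the square `[0,2]²` that dominates the symmetrised self-linking integrands. It is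
singular on the diagonal, where the curve is smooth, and, more strongly, at the points of the
diagonal that correspond to the two corners of a closed curve. -/
def selfWeight (p : ℝ × ℝ) : ℝ :=
  |p.1 - p.2| ^ (-(1 / 2) : ℝ) +
    (|p.1 - 1| ^ (-(3 / 4) : ℝ) * |p.2 - 1| ^ (-(3 / 4) : ℝ) +
    |p.1 - 0| ^ (-(3 / 4) : ℝ) * |p.2 - 2| ^ (-(3 / 4) : ℝ) +
    |p.1 - 2| ^ (-(3 / 4) : ℝ) * |p.2 - 0| ^ (-(3 / 4) : ℝ))

theorem integrableOn_selfWeight : IntegrableOn selfWeight (Icc 0 2 ×ˢ Icc 0 2) := by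
  have hp : ∀ a b : ℝ, IntegrableOn (fun p : ℝ × ℝ => |p.1 - a| ^ (-(3 / 4) : ℝ) *
      |p.2 - b| ^ (-(3 / 4) : ℝ)) (Icc 0 2 ×ˢ Icc 0 2) := by
    intro a b
    rw [IntegrableOn, Measure.volume_eq_prod, ← Measure.prod_restrict]
    exact (integrableOn_abs_sub_rpow (by norm_num) a 0 2).mul_prod
      (integrableOn_abs_sub_rpow (by norm_num) b 0 2)
  refine IntegrableOn.add ?_ (((hp 1 1).add (hp 0 2)).add (hp 2 0))
  have h1 : Integrable ((Icc (0 : ℝ) 2).indicator fun _ => (1 : ℝ)) :=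
    (integrable_indicator_iff measurableSet_Icc).2 (by simp)
  have h2 : Integrable ((Icc (-2 : ℝ) 2).indicator fun x => |x| ^ (-(1 / 2) : ℝ)) :=
    (integrable_indicator_iff measurableSet_Icc).2
      (by simpa using integrableOn_abs_sub_rpow (r := 1 / 2) (by norm_num) 0 (-2) 2)
  have h3 := (h1.convolution_integrand (ContinuousLinearMap.mul ℝ ℝ) h2).integrableOn
    (s := Icc (0 : ℝ) 2 ×ˢ Icc (0 : ℝ) 2)
  refine IntegrableOn.congr_fun h3 (fun p hp => ?_) (measurableSet_Icc.prod measurableSet_Icc)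
  have e1 : p.1 - p.2 ∈ Icc (-2 : ℝ) 2 := ⟨by linarith [hp.1.1, hp.2.2], by linarith [hp.1.2, hp.2.1]⟩
  simp [indicator_of_mem hp.2, indicator_of_mem e1]

/-- The distance on the circle `ℝ / 2ℤ`, for parameters in `[0,2]`. -/
def circDist (s t : ℝ) : ℝ := min |s - t| (2 - |s - t|)

theorem abs_inv_cube_sub_inv_cube_le {x y m : ℝ} (hm : 0 < m) (hx : 0 < x) (hy : 0 < y)
    (hx2 : m ≤ x ^ 2) (hy2 : m ≤ y ^ 2) {q : ℝ} (hq : 0 < q) (hx3 : q ≤ x ^ 3) (hy3 : q ≤ y ^ 3) :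
    |1 / x ^ 3 - 1 / y ^ 3| ≤ 2 * |x ^ 2 - y ^ 2| / (m * q) := by
  have e : 1 / x ^ 3 - 1 / y ^ 3 = -((x ^ 2 - y ^ 2) * ((x ^ 2 + x * y + y ^ 2) / (x + y)) /
      (x ^ 3 * y ^ 3)) := by field_simp; ring
  have h1 : (x ^ 2 + x * y + y ^ 2) / (x + y) ≤ x + y := by
    rw [div_le_iff₀ (by positivity)]; nlinarith [mul_pos hx hy]
  have h2 : (x + y) / (x ^ 3 * y ^ 3) = 1 / (x ^ 2 * y ^ 3) + 1 / (y ^ 2 * x ^ 3) := by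
    field_simp
  have h3 : 1 / (x ^ 2 * y ^ 3) ≤ 1 / (m * q) :=
    one_div_le_one_div_of_le (by positivity) (mul_le_mul hx2 hy3 hq.le (by positivity))
  have h4 : 1 / (y ^ 2 * x ^ 3) ≤ 1 / (m * q) :=
    one_div_le_one_div_of_le (by positivity) (mul_le_mul hy2 hx3 hq.le (by positivity))
  rw [e, abs_neg, abs_div, abs_mul, abs_of_pos (show 0 < x ^ 3 * y ^ 3 by positivity),
    abs_of_pos (show 0 < (x ^ 2 + x * y + y ^ 2) / (x + y) by positivity), mul_div_assoc]
  have h5 : (x ^ 2 + x * y + y ^ 2) / (x + y) / (x ^ 3 * y ^ 3) ≤ 2 / (m * q) := by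
    refine (div_le_div_of_nonneg_right h1 (by positivity)).trans ?_
    rw [h2]
    refine (add_le_add h3 h4).trans (le_of_eq ?_)
    ring
  calc _ ≤ |x ^ 2 - y ^ 2| * (2 / (m * q)) := mul_le_mul_of_nonneg_left h5 (abs_nonneg _)
    _ = _ := by ring

/-- The pointwise bound for the sum of the flattened integrands of the linking numbers of a curve
with its two parallels at heights `ε` and `-ε`. The leading terms near the diagonal cancel. -/
theorem abs_symm_flatKernel_le {l ε k Λ : ℝ} (hl : 0 < l) (hl1 : l ≤ 1) (hε : 0 < ε) (hk : 0 < k)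
    (hΛ : 0 < Λ) {h₀ h₁ ζ D P d e : ℝ} (hd : 0 < d) (he : 0 ≤ e)
    (hh : (k * d) ^ 2 ≤ h₀ ^ 2 + h₁ ^ 2) (hζ : |ζ| ≤ Λ * d) (hD : |D| ≤ Λ * d * e)
    (hP : |P| ≤ Λ * e) {κ : ℝ} (hκ : κ = min k (min (ε / 2) (k * (ε / (2 * Λ))))) :
    |l * (D - ε * P) / √(h₀ ^ 2 + h₁ ^ 2 + (l * (ζ - ε)) ^ 2) ^ 3 +
      l * (D + ε * P) / √(h₀ ^ 2 + h₁ ^ 2 + (l * (ζ + ε)) ^ 2) ^ 3| ≤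
      (2 * Λ / κ ^ 3 + 8 * Λ ^ 2 * ε ^ 2 / κ ^ 5) * (√l * (e / (d * √d))) := by
  have hκ0 : 0 < κ := by rw [hκ]; positivity
  have k1 : κ ≤ k := hκ ▸ min_le_left _ _
  have k2 : κ ≤ ε / 2 := hκ ▸ (min_le_right _ _).trans (min_le_left _ _)
  have k3 : κ ≤ k * (ε / (2 * Λ)) := hκ ▸ (min_le_right _ _).trans (min_le_right _ _)
  -- Both distances are at least `κ d`, because the projection is immersed, and at least `κ l`: for
  -- small `d` the heights differ by `ε / 2`, and for large `d` the planar distance suffices.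
  have low1 : ∀ w : ℝ, κ * d ≤ √(h₀ ^ 2 + h₁ ^ 2 + (l * w) ^ 2) := fun w => by
    refine Real.le_sqrt_of_sq_le ?_
    have : (κ * d) ^ 2 ≤ (k * d) ^ 2 := by gcongr
    nlinarith [sq_nonneg (l * w)]
  have low2 : ∀ w : ℝ, (d ≤ ε / (2 * Λ) → ε / 2 ≤ |w|) →
      κ * l ≤ √(h₀ ^ 2 + h₁ ^ 2 + (l * w) ^ 2) := fun w hw => by
    refine Real.le_sqrt_of_sq_le ?_
    rcases le_total d (ε / (2 * Λ)) with h | h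
    · have h1 : κ * l ≤ |l * w| := by
        rw [abs_mul, abs_of_pos hl, mul_comm]
        exact mul_le_mul_of_nonneg_left (k2.trans (hw h)) hl.le
      have h2 : (κ * l) ^ 2 ≤ (l * w) ^ 2 := by
        rw [← sq_abs (l * w)]; exact pow_le_pow_left₀ (by positivity) h1 2
      nlinarith [sq_nonneg h₀, sq_nonneg h₁]
    · have h1 : κ * l ≤ k * d :=
        (mul_le_of_le_one_right hκ0.le hl1).trans (k3.trans (mul_le_mul_of_nonneg_left h hk.le))
      have h2 : (κ * l) ^ 2 ≤ (k * d) ^ 2 := pow_le_pow_left₀ (by positivity) h1 2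
      nlinarith [sq_nonneg (l * w)]
  have hsmall : d ≤ ε / (2 * Λ) → |ζ| ≤ ε / 2 := fun h => by
    refine hζ.trans ?_
    rw [le_div_iff₀ (by positivity)] at h
    linarith
  have hx2 := low2 (ζ - ε) fun h => by
    have := abs_le.1 (hsmall h)
    rw [abs_sub_comm]
    exact le_abs.2 (Or.inl (by linarith))
  have hy2 := low2 (ζ + ε) fun h => by
    have := abs_le.1 (hsmall h)
    exact le_abs.2 (Or.inl (by linarith))
  have hx1 := low1 (ζ - ε)
  have hy1 := low1 (ζ + ε)
  have hxy : √(h₀ ^ 2 + h₁ ^ 2 + (l * (ζ - ε)) ^ 2) ^ 2 -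
      √(h₀ ^ 2 + h₁ ^ 2 + (l * (ζ + ε)) ^ 2) ^ 2 = -(4 * l ^ 2 * ζ * ε) := by
    rw [Real.sq_sqrt (by positivity), Real.sq_sqrt (by positivity)]; ring
  set x := √(h₀ ^ 2 + h₁ ^ 2 + (l * (ζ - ε)) ^ 2)
  set y := √(h₀ ^ 2 + h₁ ^ 2 + (l * (ζ + ε)) ^ 2)
  have hx : 0 < x := lt_of_lt_of_le (by positivity) hx1
  have hy : 0 < y := lt_of_lt_of_le (by positivity) hy1
  set q := κ ^ 3 * (d ^ 2 * √d * √l) with hq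
  have hq0 : 0 < q := by positivity
  -- The geometric mean of the two lower bounds, with weights `5/6` and `1/6`, makes the singularity
  -- in `d` integrable and leaves a positive power of `l`.
  have cube : ∀ v : ℝ, κ * d ≤ v → κ * l ≤ v → q ≤ v ^ 3 := by
    intro v h1 h2
    have hv : 0 ≤ v := le_trans (by positivity) h1
    have s1 := Real.sqrt_le_sqrt h1
    have s2 := Real.sqrt_le_sqrt h2
    rw [Real.sqrt_mul hκ0.le] at s1 s2
    calc q = (κ * d) ^ 2 * (√κ * √d * (√κ * √l)) := by
          rw [hq]
          have : √κ * √κ = κ := Real.mul_self_sqrt hκ0.le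
          linear_combination (-(κ ^ 2 * d ^ 2 * √d * √l)) * this
      _ ≤ v ^ 2 * (√v * √v) := by gcongr
      _ = v ^ 3 := by rw [Real.mul_self_sqrt hv]; ring
  have hx3 := cube x hx1 hx2
  have hy3 := cube y hy1 hy2
  have b1 : 1 / x ^ 3 ≤ 1 / q := one_div_le_one_div_of_le hq0 hx3
  have b2 : 1 / y ^ 3 ≤ 1 / q := one_div_le_one_div_of_le hq0 hy3
  have b3 := abs_inv_cube_sub_inv_cube_le (m := (κ * l) ^ 2) (by positivity) hx hy
    (pow_le_pow_left₀ (by positivity) hx2 2) (pow_le_pow_left₀ (by positivity) hy2 2) hq0 hx3 hy3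
  have b4 : |1 / x ^ 3 - 1 / y ^ 3| ≤ 8 * Λ * d * ε / (κ ^ 2 * q) := by
    refine b3.trans ?_
    rw [hxy, abs_neg, abs_mul, abs_mul, abs_of_pos hε,
      abs_of_pos (show 0 < 4 * l ^ 2 by positivity)]
    have : 2 * (4 * l ^ 2 * |ζ| * ε) / ((κ * l) ^ 2 * q) = 8 * |ζ| * ε / (κ ^ 2 * q) := by
      field_simp; ring
    rw [this]
    refine div_le_div_of_nonneg_right ?_ (by positivity)
    nlinarith [mul_le_mul_of_nonneg_right hζ hε.le]
  have split : l * (D - ε * P) / x ^ 3 + l * (D + ε * P) / y ^ 3 =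
      l * D * (1 / x ^ 3 + 1 / y ^ 3) - l * ε * P * (1 / x ^ 3 - 1 / y ^ 3) := by ring
  rw [split]
  refine (abs_sub _ _).trans ?_
  rw [abs_mul, abs_mul, abs_mul, abs_mul, abs_mul, abs_of_pos hl, abs_of_pos hε,
    abs_of_pos (show 0 < 1 / x ^ 3 + 1 / y ^ 3 by positivity)]
  have t1 : l * |D| * (1 / x ^ 3 + 1 / y ^ 3) ≤ l * (Λ * d * e) * (2 / q) := by
    refine mul_le_mul (mul_le_mul_of_nonneg_left hD hl.le) ?_ (by positivity) (by positivity)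
    refine (add_le_add b1 b2).trans (le_of_eq ?_); ring
  have t2 : l * ε * |P| * |1 / x ^ 3 - 1 / y ^ 3| ≤
      l * ε * (Λ * e) * (8 * Λ * d * ε / (κ ^ 2 * q)) :=
    mul_le_mul (mul_le_mul_of_nonneg_left hP (by positivity)) b4 (abs_nonneg _) (by positivity)
  refine (add_le_add t1 t2).trans (le_of_eq ?_)
  have hsl : √l ≠ 0 := (Real.sqrt_pos.2 hl).ne'
  have hsd : √d ≠ 0 := (Real.sqrt_pos.2 hd).ne'
  have hll : l = √l * √l := (Real.mul_self_sqrt hl.le).symm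
  rw [hq]
  have f1 : l * (Λ * d * e) * (2 / (κ ^ 3 * (d ^ 2 * √d * √l))) =
      2 * Λ / κ ^ 3 * (√l * (e / (d * √d))) := by
    rw [show l * (Λ * d * e) = √l * √l * (Λ * d * e) by rw [← hll]]
    field_simp
  have f2 : l * ε * (Λ * e) * (8 * Λ * d * ε / (κ ^ 2 * (κ ^ 3 * (d ^ 2 * √d * √l)))) =
      8 * Λ ^ 2 * ε ^ 2 / κ ^ 5 * (√l * (e / (d * √d))) := by
    rw [show l * ε * (Λ * e) = √l * √l * ε * (Λ * e) by rw [← hll]]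
    field_simp
  rw [f1, f2]
  ring

/-! ### Bounds for the self-linking integrand -/

theorem abs_tripleProd_le (a b c : E3) : |tripleProd a b c| ≤ 6 * (‖a‖ * ‖b‖ * ‖c‖) := by
  have h : ∀ (v : E3) i, |v i| ≤ ‖v‖ := fun v i => by
    simpa using PiLp.norm_apply_le v i
  have t : ∀ i j k, |a i * (b j * c k)| ≤ ‖a‖ * ‖b‖ * ‖c‖ := fun i j k => by
    rw [abs_mul, abs_mul, mul_assoc]
    gcongr <;> exact h _ _
  have e : tripleProd a b c = a 0 * (b 1 * c 2) - a 0 * (b 2 * c 1) - a 1 * (b 0 * c 2) +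
      a 1 * (b 2 * c 0) + a 2 * (b 0 * c 1) - a 2 * (b 1 * c 0) := by
    simp only [tripleProd]; ring
  rw [e]
  have h1 := abs_le.1 (t 0 1 2); have h2 := abs_le.1 (t 0 2 1); have h3 := abs_le.1 (t 1 0 2)
  have h4 := abs_le.1 (t 1 2 0); have h5 := abs_le.1 (t 2 0 1); have h6 := abs_le.1 (t 2 1 0)
  rw [abs_le]
  constructor <;> linarith [h1.1, h1.2, h2.1, h2.2, h3.1, h3.2, h4.1, h4.2, h5.1, h5.2, h6.1, h6.2]

theorem abs_planarDet_le (a b : E3) : |planarDet a b| ≤ 2 * (‖a‖ * ‖b‖) := by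
  have h : ∀ (v : E3) i, |v i| ≤ ‖v‖ := fun v i => by
    simpa using PiLp.norm_apply_le v i
  have t : ∀ i j, |a i * b j| ≤ ‖a‖ * ‖b‖ := fun i j => by
    rw [abs_mul]; gcongr <;> exact h _ _
  have h1 := abs_le.1 (t 0 1); have h2 := abs_le.1 (t 1 0)
  rw [planarDet, abs_le]
  constructor <;> linarith [h1.1, h1.2, h2.1, h2.2]

/-- A smooth piece and its velocity are Lipschitz, with a common constant. -/
theorem exists_piece_bounds {a b : ℝ} (hab : a < b) {α : ℝ → E3}
    (hα : ContDiffOn ℝ ∞ α (Icc a b)) : ∃ L : ℝ, ∀ s ∈ Icc a b, ∀ t ∈ Icc a b,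
      ‖α s - α t‖ ≤ L * |s - t| ∧ ‖derivWithin α (Icc a b) s‖ ≤ L ∧
      ‖derivWithin α (Icc a b) s - derivWithin α (Icc a b) t‖ ≤ L * |s - t| := by
  obtain ⟨K₁, h₁⟩ := hα.exists_lipschitzOnWith (by simp) (convex_Icc a b) isCompact_Icc
  have hd : ContDiffOn ℝ ∞ (derivWithin α (Icc a b)) (Icc a b) :=
    hα.derivWithin (uniqueDiffOn_Icc hab) (by simp)
  obtain ⟨K₂, h₂⟩ := hd.exists_lipschitzOnWith (by simp) (convex_Icc a b) isCompact_Icc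
  obtain ⟨K₃, h₃⟩ := isCompact_Icc.exists_bound_of_continuousOn hd.continuousOn
  refine ⟨max (max K₁ K₂) K₃, fun s hs t ht => ⟨?_, (h₃ s hs).trans (le_max_right _ _), ?_⟩⟩
  · have := h₁.dist_le_mul s hs t ht
    rw [dist_eq_norm, Real.dist_eq] at this
    refine this.trans (mul_le_mul_of_nonneg_right ?_ (abs_nonneg _))
    exact (le_max_left _ _).trans (le_max_left _ _)
  · have := h₂.dist_le_mul s hs t ht
    rw [dist_eq_norm, Real.dist_eq] at this
    refine this.trans (mul_le_mul_of_nonneg_right ?_ (abs_nonneg _))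
    exact (le_max_right _ _).trans (le_max_left _ _)

theorem circDist_comm (s t : ℝ) : circDist s t = circDist t s := by
  rw [circDist, circDist, abs_sub_comm]

theorem circDist_of_le_one {s t : ℝ} (h : |s - t| ≤ 1) : circDist s t = |s - t| :=
  min_eq_left (by linarith)

theorem circDist_of_le {s t : ℝ} (h : s ≤ t) : circDist s t = min (t - s) (2 - (t - s)) := by
  rw [circDist_comm, circDist, abs_of_nonneg (by linarith)]

theorem circDist_nonneg {s t : ℝ} (hs : s ∈ Icc (0 : ℝ) 2) (ht : t ∈ Icc (0 : ℝ) 2) :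
    0 ≤ circDist s t :=
  le_min (abs_nonneg _) (by
    have : |s - t| ≤ 2 := abs_le.2 ⟨by linarith [hs.1, ht.2], by linarith [hs.2, ht.1]⟩
    linarith)

theorem circDist_le_one (s t : ℝ) : circDist s t ≤ 1 := by
  rcases le_total |s - t| 1 with h | h
  · exact (min_le_left _ _).trans h
  · exact (min_le_right _ _).trans (by linarith)

theorem circDist_self (s : ℝ) : circDist s s = 0 := by simp [circDist]

theorem continuous_circDist : Continuous fun p : ℝ × ℝ => circDist p.1 p.2 := by
  unfold circDist; fun_prop

theorem circDist_eq_zero {s t : ℝ} (h : circDist s t = 0) : s = t ∨ |s - t| = 2 := by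
  rcases min_choice |s - t| (2 - |s - t|) with h' | h'
  · left; rw [circDist, h'] at h; exact sub_eq_zero.1 (abs_eq_zero.1 h)
  · right; rw [circDist, h'] at h; linarith

/-- Lipschitz bounds on the two pieces give a Lipschitz bound for the distance on the circle. -/
theorem IsSmoothLoop.exists_norm_sub_le {α : ℝ → E3} (hα : IsSmoothLoop α) {L : ℝ}
    (hL1 : ∀ s ∈ Icc (0 : ℝ) 1, ∀ t ∈ Icc (0 : ℝ) 1, ‖α s - α t‖ ≤ L * |s - t|)
    (hL2 : ∀ s ∈ Icc (1 : ℝ) 2, ∀ t ∈ Icc (1 : ℝ) 2, ‖α s - α t‖ ≤ L * |s - t|) :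
    ∀ s ∈ Icc (0 : ℝ) 2, ∀ t ∈ Icc (0 : ℝ) 2, ‖α s - α t‖ ≤ L * circDist s t := by
  have L0 : 0 ≤ L := by
    have := (norm_nonneg _).trans (hL1 0 (by simp) 1 (by simp))
    simpa using this
  have key : ∀ s ∈ Icc (0 : ℝ) 2, ∀ t ∈ Icc (0 : ℝ) 2, s ≤ t → ‖α s - α t‖ ≤ L * circDist s t := by
    intro s hs t ht hst
    rcases le_total t 1 with h | h
    · have e := hL1 s ⟨hs.1, hst.trans h⟩ t ⟨ht.1, h⟩
      rwa [circDist_of_le_one (abs_le.2 ⟨by linarith [hs.1], by linarith⟩)]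
    rcases le_total 1 s with h' | h'
    · have e := hL2 s ⟨h', hs.2⟩ t ⟨h, ht.2⟩
      rwa [circDist_of_le_one (abs_le.2 ⟨by linarith [ht.2], by linarith⟩)]
    · rw [circDist_of_le hst, mul_min_of_nonneg _ _ L0]
      have e1 := hL1 s ⟨hs.1, h'⟩ 1 (by simp)
      have e2 := hL2 1 (by norm_num) t ⟨h, ht.2⟩
      have e3 := hL1 s ⟨hs.1, h'⟩ 0 (by simp)
      have e4 := hL2 2 (by norm_num) t ⟨h, ht.2⟩
      rw [abs_of_nonpos (by linarith)] at e1 e2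
      rw [abs_of_nonneg (by linarith [hs.1])] at e3
      rw [abs_of_nonneg (by linarith [ht.2])] at e4
      refine le_min ?_ ?_
      · have := norm_sub_le_norm_sub_add_norm_sub (α s) (α 1) (α t)
        linarith
      · have := norm_sub_le_norm_sub_add_norm_sub (α s) (α 0) (α t)
        rw [← hα.closed] at this e3
        linarith
  intro s hs t ht
  rcases le_total s t with h | h
  · exact key s hs t ht h
  · rw [norm_sub_rev, circDist_comm]; exact key t ht s hs h

theorem one_div_mul_sqrt_le {x y : ℝ} (hx : 0 < x) (hy : 0 < y) :
    1 / ((x + y) * √(x + y)) ≤ x ^ (-(3 / 4) : ℝ) * y ^ (-(3 / 4) : ℝ) := by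
  have e1 : (x + y) * √(x + y) = (x + y) ^ (3 / 2 : ℝ) := by
    rw [Real.sqrt_eq_rpow, ← Real.rpow_one_add' (by positivity) (by norm_num)]
    norm_num
  have e2 : x ^ (-(3 / 4) : ℝ) * y ^ (-(3 / 4) : ℝ) = 1 / (√(x * y)) ^ (3 / 2 : ℝ) := by
    rw [← Real.mul_rpow hx.le hy.le, Real.rpow_neg (by positivity), Real.sqrt_eq_rpow,
      ← Real.rpow_mul (by positivity)]
    norm_num
  rw [e1, e2]
  refine one_div_le_one_div_of_le (by positivity)
    (Real.rpow_le_rpow (by positivity) ?_ (by norm_num))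
  rw [Real.sqrt_le_left (by positivity)]
  nlinarith [mul_pos hx hy, sq_nonneg x, sq_nonneg y]

/-- The stronger singularity across a corner is a product of integrable powers of the distances of the
two parameters from the corner. -/
theorem one_div_le_selfWeight {s t : ℝ} (hs : s ∈ Ioo (0 : ℝ) 1) (ht : t ∈ Ioo (1 : ℝ) 2) :
    1 / (circDist s t * √(circDist s t)) ≤ selfWeight (s, t) ∧
      1 / (circDist s t * √(circDist s t)) ≤ selfWeight (t, s) := by
  have p1 : 0 < 1 - s := by linarith [hs.2]
  have p2 : 0 < t - 1 := by linarith [ht.1]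
  have p3 : 0 < 2 - t := by linarith [ht.2]
  have a1 := one_div_mul_sqrt_le p1 p2
  have a2 := one_div_mul_sqrt_le hs.1 p3
  have g1 : |s - 1| = 1 - s := by rw [abs_sub_comm]; exact abs_of_pos p1
  have g2 : |t - 1| = t - 1 := abs_of_pos p2
  have g3 : |t - 2| = 2 - t := by rw [abs_sub_comm]; exact abs_of_pos p3
  have g4 : |s - 0| = s := by rw [sub_zero]; exact abs_of_pos hs.1
  have n1 : 0 ≤ |s - t| ^ (-(1 / 2) : ℝ) := by positivity
  have n1' : 0 ≤ |t - s| ^ (-(1 / 2) : ℝ) := by positivity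
  have n2 : 0 ≤ (1 - s) ^ (-(3 / 4) : ℝ) * (t - 1) ^ (-(3 / 4) : ℝ) := by positivity
  have n3 : 0 ≤ s ^ (-(3 / 4) : ℝ) * (2 - t) ^ (-(3 / 4) : ℝ) :=
    mul_nonneg (Real.rpow_nonneg hs.1.le _) (by positivity)
  have n4 : 0 ≤ |s - 2| ^ (-(3 / 4) : ℝ) * |t - 0| ^ (-(3 / 4) : ℝ) := by positivity
  have n4' : 0 ≤ |t - 0| ^ (-(3 / 4) : ℝ) * |s - 2| ^ (-(3 / 4) : ℝ) := by positivity
  have n2' := mul_comm ((1 - s) ^ (-(3 / 4) : ℝ)) ((t - 1) ^ (-(3 / 4) : ℝ))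
  have n3' := mul_comm (s ^ (-(3 / 4) : ℝ)) ((2 - t) ^ (-(3 / 4) : ℝ))
  simp only [selfWeight, g1, g2, g3, g4]
  have hst : s ≤ t := by linarith [hs.2, ht.1]
  rw [circDist_of_le hst]
  rcases min_choice (t - s) (2 - (t - s)) with h | h <;> rw [h]
  · rw [show 1 - s + (t - 1) = t - s by ring] at a1
    constructor <;> linarith
  · rw [show s + (2 - t) = 2 - (t - s) by ring] at a2
    constructor <;> linarith

theorem one_div_sqrt_le_selfWeight {s t : ℝ} (h : |s - t| ≤ 1) :
    circDist s t / (circDist s t * √(circDist s t)) ≤ selfWeight (s, t) := by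
  rw [circDist_of_le_one h]
  have e : |s - t| / (|s - t| * √|s - t|) ≤ |s - t| ^ (-(1 / 2) : ℝ) := by
    rcases (abs_nonneg (s - t)).eq_or_lt with h0 | h0
    · rw [← h0]; simp
    · rw [Real.rpow_neg h0.le, ← Real.sqrt_eq_rpow]
      refine le_of_eq ?_
      field_simp
  refine e.trans ?_
  simp only [selfWeight]
  exact le_add_of_nonneg_right (by positivity)

/-- The numerators of the self-linking integral vanish at the diagonal, to an order (with a
different meaning of `e` for points on the same smooth piece and on different ones) for which the
bound of `abs_symm_flatKernel_le` is integrable. -/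
theorem IsSmoothLoop.exists_self_bounds {α : ℝ → E3} (hα : IsSmoothLoop α) : ∃ Λ > 0,
    (∀ s ∈ Icc (0 : ℝ) 2, ∀ t ∈ Icc (0 : ℝ) 2, ‖α s - α t‖ ≤ Λ * circDist s t) ∧
    ∀ s ∈ Ioo (0 : ℝ) 1 ∪ Ioo (1 : ℝ) 2, ∀ t ∈ Ioo (0 : ℝ) 1 ∪ Ioo (1 : ℝ) 2, ∃ e ≥ 0,
      |numer α α (s, t)| ≤ Λ * circDist s t * e ∧ |planarDet (deriv α s) (deriv α t)| ≤ Λ * e ∧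
      e / (circDist s t * √(circDist s t)) ≤ selfWeight (s, t) := by
  obtain ⟨L₁, hL₁⟩ := exists_piece_bounds (by norm_num) hα.left
  obtain ⟨L₂, hL₂⟩ := exists_piece_bounds (by norm_num) hα.right
  set L := max 1 (max L₁ L₂) with hL
  have l0 : 1 ≤ L := le_max_left _ _
  have l1 : L₁ ≤ L := (le_max_left _ _).trans (le_max_right _ _)
  have l2 : L₂ ≤ L := (le_max_right _ _).trans (le_max_right _ _)
  have dist_le := hα.exists_norm_sub_le (L := L)
    (fun s hs t ht => (hL₁ s hs t ht).1.trans (mul_le_mul_of_nonneg_right l1 (abs_nonneg _)))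
    (fun s hs t ht => (hL₂ s hs t ht).1.trans (mul_le_mul_of_nonneg_right l2 (abs_nonneg _)))
  have hLL : L ≤ 6 * L ^ 3 := by
    nlinarith [sq_nonneg L, mul_pos (by linarith : 0 < L) (by linarith : 0 < L)]
  -- On the same smooth piece, `e` is the distance of the parameters: one of the velocities may be
  -- replaced by the difference of the two.
  have hsame : ∀ {s t : ℝ}, s ∈ Icc (0 : ℝ) 2 → t ∈ Icc (0 : ℝ) 2 → |s - t| ≤ 1 →
      ‖deriv α s‖ ≤ L → ‖deriv α s - deriv α t‖ ≤ L * |s - t| → ∃ e ≥ 0,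
      |numer α α (s, t)| ≤ 6 * L ^ 3 * circDist s t * e ∧
      |planarDet (deriv α s) (deriv α t)| ≤ 6 * L ^ 3 * e ∧
      e / (circDist s t * √(circDist s t)) ≤ selfWeight (s, t) := by
    intro s t hs ht hst h1 h2
    have hd := circDist_of_le_one hst
    have h3 := dist_le s hs t ht
    rw [norm_sub_rev] at h2
    refine ⟨circDist s t, circDist_nonneg hs ht, ?_, ?_, one_div_sqrt_le_selfWeight hst⟩
    · have e : numer α α (s, t) =
          tripleProd (α s - α t) (deriv α s) (deriv α t - deriv α s) := by
        simp only [numer, tripleProd, PiLp.sub_apply]; ring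
      rw [e]
      refine (abs_tripleProd_le _ _ _).trans ?_
      rw [hd] at h3 ⊢
      calc _ ≤ 6 * (L * |s - t| * L * (L * |s - t|)) := by gcongr
        _ = _ := by ring
    · have e : planarDet (deriv α s) (deriv α t) =
          planarDet (deriv α s) (deriv α t - deriv α s) := by
        simp only [planarDet, PiLp.sub_apply]; ring
      rw [e]
      refine (abs_planarDet_le _ _).trans ?_
      rw [hd]
      calc _ ≤ 2 * (L * (L * |s - t|)) := by gcongr
        _ ≤ 6 * L ^ 3 * |s - t| := by
          have : 2 * (L * L) ≤ 6 * L ^ 3 := by nlinarith [sq_nonneg L]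
          nlinarith [abs_nonneg (s - t)]
  -- On different pieces the velocities are unrelated, and `e = 1`.
  have hcross : ∀ {s t : ℝ}, s ∈ Icc (0 : ℝ) 2 → t ∈ Icc (0 : ℝ) 2 →
      ‖deriv α s‖ ≤ L → ‖deriv α t‖ ≤ L →
      1 / (circDist s t * √(circDist s t)) ≤ selfWeight (s, t) → ∃ e ≥ 0,
      |numer α α (s, t)| ≤ 6 * L ^ 3 * circDist s t * e ∧
      |planarDet (deriv α s) (deriv α t)| ≤ 6 * L ^ 3 * e ∧
      e / (circDist s t * √(circDist s t)) ≤ selfWeight (s, t) := by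
    intro s t hs ht h1 h2 hw
    have h3 := dist_le s hs t ht
    have h4 := circDist_nonneg hs ht
    refine ⟨1, zero_le_one, ?_, ?_, hw⟩
    · refine (abs_tripleProd_le _ _ _).trans ?_
      calc _ ≤ 6 * (L * circDist s t * L * L) := by gcongr
        _ = _ := by ring
    · refine (abs_planarDet_le _ _).trans ?_
      calc _ ≤ 2 * (L * L) := by gcongr
        _ ≤ 6 * L ^ 3 * 1 := by nlinarith [sq_nonneg L]
  refine ⟨6 * L ^ 3, by positivity, fun s hs t ht => (dist_le s hs t ht).trans
    (mul_le_mul_of_nonneg_right hLL (circDist_nonneg hs ht)), ?_⟩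
  have dw : ∀ {a b s : ℝ}, s ∈ Ioo a b → derivWithin α (Icc a b) s = deriv α s := fun hs =>
    derivWithin_of_mem_nhds (Icc_mem_nhds hs.1 hs.2)
  have i1 : ∀ {s : ℝ}, s ∈ Ioo (0 : ℝ) 1 → s ∈ Icc (0 : ℝ) 2 := fun hs =>
    ⟨hs.1.le, by linarith [hs.2]⟩
  have i2 : ∀ {s : ℝ}, s ∈ Ioo (1 : ℝ) 2 → s ∈ Icc (0 : ℝ) 2 := fun hs =>
    ⟨by linarith [hs.1], hs.2.le⟩
  have b1 : ∀ s ∈ Ioo (0 : ℝ) 1, ‖deriv α s‖ ≤ L := fun s hs => by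
    have := (hL₁ s (Ioo_subset_Icc_self hs) s (Ioo_subset_Icc_self hs)).2.1
    rw [dw hs] at this; exact this.trans l1
  have b2 : ∀ s ∈ Ioo (1 : ℝ) 2, ‖deriv α s‖ ≤ L := fun s hs => by
    have := (hL₂ s (Ioo_subset_Icc_self hs) s (Ioo_subset_Icc_self hs)).2.1
    rw [dw hs] at this; exact this.trans l2
  rintro s (hs | hs) t (ht | ht)
  · refine hsame (i1 hs) (i1 ht) (abs_le.2 ⟨by linarith [hs.1, ht.2], by linarith [hs.2, ht.1]⟩)
      (b1 s hs) ?_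
    have := (hL₁ s (Ioo_subset_Icc_self hs) t (Ioo_subset_Icc_self ht)).2.2
    rw [dw hs, dw ht] at this
    exact this.trans (mul_le_mul_of_nonneg_right l1 (abs_nonneg _))
  · exact hcross (i1 hs) (i2 ht) (b1 s hs) (b2 t ht) (one_div_le_selfWeight hs ht).1
  · refine hcross (i2 hs) (i1 ht) (b2 s hs) (b1 t ht) ?_
    rw [circDist_comm]
    exact (one_div_le_selfWeight ht hs).2
  · refine hsame (i2 hs) (i2 ht) (abs_le.2 ⟨by linarith [hs.1, ht.2], by linarith [hs.2, ht.1]⟩)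
      (b2 s hs) ?_
    have := (hL₂ s (Ioo_subset_Icc_self hs) t (Ioo_subset_Icc_self ht)).2.2
    rw [dw hs, dw ht] at this
    exact this.trans (mul_le_mul_of_nonneg_right l2 (abs_nonneg _))

/-! ### Self-linking and the writhe -/

section Parallel

variable {α : ℝ → E3}

theorem ez_apply_zero : ez 0 = 0 := by simp [ez]
theorem ez_apply_one : ez 1 = 0 := by simp [ez]
theorem ez_apply_two : ez 2 = 1 := by simp [ez]

theorem flatKernel_parallel (α : ℝ → E3) (ε l : ℝ) (p : ℝ × ℝ) :
    flatKernel (numer α fun t => α t + ε • ez) (diffCoord α (fun t => α t + ε • ez) 0)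
      (diffCoord α (fun t => α t + ε • ez) 1) (diffCoord α (fun t => α t + ε • ez) 2) l p =
    l * (numer α α p - ε * planarDet (deriv α p.1) (deriv α p.2)) /
      √(diffCoord α α 0 p ^ 2 + diffCoord α α 1 p ^ 2 +
        (l * (diffCoord α α 2 p - ε)) ^ 2) ^ 3 := by
  have h0 : diffCoord α (fun t => α t + ε • ez) 0 p = diffCoord α α 0 p := by
    simp [diffCoord, ez]
  have h1 : diffCoord α (fun t => α t + ε • ez) 1 p = diffCoord α α 1 p := by
    simp [diffCoord, ez]
  have h2 : diffCoord α (fun t => α t + ε • ez) 2 p = diffCoord α α 2 p - ε := by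
    simp [diffCoord, ez]; ring
  have h3 : numer α (fun t => α t + ε • ez) p =
      numer α α p - ε * planarDet (deriv α p.1) (deriv α p.2) := by
    simp only [numer, planarDet, tripleProd, deriv_add_const, PiLp.sub_apply, PiLp.add_apply,
      PiLp.smul_apply, ez_apply_zero, ez_apply_one, ez_apply_two, smul_eq_mul]
    ring
  rw [flatKernel, h0, h1, h2, h3]

/-- Almost all pairs of parameters avoid the corners. -/
theorem ae_mem_pieces : ∀ᵐ p : ℝ × ℝ, p ∈ Icc (0 : ℝ) 2 ×ˢ Icc (0 : ℝ) 2 →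
    p.1 ∈ Ioo (0 : ℝ) 1 ∪ Ioo (1 : ℝ) 2 ∧ p.2 ∈ Ioo (0 : ℝ) 1 ∪ Ioo (1 : ℝ) 2 := by
  have h : ∀ᵐ s : ℝ, s ∈ Icc (0 : ℝ) 2 → s ∈ Ioo (0 : ℝ) 1 ∪ Ioo (1 : ℝ) 2 := by
    have hn : ∀ᵐ s : ℝ, s ∉ ({0, 1, 2} : Set ℝ) :=
      compl_mem_ae_iff.2 ((Set.toFinite _).measure_zero volume)
    filter_upwards [hn] with s hs hs'
    simp only [mem_insert_iff, mem_singleton_iff, not_or] at hs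
    have h0 := lt_of_le_of_ne hs'.1 (Ne.symm hs.1)
    have h2 := lt_of_le_of_ne hs'.2 hs.2.2
    rcases lt_or_gt_of_ne hs.2.1 with h1 | h1
    · exact Or.inl ⟨h0, h1⟩
    · exact Or.inr ⟨h1, h2⟩
  have h1 := Measure.quasiMeasurePreserving_fst (μ := (volume : Measure ℝ))
    (ν := (volume : Measure ℝ)).ae h
  have h2 := Measure.quasiMeasurePreserving_snd (μ := (volume : Measure ℝ))
    (ν := (volume : Measure ℝ)).ae h
  filter_upwards [h1, h2] with p k1 k2 hp using ⟨k1 hp.1, k2 hp.2⟩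

/-- The closed curve `α` projects to the plane as an immersed curve with the finite set `C` of
(ordered) transverse double points, away from the corners; `α` is embedded over the double points.
The condition `immersed` says that the projection is uniformly injective near the diagonal. -/
structure HasPlanarDoublePoints (α : ℝ → E3) (C : Finset (ℝ × ℝ)) : Prop where
  immersed : ∃ k > 0, ∃ r > 0, ∀ s ∈ Icc (0 : ℝ) 2, ∀ t ∈ Icc (0 : ℝ) 2, circDist s t ≤ r →
    (k * circDist s t) ^ 2 ≤ diffCoord α α 0 (s, t) ^ 2 + diffCoord α α 1 (s, t) ^ 2
  mem_of_eq : ∀ s ∈ Icc (0 : ℝ) 2, ∀ t ∈ Icc (0 : ℝ) 2, α s 0 = α t 0 → α s 1 = α t 1 →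
    (s, t) ∈ C ∨ circDist s t = 0
  mem_Ioo : ∀ c ∈ C, c ∈ Ioo (0 : ℝ) 1 ×ˢ Ioo (0 : ℝ) 1
  eq_zero : ∀ c ∈ C, α c.1 0 = α c.2 0
  eq_one : ∀ c ∈ C, α c.1 1 = α c.2 1
  ne_two : ∀ c ∈ C, α c.1 2 ≠ α c.2 2
  transverse : ∀ c ∈ C, planarDet (deriv α c.1) (deriv α c.2) ≠ 0

theorem sign_sub_add_sign_add {x ε : ℝ} (P : ℝ) (hε : 0 < ε) (hx : ε < |x|) :
    (SignType.sign ((x - ε) * P) : ℝ) + (SignType.sign ((x + ε) * P) : ℝ) =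
      2 * (SignType.sign (x * P) : ℝ) := by
  simp only [sign_mul, SignType.coe_mul]
  rcases lt_abs.1 hx with h | h
  · rw [sign_pos (show 0 < x - ε by linarith), sign_pos (show 0 < x + ε by linarith),
      sign_pos (show 0 < x by linarith)]
    ring
  · rw [sign_neg (show x - ε < 0 by linarith), sign_neg (show x + ε < 0 by linarith),
      sign_neg (show x < 0 by linarith)]
    ring

/-- The two vertical parallels at small heights `ε` and `-ε` are disjoint from the curve. -/
theorem HasPlanarDoublePoints.ne_parallel {C : Finset (ℝ × ℝ)} (hα : IsSmoothLoop α)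
    (h : HasPlanarDoublePoints α C) {ε : ℝ} (hε : ε ≠ 0)
    (hεC : ∀ c ∈ C, |ε| < |α c.1 2 - α c.2 2|) :
    ∀ s ∈ Icc (0 : ℝ) 2, ∀ t ∈ Icc (0 : ℝ) 2, α s ≠ α t + ε • ez := by
  intro s hs t ht heq
  have e0 : α s 0 = α t 0 := by rw [heq]; simp [ez]
  have e1 : α s 1 = α t 1 := by rw [heq]; simp [ez]
  have e2 : α s 2 - α t 2 = ε := by rw [heq]; simp [ez]
  rcases h.mem_of_eq s hs t ht e0 e1 with hc | hd
  · have := hεC _ hc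
    simp only [e2] at this
    exact lt_irrefl _ this
  · obtain ⟨Λ, -, hΛ, -⟩ := hα.exists_self_bounds
    have h0 := hΛ s hs t ht
    rw [hd, mul_zero] at h0
    have h1 : α s = α t := sub_eq_zero.1 (norm_le_zero_iff.1 h0)
    rw [h1, sub_self] at e2
    exact hε e2.symm

/-- Away from the double points the planar distance is bounded below by a multiple of the distance of
the parameters: near the diagonal by immersion, elsewhere by compactness. -/
theorem HasPlanarDoublePoints.exists_lower_bound {C : Finset (ℝ × ℝ)} (hα : IsSmoothLoop α)
    (h : HasPlanarDoublePoints α C) {δ : ℝ} (hδ : 0 < δ) :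
    ∃ k > 0, ∀ p ∈ (Icc (0 : ℝ) 2 ×ˢ Icc (0 : ℝ) 2) \ ⋃ c ∈ C, Metric.ball c δ,
      (k * circDist p.1 p.2) ^ 2 ≤ diffCoord α α 0 p ^ 2 + diffCoord α α 1 p ^ 2 := by
  set K := (Icc (0 : ℝ) 2 ×ˢ Icc (0 : ℝ) 2) \ ⋃ c ∈ C, Metric.ball c δ with hK
  have hKs : K ⊆ Icc (0 : ℝ) 2 ×ˢ Icc (0 : ℝ) 2 := sdiff_subset
  have hKc : IsCompact K := (isCompact_Icc.prod isCompact_Icc).diff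
    (isOpen_biUnion fun c _ => Metric.isOpen_ball)
  obtain ⟨k, hk, r, hr, hkr⟩ := h.immersed
  have hKr : IsCompact (K ∩ {p | r ≤ circDist p.1 p.2}) :=
    hKc.inter_right (isClosed_le continuous_const continuous_circDist)
  obtain ⟨m, hm, hmK⟩ : ∃ m > 0, ∀ p ∈ K ∩ {p | r ≤ circDist p.1 p.2},
      m ≤ diffCoord α α 0 p ^ 2 + diffCoord α α 1 p ^ 2 := by
    refine hKr.exists_forall_le' (a := 0) ?_ ?_
    · exact (((hα.continuousOn_diffCoord hα 0).pow 2).add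
        ((hα.continuousOn_diffCoord hα 1).pow 2)).mono (inter_subset_left.trans hKs)
    · rintro p ⟨hp, hpr⟩
      by_contra hcon
      have h1 : diffCoord α α 0 p = 0 := by
        nlinarith [sq_nonneg (diffCoord α α 0 p), sq_nonneg (diffCoord α α 1 p)]
      have h2 : diffCoord α α 1 p = 0 := by
        nlinarith [sq_nonneg (diffCoord α α 0 p), sq_nonneg (diffCoord α α 1 p)]
      rcases h.mem_of_eq p.1 (hKs hp).1 p.2 (hKs hp).2 (sub_eq_zero.1 h1) (sub_eq_zero.1 h2)
        with hc | hc
      · exact hp.2 (mem_biUnion hc (Metric.mem_ball_self hδ))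
      · simp only [mem_ofPred_eq, hc] at hpr
        linarith
  refine ⟨min k √m, by positivity, fun p hp => ?_⟩
  have hd := circDist_nonneg (hKs hp).1 (hKs hp).2
  rcases le_total (circDist p.1 p.2) r with hle | hle
  · refine le_trans ?_ (hkr p.1 (hKs hp).1 p.2 (hKs hp).2 hle)
    exact pow_le_pow_left₀ (by positivity) (mul_le_mul_of_nonneg_right (min_le_left _ _) hd) 2
  · refine le_trans ?_ (hmK p ⟨hp, hle⟩)
    have h1 : min k √m * circDist p.1 p.2 ≤ √m * 1 :=
      mul_le_mul (min_le_right _ _) (circDist_le_one _ _) hd (Real.sqrt_nonneg _)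
    calc _ ≤ (√m * 1) ^ 2 := pow_le_pow_left₀ (by positivity) h1 2
      _ = m := by rw [mul_one, Real.sq_sqrt hm.le]

/-- Away from the crossings, the sum of the flattened integrands for the two parallels at heights
`ε` and `-ε` contributes nothing in the limit. -/
theorem HasPlanarDoublePoints.tendsto_rest {C : Finset (ℝ × ℝ)} (hα : IsSmoothLoop α)
    (h : HasPlanarDoublePoints α C) {ε : ℝ} (hε : 0 < ε) {δ : ℝ} (hδ : 0 < δ) :
    Tendsto (fun l => ∫ p in (Icc (0 : ℝ) 2 ×ˢ Icc (0 : ℝ) 2) \ ⋃ c ∈ C, Metric.ball c δ,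
      (l * (numer α α p - ε * planarDet (deriv α p.1) (deriv α p.2)) /
        √(diffCoord α α 0 p ^ 2 + diffCoord α α 1 p ^ 2 +
          (l * (diffCoord α α 2 p - ε)) ^ 2) ^ 3 +
      l * (numer α α p + ε * planarDet (deriv α p.1) (deriv α p.2)) /
        √(diffCoord α α 0 p ^ 2 + diffCoord α α 1 p ^ 2 +
          (l * (diffCoord α α 2 p + ε)) ^ 2) ^ 3)) (𝓝[>] 0) (𝓝 0) := by
  obtain ⟨Λ, hΛ, hΛ1, hΛ2⟩ := hα.exists_self_bounds
  obtain ⟨k, hk, hkK⟩ := h.exists_lower_bound hα hδ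
  set K := (Icc (0 : ℝ) 2 ×ˢ Icc (0 : ℝ) 2) \ ⋃ c ∈ C, Metric.ball c δ with hK
  have hKs : K ⊆ Icc (0 : ℝ) 2 ×ˢ Icc (0 : ℝ) 2 := sdiff_subset
  have hKm : MeasurableSet K := (measurableSet_Icc.prod measurableSet_Icc).diff
    (Finset.measurableSet_biUnion _ fun c _ => Metric.isOpen_ball.measurableSet)
  have hW := integrableOn_selfWeight.mono_set hKs
  set κ := min k (min (ε / 2) (k * (ε / (2 * Λ)))) with hκ
  set B := 2 * Λ / κ ^ 3 + 8 * Λ ^ 2 * ε ^ 2 / κ ^ 5 with hB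
  have hκ0 : 0 < κ := by positivity
  have hB0 : 0 ≤ B := by positivity
  refine squeeze_zero_norm' (a := fun l => √l * (B * ∫ p in K, selfWeight p)) ?_ ?_
  · filter_upwards [Ioo_mem_nhdsGT zero_lt_one] with l hl
    rw [← integral_const_mul, ← integral_const_mul]
    refine norm_integral_le_of_norm_le ((hW.const_mul B).const_mul √l) ?_
    rw [ae_restrict_iff' hKm]
    filter_upwards [ae_mem_pieces] with p hp hpK
    obtain ⟨hp1, hp2⟩ := hp (hKs hpK)
    obtain ⟨e, he, hD, hP, hw⟩ := hΛ2 p.1 hp1 p.2 hp2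
    have hd := circDist_nonneg (hKs hpK).1 (hKs hpK).2
    have hζ0 := hΛ1 p.1 (hKs hpK).1 p.2 (hKs hpK).2
    have hζ : |diffCoord α α 2 p| ≤ Λ * circDist p.1 p.2 := by
      refine le_trans ?_ hζ0
      have := PiLp.norm_apply_le (α p.1 - α p.2) 2
      simpa [diffCoord] using this
    have hw0 : 0 ≤ selfWeight p := by unfold selfWeight; positivity
    have htarget : 0 ≤ √l * (B * selfWeight p) := by positivity
    rcases hd.eq_or_lt with h0 | h0
    · -- On the diagonal both numerators vanish.
      have e1 : numer α α p = 0 := by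
        rw [← h0, mul_zero] at hζ0
        have : α p.1 - α p.2 = 0 := norm_le_zero_iff.1 hζ0
        simp [numer, this, tripleProd]
      have e2 : planarDet (deriv α p.1) (deriv α p.2) = 0 := by
        rcases circDist_eq_zero h0.symm with h | h
        · rw [h]; simp only [planarDet]; ring
        · exfalso
          rcases hp1 with h1 | h1 <;> rcases hp2 with h2 | h2 <;>
          · rcases abs_eq (by norm_num : (0 : ℝ) ≤ 2) |>.1 h with h3 | h3 <;>
            linarith [h1.1, h1.2, h2.1, h2.2]
      rw [e1, e2]
      simpa using htarget
    · rw [Real.norm_eq_abs]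
      refine (abs_symm_flatKernel_le hl.1 hl.2.le hε hk hΛ h0 he (hkK p hpK) hζ hD hP hκ).trans ?_
      calc B * (√l * (e / (circDist p.1 p.2 * √(circDist p.1 p.2))))
          ≤ B * (√l * selfWeight p) := by gcongr
        _ = _ := by ring
  · have : Tendsto (fun l : ℝ => √l * (B * ∫ p in K, selfWeight p)) (𝓝 0)
      (𝓝 (√0 * (B * ∫ p in K, selfWeight p))) := Continuous.tendsto (by fun_prop) 0
    rw [Real.sqrt_zero, zero_mul] at this
    exact this.mono_left nhdsWithin_le_nhds

/-- The linking number of a curve with its vertical parallel is the writhe of its projection. The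
parallels above and below the curve have the same linking number with it, and the singular parts,
near the diagonal, of the two Gauss integrals cancel. -/
theorem HasPlanarDoublePoints.gaussIntegral_parallel {C : Finset (ℝ × ℝ)} (hα : IsSmoothLoop α)
    (h : HasPlanarDoublePoints α C) {ε : ℝ} (hε : 0 < ε)
    (hεC : ∀ c ∈ C, ε < |α c.1 2 - α c.2 2|) :
    gaussIntegral α (fun t => α t + ε • ez) = 1 / 2 * ∑ c ∈ C,
      (SignType.sign ((α c.1 2 - α c.2 2) * planarDet (deriv α c.1) (deriv α c.2)) : ℝ) := by
  have hup := h.ne_parallel hα hε.ne' (by rwa [abs_of_pos hε])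
  have hdn := h.ne_parallel hα (neg_ne_zero.2 hε.ne') (by rwa [abs_neg, abs_of_pos hε])
  have lup := hα.add_const (ε • ez)
  have ldn := hα.add_const (-ε • ez)
  have hsub : Ioo (0 : ℝ) 1 ×ˢ Ioo (0 : ℝ) 1 ⊆ Icc (0 : ℝ) 2 ×ˢ Icc (0 : ℝ) 2 := fun p hp =>
    ⟨⟨hp.1.1.le, by linarith [hp.1.2]⟩, ⟨hp.2.1.le, by linarith [hp.2.2]⟩⟩
  have hsymm : gaussIntegral α (fun t => α t + -ε • ez) =
      gaussIntegral α (fun t => α t + ε • ez) := by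
    rw [← gaussIntegral_add_const α (fun t => α t + -ε • ez) (ε • ez)]
    simp only [neg_smul, neg_add_cancel_right]
    exact lup.gaussIntegral_comm hα fun s hs t ht => (hup t ht s hs).symm
  set fup := fun l => flatKernel (numer α fun t => α t + ε • ez)
    (diffCoord α (fun t => α t + ε • ez) 0) (diffCoord α (fun t => α t + ε • ez) 1)
    (diffCoord α (fun t => α t + ε • ez) 2) l with hfup
  set fdn := fun l => flatKernel (numer α fun t => α t + -ε • ez)
    (diffCoord α (fun t => α t + -ε • ez) 0) (diffCoord α (fun t => α t + -ε • ez) 1)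
    (diffCoord α (fun t => α t + -ε • ez) 2) l with hfdn
  have iup : ∀ l > 0, IntegrableOn (fup l) (Icc 0 2 ×ˢ Icc 0 2) := fun l hl =>
    hα.integrableOn_flatKernel lup hup hl
  have idn : ∀ l > 0, IntegrableOn (fdn l) (Icc 0 2 ×ˢ Icc 0 2) := fun l hl =>
    hα.integrableOn_flatKernel ldn hdn hl
  have lim := tendsto_setIntegral_of_concentrates (S := Icc (0 : ℝ) 2 ×ˢ Icc (0 : ℝ) 2)
    (g := fun l p => fup l p + fdn l p) C
    (fun c => 4 * Real.pi * (SignType.sign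
      ((α c.1 2 - α c.2 2) * planarDet (deriv α c.1) (deriv α c.2)) : ℝ))
    (fun l hl => (iup l hl).add (idn l hl))
    (by
      intro c hc
      have hz : ∀ η : ℝ, |η| = ε → α c.1 2 ≠ (α c.2 + η • ez) 2 := by
        intro η hη heq
        have := hεC c hc
        rw [heq] at this
        simp [ez, hη] at this
      have kup := hα.tendsto_flatKernel_crossing lup (h.mem_Ioo c hc)
        (by simp [ez, h.eq_zero c hc]) (by simp [ez, h.eq_one c hc]) (hz ε (abs_of_pos hε))
        (by rw [deriv_add_const]; exact h.transverse c hc)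
      have kdn := hα.tendsto_flatKernel_crossing ldn (h.mem_Ioo c hc)
        (by simp [ez, h.eq_zero c hc]) (by simp [ez, h.eq_one c hc])
        (hz (-ε) (by rw [abs_neg, abs_of_pos hε]))
        (by rw [deriv_add_const]; exact h.transverse c hc)
      have hb : ∀ᶠ δ in 𝓝[>] (0 : ℝ), Metric.ball c δ ⊆ Icc 0 2 ×ˢ Icc 0 2 := by
        obtain ⟨r, hr, hrS⟩ := Metric.mem_nhds_iff.1
          ((isOpen_Ioo.prod isOpen_Ioo).mem_nhds (h.mem_Ioo c hc))
        filter_upwards [Ioo_mem_nhdsGT hr] with δ hδ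
        exact (Metric.ball_subset_ball hδ.2.le).trans (hrS.trans hsub)
      filter_upwards [kup, kdn, hb] with δ t1 t2 hb
      refine ((t1.add t2).congr' ?_).trans (le_of_eq ?_)
      · filter_upwards [self_mem_nhdsWithin] with l hl
        exact (integral_add ((iup l hl).mono_set hb) ((idn l hl).mono_set hb)).symm
      · congr 1
        rw [deriv_add_const, deriv_add_const]
        have := sign_sub_add_sign_add (planarDet (deriv α c.1) (deriv α c.2)) hε (hεC c hc)
        have a1 : α c.1 2 - (α c.2 + ε • ez) 2 = α c.1 2 - α c.2 2 - ε := by simp [ez]; ring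
        have a2 : α c.1 2 - (α c.2 + -ε • ez) 2 = α c.1 2 - α c.2 2 + ε := by simp [ez]; ring
        rw [a1, a2]
        linear_combination 2 * Real.pi * this)
    (fun c hc => mem_of_superset ((isOpen_Ioo.prod isOpen_Ioo).mem_nhds (h.mem_Ioo c hc)) hsub)
    (by
      intro δ hδ
      refine (h.tendsto_rest hα hε hδ).congr fun l => ?_
      refine integral_congr_ae (Eventually.of_forall fun p => ?_)
      simp only [hfup, hfdn, flatKernel_parallel, neg_mul, sub_neg_eq_add])
  have hconst := (lim.const_mul (1 / (4 * Real.pi))).congr'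
    (f₂ := fun _ => gaussIntegral α (fun t => α t + ε • ez) +
      gaussIntegral α (fun t => α t + -ε • ez)) (by
    filter_upwards [self_mem_nhdsWithin] with l hl
    rw [integral_add (iup l hl) (idn l hl), mul_add,
      hα.gaussIntegral_eq_flatKernel lup hup hl, hα.gaussIntegral_eq_flatKernel ldn hdn hl])
  have := tendsto_nhds_unique tendsto_const_nhds hconst
  rw [hsymm, ← Finset.mul_sum, ← mul_assoc] at this
  have h4 : 1 / (4 * Real.pi) * (4 * Real.pi) = 1 := by field_simp
  rw [h4] at this
  linarith

end Parallel

namespace FramedStringLink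

/-! ### Closing arcs -/

variable {μ : ℕ}

theorem endX_pos (i : Fin μ) : 0 < endX μ i := by unfold endX; positivity

theorem endX_injective {i j : Fin μ} (h : endX μ i = endX μ j) : i = j := by
  have hμ : (μ : ℝ) + 1 ≠ 0 := by positivity
  rw [endX, endX, div_left_inj' hμ, add_left_inj] at h
  exact Fin.ext (by exact_mod_cast h)

/-- The radius of a closing arc. -/
def arcRadius (μ : ℕ) (i : Fin μ) : ℝ := √((endX μ i) ^ 2 + (1 / 2) ^ 2)

/-- The polar angle at which a closing arc starts. -/
def arcStart (μ : ℕ) (i : Fin μ) : ℝ := Real.arctan ((1 / 2) / endX μ i)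

/-- The polar angle of a point of a closing arc. -/
def arcAngle (μ : ℕ) (i : Fin μ) (u : ℝ) : ℝ :=
  arcStart μ i + u * (2 * Real.pi - 2 * arcStart μ i)

theorem closingArc_eq (i : Fin μ) (u : ℝ) : closingArc μ i u =
    !₂[arcRadius μ i * Real.cos (arcAngle μ i u),
      1 / 2 + arcRadius μ i * Real.sin (arcAngle μ i u), 1 / 2] := rfl

theorem arcRadius_pos (i : Fin μ) : 0 < arcRadius μ i := Real.sqrt_pos.2 (by positivity)

theorem arcStart_pos (i : Fin μ) : 0 < arcStart μ i :=
  Real.arctan_pos.2 (div_pos (by norm_num) (endX_pos i))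

theorem arcStart_lt (i : Fin μ) : arcStart μ i < Real.pi / 2 := Real.arctan_lt_pi_div_two _

theorem sqrt_one_add_slope (i : Fin μ) :
    √(1 + (1 / 2 / endX μ i) ^ 2) = arcRadius μ i / endX μ i := by
  have he := endX_pos i
  rw [arcRadius, ← Real.sqrt_sq he.le, ← Real.sqrt_div' _ (by positivity), Real.sqrt_sq he.le]
  congr 1
  field_simp

theorem arcRadius_mul_cos (i : Fin μ) : arcRadius μ i * Real.cos (arcStart μ i) = endX μ i := by
  have he := endX_pos i
  have hr := arcRadius_pos i
  rw [arcStart, Real.cos_arctan, sqrt_one_add_slope]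
  field_simp

theorem arcRadius_mul_sin (i : Fin μ) : arcRadius μ i * Real.sin (arcStart μ i) = 1 / 2 := by
  have he := endX_pos i
  have hr := arcRadius_pos i
  rw [arcStart, Real.sin_arctan, sqrt_one_add_slope]
  field_simp

theorem arcAngle_zero (i : Fin μ) : arcAngle μ i 0 = arcStart μ i := by simp [arcAngle]

theorem arcAngle_one (i : Fin μ) : arcAngle μ i 1 = 2 * Real.pi - arcStart μ i := by
  simp [arcAngle]; ring

theorem closingArc_zero (i : Fin μ) : closingArc μ i 0 = !₂[endX μ i, 1, 1 / 2] := by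
  rw [closingArc_eq, arcAngle_zero, arcRadius_mul_cos, arcRadius_mul_sin]
  norm_num

theorem closingArc_one (i : Fin μ) : closingArc μ i 1 = !₂[endX μ i, 0, 1 / 2] := by
  rw [closingArc_eq, arcAngle_one, Real.cos_two_pi_sub, Real.sin_two_pi_sub, mul_neg,
    arcRadius_mul_cos, arcRadius_mul_sin]
  norm_num

theorem arcAngle_slope_pos (i : Fin μ) : 0 < 2 * Real.pi - 2 * arcStart μ i := by
  linarith [arcStart_lt i, Real.pi_pos]

theorem arcAngle_mem_Icc (i : Fin μ) {u : ℝ} (hu : u ∈ Icc (0 : ℝ) 1) :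
    arcAngle μ i u ∈ Icc (arcStart μ i) (2 * Real.pi - arcStart μ i) := by
  have h := arcAngle_slope_pos i
  constructor <;> rw [arcAngle] <;> nlinarith [hu.1, hu.2]

theorem arcAngle_mem_Ioo (i : Fin μ) {u : ℝ} (hu : u ∈ Ioo (0 : ℝ) 1) :
    arcAngle μ i u ∈ Ioo (arcStart μ i) (2 * Real.pi - arcStart μ i) := by
  have h := arcAngle_slope_pos i
  constructor <;> rw [arcAngle] <;> nlinarith [hu.1, hu.2]

/-- The interior of a closing arc projects to the outside of the unit square. -/
theorem closingArc_outside (i : Fin μ) {u : ℝ} (hu : u ∈ Ioo (0 : ℝ) 1)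
    (hx : 0 ≤ closingArc μ i u 0) : closingArc μ i u 1 < 0 ∨ 1 < closingArc μ i u 1 := by
  have ha := arcAngle_mem_Ioo i hu
  have hr := arcRadius_pos i
  have h0 := arcStart_pos i
  set φ := arcAngle μ i u with hφ
  have hcos : Real.cos φ < Real.cos (arcStart μ i) := by
    have h1 : Real.cos φ = -Real.cos |φ - Real.pi| := by
      rw [Real.cos_abs, Real.cos_sub_pi, neg_neg]
    have h2 : Real.cos (arcStart μ i) = -Real.cos (Real.pi - arcStart μ i) := by
      rw [Real.cos_pi_sub, neg_neg]
    rw [h1, h2, neg_lt_neg_iff]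
    refine Real.cos_lt_cos_of_nonneg_of_le_pi (abs_nonneg _) (by linarith) ?_
    exact abs_lt.2 ⟨by linarith [ha.1], by linarith [ha.2]⟩
  have e0 : closingArc μ i u 0 = arcRadius μ i * Real.cos φ := by simp [closingArc_eq, hφ]
  have e1 : closingArc μ i u 1 = 1 / 2 + arcRadius μ i * Real.sin φ := by
    simp [closingArc_eq, hφ]
  rw [e0] at hx
  rw [e1]
  have hc0 : 0 ≤ Real.cos φ := nonneg_of_mul_nonneg_right hx hr
  have hsq : Real.sin (arcStart μ i) ^ 2 < Real.sin φ ^ 2 := by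
    rw [Real.sin_sq, Real.sin_sq]
    nlinarith
  have h2 : (1 / 2 : ℝ) ^ 2 < (arcRadius μ i * Real.sin φ) ^ 2 := by
    rw [← arcRadius_mul_sin i, mul_pow, mul_pow]
    exact mul_lt_mul_of_pos_left hsq (by positivity)
  rcases lt_abs.1 (sq_lt_sq.1 h2) with h | h
  · right; rw [abs_of_pos (by norm_num)] at h; linarith
  · left; rw [abs_of_pos (by norm_num)] at h; linarith

/-- A closing arc does not meet the half-plane that contains the meridional disc. -/
theorem closingArc_neg_of_eq_half (i : Fin μ) {u : ℝ} (hu : u ∈ Icc (0 : ℝ) 1)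
    (hy : closingArc μ i u 1 = 1 / 2) : closingArc μ i u 0 < 0 := by
  have ha := arcAngle_mem_Icc i hu
  have hr := arcRadius_pos i
  have h0 := arcStart_pos i
  set φ := arcAngle μ i u with hφ
  have e0 : closingArc μ i u 0 = arcRadius μ i * Real.cos φ := by simp [closingArc_eq, hφ]
  have e1 : closingArc μ i u 1 = 1 / 2 + arcRadius μ i * Real.sin φ := by
    simp [closingArc_eq, hφ]
  rw [e1] at hy
  have hs : Real.sin φ = 0 := by
    have : arcRadius μ i * Real.sin φ = 0 := by linarith
    exact (mul_eq_zero.1 this).resolve_left hr.ne'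
  have hs' : Real.sin (φ - Real.pi) = 0 := by rw [Real.sin_sub_pi, hs, neg_zero]
  have hφ' := (Real.sin_eq_zero_iff_of_lt_of_lt (by linarith [ha.1]) (by linarith [ha.2])).1 hs'
  rw [e0, show φ = Real.pi by linarith, Real.cos_pi]
  linarith

theorem closingArc_injective {i j : Fin μ} {u v : ℝ} (hu : u ∈ Icc (0 : ℝ) 1)
    (hv : v ∈ Icc (0 : ℝ) 1) (h0 : closingArc μ i u 0 = closingArc μ j v 0)
    (h1 : closingArc μ i u 1 = closingArc μ j v 1) : i = j ∧ u = v := by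
  simp only [closingArc_eq, PiLp.toLp_apply, Matrix.cons_val_zero, Matrix.cons_val_one,
    add_right_inj] at h0 h1
  have hi := arcRadius_pos i
  have hj := arcRadius_pos j
  have hR : arcRadius μ i ^ 2 = arcRadius μ j ^ 2 := by
    have e1 := Real.sin_sq_add_cos_sq (arcAngle μ i u)
    have e2 := Real.sin_sq_add_cos_sq (arcAngle μ j v)
    calc arcRadius μ i ^ 2 = (arcRadius μ i * Real.cos (arcAngle μ i u)) ^ 2 +
        (arcRadius μ i * Real.sin (arcAngle μ i u)) ^ 2 := by
          linear_combination (-(arcRadius μ i ^ 2)) * e1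
      _ = _ := by rw [h0, h1]; linear_combination (arcRadius μ j ^ 2) * e2
  have hij : i = j := by
    rw [arcRadius, arcRadius, Real.sq_sqrt (by positivity), Real.sq_sqrt (by positivity),
      add_left_inj] at hR
    exact endX_injective ((pow_left_inj₀ (endX_pos i).le (endX_pos j).le two_ne_zero).1 hR)
  subst hij
  refine ⟨rfl, ?_⟩
  have c := mul_left_cancel₀ hi.ne' h0
  have s := mul_left_cancel₀ hi.ne' h1
  have ha := arcAngle_mem_Icc i hu
  have hb := arcAngle_mem_Icc i hv
  have hp := arcStart_pos i
  have hcos : Real.cos (arcAngle μ i u - arcAngle μ i v) = 1 := by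
    rw [Real.cos_sub, c, s]
    linear_combination Real.sin_sq_add_cos_sq (arcAngle μ i v)
  have hz := (Real.cos_eq_one_iff_of_lt_of_lt (by linarith [ha.1, hb.2])
    (by linarith [ha.2, hb.1])).1 hcos
  have : (u - v) * (2 * Real.pi - 2 * arcStart μ i) = 0 := by
    rw [← hz]; simp only [arcAngle]; ring
  exact sub_eq_zero.1 ((mul_eq_zero.1 this).resolve_right (arcAngle_slope_pos i).ne')

theorem contDiff_closingArc (i : Fin μ) : ContDiff ℝ ∞ (closingArc μ i) := by
  have ha : ContDiff ℝ ∞ (arcAngle μ i) := by unfold arcAngle; fun_prop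
  rw [contDiff_euclidean]
  intro k
  fin_cases k
  · exact contDiff_const.mul (Real.contDiff_cos.comp ha)
  · exact contDiff_const.add (contDiff_const.mul (Real.contDiff_sin.comp ha))
  · exact contDiff_const

/-- The `y`-coordinate increases where the closing arc starts and where it ends. -/
theorem deriv_closingArc_pos (i : Fin μ) {u : ℝ} (hu : u = 0 ∨ u = 1) :
    0 < deriv (closingArc μ i) u 1 := by
  have h1 := (((contDiff_closingArc i).differentiable (by simp)) u).hasDerivAt.coord 1
  have ha : HasDerivAt (arcAngle μ i) (2 * Real.pi - 2 * arcStart μ i) u := by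
    have h := ((hasDerivAt_id u).mul_const
      (2 * Real.pi - 2 * arcStart μ i)).const_add (arcStart μ i)
    rw [one_mul] at h
    exact h
  have h2 : HasDerivAt (fun u => closingArc μ i u 1)
      (arcRadius μ i * (Real.cos (arcAngle μ i u) * (2 * Real.pi - 2 * arcStart μ i))) u := by
    exact (ha.sin.const_mul (arcRadius μ i)).const_add (1 / 2)
  rw [h1.unique h2]
  have hc : Real.cos (arcAngle μ i u) = Real.cos (arcStart μ i) := by
    rcases hu with rfl | rfl
    · rw [arcAngle_zero]
    · rw [arcAngle_one, Real.cos_two_pi_sub]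
  rw [hc, ← mul_assoc, arcRadius_mul_cos]
  exact mul_pos (endX_pos i) (arcAngle_slope_pos i)

/-! ### The closed components -/

section Closed

variable (D : FramedStringLink μ)

theorem closedStrand_of_le (i : Fin μ) {t : ℝ} (h : t ≤ 1) : D.closedStrand i t = D.strand i t :=
  if_pos h

theorem closedStrand_of_ge (i : Fin μ) {t : ℝ} (h : 1 ≤ t) :
    D.closedStrand i t = closingArc μ i (t - 1) := by
  rcases h.eq_or_lt with rfl | h
  · rw [D.closedStrand_of_le i le_rfl, D.strand_one, sub_self, closingArc_zero]
  · exact if_neg (not_le.2 h)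

theorem closedStrand_two (i : Fin μ) : D.closedStrand i 2 = D.strand i 0 := by
  rw [D.closedStrand_of_ge i (by norm_num), D.strand_zero]
  norm_num [closingArc_one]

theorem strand_mem_unit (i : Fin μ) {t : ℝ} (ht : t ∈ Icc (0 : ℝ) 1) (k : Fin 3) :
    0 ≤ D.strand i t k ∧ D.strand i t k ≤ 1 := (D.mem_solidTorus i t ht).1 k

theorem strand_y_mem_Ioo (i : Fin μ) {t : ℝ} (ht : t ∈ Ioo (0 : ℝ) 1) :
    D.strand i t 1 ∈ Ioo (0 : ℝ) 1 := by
  obtain ⟨δ, hδ, hb⟩ := Metric.mem_nhds_iff.1 (mem_interior_iff_mem_nhds.1 (D.mem_interior i t ht))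
  set v : E3 := !₂[0, 1, 0] with hv
  have hn : ‖v‖ = 1 := by
    rw [← Real.sqrt_sq (norm_nonneg v), norm_sq_eq_coords]; simp [hv]
  have hmem : ∀ r : ℝ, |r| < δ → D.strand i t + r • v ∈ solidTorus := fun r hr => hb (by
    rw [Metric.mem_ball, dist_eq_norm, add_sub_cancel_left, norm_smul, hn, mul_one]; exact hr)
  have h1 := ((hmem (δ / 2) (by rw [abs_of_pos] <;> linarith)).1 1).2
  have h2 := ((hmem (-(δ / 2)) (by rw [abs_neg, abs_of_pos] <;> linarith)).1 1).1
  simp [hv] at h1 h2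
  exact ⟨by linarith, by linarith⟩

/-- Points of the closing arcs (end points excluded) are not double points of the projection. -/
theorem eq_of_arc_planar {i j : Fin μ} {s t : ℝ} (hs : s ∈ Ioo (1 : ℝ) 2) (ht : t ∈ Icc (0 : ℝ) 2)
    (h0 : D.closedStrand i s 0 = D.closedStrand j t 0)
    (h1 : D.closedStrand i s 1 = D.closedStrand j t 1) : i = j ∧ s = t := by
  rw [D.closedStrand_of_ge i hs.1.le] at h0 h1
  rcases le_total t 1 with h | h
  · exfalso
    rw [D.closedStrand_of_le j h] at h0 h1
    have hx := D.strand_mem_unit j ⟨ht.1, h⟩ 0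
    have hy := D.strand_mem_unit j ⟨ht.1, h⟩ 1
    rcases closingArc_outside i (u := s - 1) ⟨by linarith [hs.1], by linarith [hs.2]⟩
      (by rw [h0]; exact hx.1) with h2 | h2 <;> rw [h1] at h2 <;> linarith
  · rw [D.closedStrand_of_ge j h] at h0 h1
    obtain ⟨e, e'⟩ := closingArc_injective ⟨by linarith [hs.1], by linarith [hs.2]⟩
      ⟨by linarith, by linarith [ht.2]⟩ h0 h1
    exact ⟨e, by linarith⟩

/-- The parameter in `[0,1]` of a point of a string, for a parameter in `[0,2]` that does not belong
to the interior of the closing arc. -/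
theorem exists_strand_param (i : Fin μ) {s : ℝ} (hs : s ∈ Icc (0 : ℝ) 2) (h : s ∉ Ioo (1 : ℝ) 2) :
    ∃ s' ∈ Icc (0 : ℝ) 1, D.closedStrand i s = D.strand i s' ∧ (s' = s ∨ s = 2 ∧ s' = 0) := by
  rcases le_or_gt s 1 with h1 | h1
  · exact ⟨s, ⟨hs.1, h1⟩, D.closedStrand_of_le i h1, Or.inl rfl⟩
  · have h2 : s = 2 := le_antisymm hs.2 (not_lt.1 fun h2 => h ⟨h1, h2⟩)
    exact ⟨0, by simp, by rw [h2, closedStrand_two], Or.inr ⟨h2, rfl⟩⟩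

theorem closedStrand_injective {i j : Fin μ} {s t : ℝ} (hs : s ∈ Icc (0 : ℝ) 2)
    (ht : t ∈ Icc (0 : ℝ) 2) (h : D.closedStrand i s = D.closedStrand j t) :
    i = j ∧ (s = t ∨ s = 0 ∧ t = 2 ∨ s = 2 ∧ t = 0) := by
  by_cases h1 : s ∈ Ioo (1 : ℝ) 2
  · obtain ⟨e1, e2⟩ := D.eq_of_arc_planar h1 ht (by rw [h]) (by rw [h])
    exact ⟨e1, Or.inl e2⟩
  by_cases h2 : t ∈ Ioo (1 : ℝ) 2
  · obtain ⟨e1, e2⟩ := D.eq_of_arc_planar h2 hs (by rw [h]) (by rw [h])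
    exact ⟨e1.symm, Or.inl e2.symm⟩
  obtain ⟨s', hs', es, cs⟩ := D.exists_strand_param i hs h1
  obtain ⟨t', ht', et, ct⟩ := D.exists_strand_param j ht h2
  rw [es, et] at h
  obtain ⟨e1, e2⟩ := D.injective i j s' hs' t' ht' h
  refine ⟨e1, ?_⟩
  rcases cs with rfl | ⟨rfl, rfl⟩ <;> rcases ct with rfl | ⟨rfl, rfl⟩
  · exact Or.inl e2
  · exact Or.inr (Or.inl ⟨e2, rfl⟩)
  · exact Or.inr (Or.inr ⟨rfl, e2.symm⟩)
  · exact Or.inl rfl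

/-- The components of the closure do not meet the axis of the hole. -/
theorem closedStrand_off_axis (i : Fin μ) {t : ℝ} (ht : t ∈ Icc (0 : ℝ) 2) :
    ¬(D.closedStrand i t 0 = 1 / 2 ∧ D.closedStrand i t 1 = 1 / 2) := by
  rintro ⟨h0, h1⟩
  rcases le_total t 1 with h | h
  · rw [D.closedStrand_of_le i h] at h0 h1
    have := (D.mem_solidTorus i t ⟨ht.1, h⟩).2
    apply this
    show 1 / 4 < _ ∧ _ < 3 / 4 ∧ 1 / 4 < _ ∧ _ < 3 / 4
    rw [h0, h1]; norm_num
  · rw [D.closedStrand_of_ge i h] at h0 h1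
    have := closingArc_neg_of_eq_half i ⟨by linarith, by linarith [ht.2]⟩ h1
    rw [h0] at this
    linarith

end Closed

end FramedStringLink

/-! ### Lifting to the universal cyclic cover -/

@[simp] theorem coverMap_apply_zero (q : E3) :
    coverMap q 0 = 1 / 2 + Real.exp (q 0) * Real.cos (q 1) := rfl
@[simp] theorem coverMap_apply_one (q : E3) :
    coverMap q 1 = 1 / 2 + Real.exp (q 0) * Real.sin (q 1) := rfl
@[simp] theorem coverMap_apply_two (q : E3) : coverMap q 2 = q 2 := rfl
@[simp] theorem deckTranslate_apply_zero (m : ℤ) (q : E3) : deckTranslate m q 0 = q 0 := rfl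
@[simp] theorem deckTranslate_apply_one (m : ℤ) (q : E3) :
    deckTranslate m q 1 = q 1 + 2 * Real.pi * (m : ℝ) := rfl
@[simp] theorem deckTranslate_apply_two (m : ℤ) (q : E3) : deckTranslate m q 2 = q 2 := rfl

theorem E3.ext {p q : E3} (h0 : p 0 = q 0) (h1 : p 1 = q 1) (h2 : p 2 = q 2) : p = q := by
  ext k; fin_cases k <;> assumption

theorem deckTranslate_zero (q : E3) : deckTranslate 0 q = q := by
  apply E3.ext <;> simp

/-- A deck transformation is a translation. -/
theorem deckTranslate_eq_add (m : ℤ) (q : E3) :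
    deckTranslate m q = q + !₂[0, 2 * Real.pi * (m : ℝ), 0] := by
  apply E3.ext <;> simp

theorem coverMap_planar_eq {q q' : E3} (h0 : coverMap q 0 = coverMap q' 0)
    (h1 : coverMap q 1 = coverMap q' 1) :
    q 0 = q' 0 ∧ ∃ m : ℤ, q' 1 = q 1 + 2 * Real.pi * (m : ℝ) := by
  simp only [coverMap_apply_zero, coverMap_apply_one, add_right_inj] at h0 h1
  have e : Real.exp (q 0) = Real.exp (q' 0) := by
    refine (pow_left_inj₀ (Real.exp_pos _).le (Real.exp_pos _).le two_ne_zero).1 ?_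
    have a1 := Real.sin_sq_add_cos_sq (q 1)
    have a2 := Real.sin_sq_add_cos_sq (q' 1)
    calc Real.exp (q 0) ^ 2 = (Real.exp (q 0) * Real.cos (q 1)) ^ 2 +
        (Real.exp (q 0) * Real.sin (q 1)) ^ 2 := by
          linear_combination (-(Real.exp (q 0) ^ 2)) * a1
      _ = _ := by rw [h0, h1]; linear_combination (Real.exp (q' 0) ^ 2) * a2
  rw [e] at h0 h1
  have c := mul_left_cancel₀ (Real.exp_pos _).ne' h0
  have s := mul_left_cancel₀ (Real.exp_pos _).ne' h1
  refine ⟨Real.exp_injective e, ?_⟩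
  obtain ⟨m, hm⟩ := Real.Angle.angle_eq_iff_two_pi_dvd_sub.1
    (Real.Angle.cos_sin_inj c.symm s.symm)
  exact ⟨m, by linarith⟩

theorem coverMap_eq_iff {q q' : E3} :
    coverMap q = coverMap q' ↔ ∃ m : ℤ, q' = deckTranslate m q := by
  constructor
  · intro h
    obtain ⟨h0, m, hm⟩ := coverMap_planar_eq (congrArg (fun p : E3 => p 0) h)
      (congrArg (fun p : E3 => p 1) h)
    have h2 : coverMap q 2 = coverMap q' 2 := by rw [h]
    exact ⟨m, E3.ext h0.symm hm (by simpa using h2.symm)⟩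
  · rintro ⟨m, rfl⟩
    have e : q 1 + 2 * Real.pi * (m : ℝ) = q 1 + m * (2 * Real.pi) := by ring
    apply E3.ext
    · simp [e, Real.cos_add_int_mul_two_pi]
    · simp [e, Real.sin_add_int_mul_two_pi]
    · simp

theorem coverMap_deckTranslate (m : ℤ) (q : E3) : coverMap (deckTranslate m q) = coverMap q :=
  (coverMap_eq_iff.2 ⟨m, rfl⟩).symm

theorem deckTranslate_eq_self {m : ℤ} {q : E3} (h : deckTranslate m q = q) : m = 0 := by
  have := congrArg (fun p : E3 => p 1) h
  simpa [Real.pi_ne_zero] using this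

/-- A continuous real function with values in `ℤ` is constant on a preconnected set. -/
theorem IsPreconnected.constant_int {X : Type*} [TopologicalSpace X] {S : Set X}
    (hS : IsPreconnected S) {f : X → ℝ} (hf : ContinuousOn f S)
    (h : ∀ x ∈ S, ∃ m : ℤ, f x = m) {x y : X} (hx : x ∈ S) (hy : y ∈ S) : f x = f y := by
  classical
  choose! m hm using h
  have hc : ContinuousOn m S := by
    rw [Int.isClosedEmbedding_coe_real.isEmbedding.continuousOn_iff]
    exact hf.congr fun x hx => (hm x hx).symm
  rw [hm x hx, hm y hy, hS.constant hc hx hy]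

theorem E3.continuousOn_coord {X : Type*} [TopologicalSpace X] {S : Set X} {κ : X → E3}
    (h : ContinuousOn κ S) (k : Fin 3) : ContinuousOn (fun x => κ x k) S :=
  (EuclideanSpace.proj (𝕜 := ℝ) k).continuous.comp_continuousOn h

/-- Two lifts of a map on a connected set differ by a deck transformation. -/
theorem exists_deckTranslate_of_coverMap_eq {X : Type*} [TopologicalSpace X] {S : Set X}
    (hS : IsPreconnected S) {κ κ' : X → E3} (hκ : ContinuousOn κ S) (hκ' : ContinuousOn κ' S)
    (h : ∀ x ∈ S, coverMap (κ x) = coverMap (κ' x)) :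
    ∃ m : ℤ, ∀ x ∈ S, κ' x = deckTranslate m (κ x) := by
  rcases S.eq_empty_or_nonempty with rfl | ⟨x₀, hx₀⟩
  · exact ⟨0, by simp⟩
  obtain ⟨m, hm⟩ := coverMap_eq_iff.1 (h x₀ hx₀)
  have h2π : 2 * Real.pi ≠ 0 := by positivity
  have hc : ContinuousOn (fun x => (κ' x 1 - κ x 1) / (2 * Real.pi)) S :=
    ((E3.continuousOn_coord hκ' 1).sub (E3.continuousOn_coord hκ 1)).div_const _
  refine ⟨m, fun x hx => ?_⟩
  have e := hS.constant_int hc (fun y hy => by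
    obtain ⟨n, hn⟩ := coverMap_eq_iff.1 (h y hy)
    exact ⟨n, by rw [hn]; simp⟩) hx hx₀
  obtain ⟨n, hn⟩ := coverMap_eq_iff.1 (h x hx)
  rw [hn, hm] at e
  simp only [deckTranslate_apply_one, add_sub_cancel_left] at e
  rw [mul_div_cancel_left₀ _ h2π, mul_div_cancel_left₀ _ h2π] at e
  rw [hn, Int.cast_injective e]

theorem eqOn_of_coverMap_eq {X : Type*} [TopologicalSpace X] {S : Set X}
    (hS : IsPreconnected S) {κ κ' : X → E3} (hκ : ContinuousOn κ S) (hκ' : ContinuousOn κ' S)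
    (h : ∀ x ∈ S, coverMap (κ x) = coverMap (κ' x)) {x₀ : X} (hx₀ : x₀ ∈ S)
    (h0 : κ x₀ = κ' x₀) : EqOn κ κ' S := by
  obtain ⟨m, hm⟩ := exists_deckTranslate_of_coverMap_eq hS hκ hκ' h
  have : m = 0 := deckTranslate_eq_self (q := κ x₀) (by rw [← hm x₀ hx₀, h0])
  intro x hx
  rw [hm x hx, this, deckTranslate_zero]

/-- A continuous lift of a smooth map is smooth: its radial coordinate is a logarithm of the
radius, its angular coordinate is locally an arcsine. -/
theorem contDiffOn_of_coverMap_eq {E : Type*} [NormedAddCommGroup E] [NormedSpace ℝ E]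
    {S : Set E} {A C : E → E3} (hA : ContinuousOn A S) (hC : ContDiffOn ℝ ∞ C S)
    (h : ∀ p ∈ S, coverMap (A p) = C p) : ContDiffOn ℝ ∞ A S := by
  have hk := contDiffOn_euclidean.1 hC
  have e0 : ∀ p ∈ S, C p 0 - 1 / 2 = Real.exp (A p 0) * Real.cos (A p 1) := fun p hp => by
    rw [← h p hp]; simp
  have e1 : ∀ p ∈ S, C p 1 - 1 / 2 = Real.exp (A p 0) * Real.sin (A p 1) := fun p hp => by
    rw [← h p hp]; simp
  have er : ∀ p ∈ S, (C p 0 - 1 / 2) ^ 2 + (C p 1 - 1 / 2) ^ 2 = Real.exp (A p 0) ^ 2 := by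
    intro p hp
    rw [e0 p hp, e1 p hp]
    linear_combination (Real.exp (A p 0) ^ 2) * Real.sin_sq_add_cos_sq (A p 1)
  have s0 : ContDiffOn ℝ ∞ (fun p => C p 0 - 1 / 2) S := (hk 0).sub contDiffOn_const
  have s1 : ContDiffOn ℝ ∞ (fun p => C p 1 - 1 / 2) S := (hk 1).sub contDiffOn_const
  have a0 : ContDiffOn ℝ ∞ (fun p => A p 0) S := by
    have : ContDiffOn ℝ ∞ (fun p =>
        1 / 2 * Real.log ((C p 0 - 1 / 2) ^ 2 + (C p 1 - 1 / 2) ^ 2)) S := by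
      refine contDiffOn_const.mul (((s0.pow 2).add (s1.pow 2)).log fun p hp => ?_)
      rw [er p hp]; positivity
    refine this.congr fun p hp => ?_
    rw [er p hp, Real.log_pow, Real.log_exp]
    push_cast; ring
  have hexp : ContDiffOn ℝ ∞ (fun p => Real.exp (-A p 0)) S := a0.neg.exp
  have hcos : ∀ p ∈ S, Real.exp (-A p 0) * (C p 0 - 1 / 2) = Real.cos (A p 1) := fun p hp => by
    rw [e0 p hp, ← mul_assoc, ← Real.exp_add]; simp
  have hsin : ∀ p ∈ S, Real.exp (-A p 0) * (C p 1 - 1 / 2) = Real.sin (A p 1) := fun p hp => by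
    rw [e1 p hp, ← mul_assoc, ← Real.exp_add]; simp
  have a1 : ContDiffOn ℝ ∞ (fun p => A p 1) S := by
    intro p hp
    have hg : ContDiffOn ℝ ∞ (fun q => Real.cos (A p 1) * (Real.exp (-A q 0) * (C q 1 - 1 / 2)) -
        Real.sin (A p 1) * (Real.exp (-A q 0) * (C q 0 - 1 / 2))) S :=
      (contDiffOn_const.mul (hexp.mul s1)).sub (contDiffOn_const.mul (hexp.mul s0))
    have hv : ∀ q ∈ S, Real.cos (A p 1) * (Real.exp (-A q 0) * (C q 1 - 1 / 2)) -
        Real.sin (A p 1) * (Real.exp (-A q 0) * (C q 0 - 1 / 2)) =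
          Real.sin (A q 1 - A p 1) := fun q hq => by
      rw [hcos q hq, hsin q hq, Real.sin_sub]; ring
    have hat : ContDiffAt ℝ ∞ Real.arcsin (Real.cos (A p 1) * (Real.exp (-A p 0) *
        (C p 1 - 1 / 2)) - Real.sin (A p 1) * (Real.exp (-A p 0) * (C p 0 - 1 / 2))) := by
      rw [hv p hp]
      exact Real.contDiffAt_arcsin (by simp) (by simp)
    have hcomp := (contDiffWithinAt_const (c := A p 1)).add
      (hat.comp_contDiffWithinAt p (hg p hp))
    have hnear : ∀ᶠ q in 𝓝[S] p, |A q 1 - A p 1| < Real.pi / 2 := by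
      have ht : Tendsto (fun q => |A q 1 - A p 1|) (𝓝[S] p) (𝓝 0) := by
        have := ((E3.continuousOn_coord hA 1 p hp).sub_const (A p 1)).abs
        simpa [ContinuousWithinAt] using this
      exact ht.eventually_lt_const (by positivity)
    refine hcomp.congr_of_eventuallyEq_of_mem ?_ hp
    filter_upwards [hnear, self_mem_nhdsWithin] with q hq hqS
    rw [abs_lt] at hq
    simp only [Function.comp_apply]
    rw [hv q hqS, Real.arcsin_sin hq.1.le hq.2.le]
    ring
  rw [contDiffOn_euclidean]
  intro k
  fin_cases k
  · exact a0
  · exact a1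
  · exact (hk 2).congr fun p hp => by rw [← h p hp]; rfl

/-- A continuous map of a rectangle to the complement of the axis lifts to the cover. -/
theorem exists_lift_of_off_axis {C : ℝ × ℝ → E3} {a b c d : ℝ} (hab : a ≤ b) (hcd : c ≤ d)
    (hC : ContinuousOn C (Icc a b ×ˢ Icc c d))
    (hax : ∀ p ∈ Icc a b ×ˢ Icc c d, ¬(C p 0 = 1 / 2 ∧ C p 1 = 1 / 2)) {p₀ : ℝ × ℝ}
    (hp₀ : p₀ ∈ Icc a b ×ˢ Icc c d) {q₀ : E3} (hq₀ : coverMap q₀ = C p₀) :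
    ∃ A : ℝ × ℝ → E3, Continuous A ∧ A p₀ = q₀ ∧
      ∀ p ∈ Icc a b ×ˢ Icc c d, coverMap (A p) = C p := by
  -- A retraction onto the rectangle extends the map to the plane, which is simply connected.
  obtain ⟨r, hrc, hrm, hre⟩ : ∃ r : ℝ × ℝ → ℝ × ℝ, Continuous r ∧
      (∀ p, r p ∈ Icc a b ×ˢ Icc c d) ∧ ∀ p ∈ Icc a b ×ˢ Icc c d, r p = p := by
    refine ⟨fun p => (projIcc a b hab p.1, projIcc c d hcd p.2), ?_,
      fun p => ⟨(projIcc a b hab p.1).2, (projIcc c d hcd p.2).2⟩, fun p hp => ?_⟩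
    · refine Continuous.prodMk ?_ ?_
      · exact continuous_subtype_val.comp (continuous_projIcc.comp continuous_fst)
      · exact continuous_subtype_val.comp (continuous_projIcc.comp continuous_snd)
    · dsimp only; rw [projIcc_of_mem hab hp.1, projIcc_of_mem hcd hp.2]
  have hCr : Continuous fun p => C (r p) :=
    hC.comp_continuous hrc hrm
  have hCk : ∀ k : Fin 3, Continuous fun p => C (r p) k := fun k =>
    (EuclideanSpace.proj (𝕜 := ℝ) k).continuous.comp hCr
  have hwc : Continuous fun p => (⟨C (r p) 0 - 1 / 2, C (r p) 1 - 1 / 2⟩ : ℂ) := by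
    exact Complex.equivRealProdCLM.symm.continuous.comp
      (((hCk 0).sub continuous_const).prodMk ((hCk 1).sub continuous_const))
  have hexp : ∀ z : ℂ, ∀ x y : ℝ, Complex.exp z = ⟨x, y⟩ ↔
      Real.exp z.re * Real.cos z.im = x ∧ Real.exp z.re * Real.sin z.im = y := fun z x y => by
    rw [Complex.ext_iff, Complex.exp_re, Complex.exp_im]
  have he : Complex.exp ⟨q₀ 0, q₀ 1⟩ = ⟨C (r p₀) 0 - 1 / 2, C (r p₀) 1 - 1 / 2⟩ := by
    rw [hexp, hre p₀ hp₀, ← hq₀, coverMap_apply_zero, coverMap_apply_one]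
    constructor <;> ring
  have hne : ∀ p, (⟨C (r p) 0 - 1 / 2, C (r p) 1 - 1 / 2⟩ : ℂ) ≠ 0 := fun p h0 =>
    hax (r p) (hrm p) (by
      rw [Complex.ext_iff] at h0
      exact ⟨sub_eq_zero.1 h0.1, sub_eq_zero.1 h0.2⟩)
  obtain ⟨ξ, ⟨hξ0, hξ⟩, -⟩ := Complex.isCoveringMapOn_exp.existsUnique_continuousMap_lifts
    ⟨_, hwc⟩ he hne
  refine ⟨fun p => !₂[(ξ p).re, (ξ p).im, C (r p) 2], ?_, ?_, fun p hp => ?_⟩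
  · refine (PiLp.continuous_toLp 2 _).comp (continuous_pi fun k => ?_)
    fin_cases k
    · exact Complex.continuous_re.comp ξ.continuous
    · exact Complex.continuous_im.comp ξ.continuous
    · exact hCk 2
  · apply E3.ext
    · simp [hξ0]
    · simp [hξ0]
    · simp [hre p₀ hp₀, ← hq₀]
  · obtain ⟨h0, h1⟩ := (hexp _ _ _).1 (congrFun hξ p)
    rw [hre p hp] at h0 h1
    apply E3.ext
    · simp [h0]
    · simp [h1]
    · simp [hre p hp]

namespace FramedStringLink

variable {μ : ℕ}

/-! ### Lifting an isotopy -/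

/-- A smooth one-parameter family of framed string links, with parameter in `[0,1]`. -/
structure IsSmoothFamily (F : ℝ → FramedStringLink μ) : Prop where
  strand : ∀ i, ContDiffOn ℝ ∞ (fun p : ℝ × ℝ => (F p.1).strand i p.2) (patch 0 1)
  framing : ∀ i, ContDiffOn ℝ ∞ (fun p : ℝ × ℝ => (F p.1).framing i p.2) (patch 0 1)

theorem isSmoothFamily_const (T : FramedStringLink μ) : IsSmoothFamily fun _ => T where
  strand i := (T.smooth_strand i).comp (f := fun p : ℝ × ℝ => p.2) (by fun_prop) fun _ hp => hp.2
  framing i := (T.smooth_framing i).comp (f := fun p : ℝ × ℝ => p.2) (by fun_prop) fun _ hp => hp.2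

theorem closedStrand_zero (T : FramedStringLink μ) (i : Fin μ) :
    T.closedStrand i 0 = !₂[endX μ i, 0, 1 / 2] := by
  rw [T.closedStrand_of_le i zero_le_one, T.strand_zero]

theorem closedStrand_two_eq_zero (T : FramedStringLink μ) (i : Fin μ) :
    T.closedStrand i 2 = T.closedStrand i 0 := by
  rw [closedStrand_two, T.closedStrand_of_le i zero_le_one]

variable {F : ℝ → FramedStringLink μ}

theorem IsSmoothFamily.isLoopHomotopy (hF : IsSmoothFamily F) (i : Fin μ) :
    IsLoopHomotopy fun p : ℝ × ℝ => (F p.1).closedStrand i p.2 where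
  left := (hF.strand i).congr fun p hp => (F p.1).closedStrand_of_le i hp.2.2
  right := by
    have h : ContDiff ℝ ∞ fun p : ℝ × ℝ => closingArc μ i (p.2 - 1) :=
      (contDiff_closingArc i).comp (by fun_prop)
    exact h.contDiffOn.congr fun p hp => (F p.1).closedStrand_of_ge i hp.2.1
  closed _ _ := closedStrand_two_eq_zero _ i

theorem patch_union : patch 0 1 ∪ patch 1 2 = patch 0 2 := by
  rw [patch, patch, patch, ← prod_union, Icc_union_Icc_eq_Icc zero_le_one one_le_two]

theorem patch_union_continuousOn {X : Type*} [TopologicalSpace X] {A : ℝ × ℝ → X}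
    (h1 : ContinuousOn A (patch 0 1)) (h2 : ContinuousOn A (patch 1 2)) :
    ContinuousOn A (patch 0 2) := by
  rw [← patch_union]
  exact h1.union_of_isClosed h2 (isClosed_Icc.prod isClosed_Icc) (isClosed_Icc.prod isClosed_Icc)

theorem _root_.IsLoopHomotopy.continuousOn {A : ℝ × ℝ → E3} (hA : IsLoopHomotopy A) :
    ContinuousOn A (patch 0 2) :=
  patch_union_continuousOn hA.left.continuousOn hA.right.continuousOn

/-- `A` lifts the `i`-th closed component throughout the family `F`. -/
structure IsFamilyLift (F : ℝ → FramedStringLink μ) (i : Fin μ) (A : ℝ × ℝ → E3) : Prop where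
  continuousOn : ContinuousOn A (patch 0 2)
  cover : ∀ p ∈ patch 0 2, coverMap (A p) = (F p.1).closedStrand i p.2

theorem IsFamilyLift.left {i : Fin μ} {A : ℝ × ℝ → E3} (hA : IsFamilyLift F i A)
    (hF : IsSmoothFamily F) : ContDiffOn ℝ ∞ A (patch 0 1) := by
  have h : patch 0 1 ⊆ patch 0 2 := patch_union ▸ subset_union_left
  exact contDiffOn_of_coverMap_eq (hA.continuousOn.mono h) (hF.isLoopHomotopy i).left
    fun p hp => hA.cover p (h hp)

theorem IsFamilyLift.right {i : Fin μ} {A : ℝ × ℝ → E3} (hA : IsFamilyLift F i A)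
    (hF : IsSmoothFamily F) : ContDiffOn ℝ ∞ A (patch 1 2) := by
  have h : patch 1 2 ⊆ patch 0 2 := patch_union ▸ subset_union_right
  exact contDiffOn_of_coverMap_eq (hA.continuousOn.mono h) (hF.isLoopHomotopy i).right
    fun p hp => hA.cover p (h hp)

theorem IsFamilyLift.slice {i : Fin μ} {A : ℝ × ℝ → E3} (hA : IsFamilyLift F i A)
    {u : ℝ} (hu : u ∈ Icc (0 : ℝ) 1) : ContinuousOn (fun t => A (u, t)) (Icc 0 2) :=
  hA.continuousOn.comp (f := fun t : ℝ => (u, t)) (by fun_prop) fun _ ht => ⟨hu, ht⟩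

/-- Every lift of the common initial point extends to a lift of the family. -/
theorem IsSmoothFamily.exists_familyLift (hF : IsSmoothFamily F) (i : Fin μ) {q₀ : E3}
    (hq₀ : coverMap q₀ = !₂[endX μ i, 0, 1 / 2]) :
    ∃ A, IsFamilyLift F i A ∧ ∀ u ∈ Icc (0 : ℝ) 1, A (u, 0) = q₀ := by
  have hz : ((0 : ℝ), (0 : ℝ)) ∈ patch 0 2 := ⟨⟨le_rfl, zero_le_one⟩, ⟨le_rfl, zero_le_two⟩⟩
  obtain ⟨A, hA, h0, hc⟩ := exists_lift_of_off_axis zero_le_one zero_le_two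
    (hF.isLoopHomotopy i).continuousOn (fun p hp => (F p.1).closedStrand_off_axis i hp.2) hz
    (q₀ := q₀) (by rw [hq₀, closedStrand_zero])
  refine ⟨A, ⟨hA.continuousOn, hc⟩, fun u hu => ?_⟩
  have := eqOn_of_coverMap_eq (S := Icc (0 : ℝ) 1) isPreconnected_Icc (κ := fun u => A (u, 0))
    (κ' := fun _ => q₀) (by fun_prop) continuousOn_const (fun u hu => by
      rw [hc (u, 0) ⟨hu, ⟨le_rfl, zero_le_two⟩⟩, hq₀, closedStrand_zero]) ⟨le_rfl, zero_le_one⟩ h0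
  exact this hu

/-- The lifts to the cyclic cover of the components of the closure of `T` are closed curves. -/
def LiftClosed (T : FramedStringLink μ) : Prop :=
  ∀ i, ∀ κ : ℝ → E3, ContinuousOn κ (Icc 0 2) →
    (∀ t ∈ Icc (0 : ℝ) 2, coverMap (κ t) = T.closedStrand i t) → κ 2 = κ 0

theorem closedStrand_congr {T T' : FramedStringLink μ}
    (h : ∀ i, ∀ t ∈ Icc (0 : ℝ) 1, T.strand i t = T'.strand i t) (i : Fin μ) {t : ℝ}
    (ht : 0 ≤ t) : T.closedStrand i t = T'.closedStrand i t := by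
  unfold closedStrand
  split_ifs with h1
  · exact h i t ⟨ht, h1⟩
  · rfl

theorem LiftClosed.congr {T T' : FramedStringLink μ} (hT : T.LiftClosed)
    (h : ∀ i, ∀ t ∈ Icc (0 : ℝ) 1, T.strand i t = T'.strand i t) : T'.LiftClosed :=
  fun i κ hκ hc => hT i κ hκ fun t ht => by rw [hc t ht, closedStrand_congr h i ht.1]

/-- A lift of a family consists of closed curves if one of them is closed. -/
theorem IsFamilyLift.closed_of_closed {i : Fin μ} {A : ℝ × ℝ → E3} (hA : IsFamilyLift F i A)
    {u v : ℝ} (hu : u ∈ Icc (0 : ℝ) 1) (hv : v ∈ Icc (0 : ℝ) 1) (h : A (u, 2) = A (u, 0)) :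
    A (v, 2) = A (v, 0) := by
  have z0 : (0 : ℝ) ∈ Icc (0 : ℝ) 2 := ⟨le_rfl, zero_le_two⟩
  have z2 : (2 : ℝ) ∈ Icc (0 : ℝ) 2 := ⟨zero_le_two, le_rfl⟩
  obtain ⟨m, hm⟩ := exists_deckTranslate_of_coverMap_eq (S := Icc (0 : ℝ) 1) isPreconnected_Icc
    (κ := fun u => A (u, 0)) (κ' := fun u => A (u, 2))
    (hA.continuousOn.comp (f := fun u : ℝ => (u, (0 : ℝ))) (by fun_prop) fun _ hu => ⟨hu, z0⟩)
    (hA.continuousOn.comp (f := fun u : ℝ => (u, (2 : ℝ))) (by fun_prop) fun _ hu => ⟨hu, z2⟩)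
    (fun u hu => by
      rw [hA.cover (u, 0) ⟨hu, z0⟩, hA.cover (u, 2) ⟨hu, z2⟩, closedStrand_two_eq_zero])
  have h0 : m = 0 := deckTranslate_eq_self (q := A (u, 0)) ((hm u hu).symm.trans h)
  have := hm v hv
  rwa [h0, deckTranslate_zero] at this

/-- A lift of one member of a family extends to a lift of the family. -/
theorem IsSmoothFamily.exists_familyLift_eq (hF : IsSmoothFamily F) {i : Fin μ} {v : ℝ}
    (hv : v ∈ Icc (0 : ℝ) 1) {κ : ℝ → E3} (hκ : ContinuousOn κ (Icc 0 2))
    (hc : ∀ t ∈ Icc (0 : ℝ) 2, coverMap (κ t) = (F v).closedStrand i t) :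
    ∃ A, IsFamilyLift F i A ∧ ∀ t ∈ Icc (0 : ℝ) 2, A (v, t) = κ t := by
  have z0 : (0 : ℝ) ∈ Icc (0 : ℝ) 2 := ⟨le_rfl, zero_le_two⟩
  obtain ⟨A, hA, h0⟩ := hF.exists_familyLift i (q₀ := κ 0) (by rw [hc 0 z0, closedStrand_zero])
  exact ⟨A, hA, eqOn_of_coverMap_eq isPreconnected_Icc (hA.slice hv) hκ
    (fun t ht => by rw [hA.cover (v, t) ⟨hv, ht⟩, hc t ht]) z0 (h0 v hv)⟩

theorem IsSmoothFamily.liftClosed (hF : IsSmoothFamily F) {u v : ℝ} (hu : u ∈ Icc (0 : ℝ) 1)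
    (hv : v ∈ Icc (0 : ℝ) 1) (h : (F u).LiftClosed) : (F v).LiftClosed := by
  intro i κ hκ hc
  obtain ⟨A, hA, he⟩ := hF.exists_familyLift_eq hv hκ hc
  have := hA.closed_of_closed hu hv (h i _ (hA.slice hu) fun t ht => hA.cover (u, t) ⟨hu, ht⟩)
  rwa [he 2 ⟨zero_le_two, le_rfl⟩, he 0 ⟨le_rfl, zero_le_two⟩] at this

theorem IsFamilyLift.isLoopHomotopy {i : Fin μ} {A : ℝ × ℝ → E3} (hA : IsFamilyLift F i A)
    (hF : IsSmoothFamily F) {v : ℝ} (hv : v ∈ Icc (0 : ℝ) 1) (h : (F v).LiftClosed) :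
    IsLoopHomotopy A :=
  ⟨hA.left hF, hA.right hF, fun u hu => hF.liftClosed hv hu h i _ (hA.slice hu) fun t ht =>
    hA.cover (u, t) ⟨hu, ht⟩⟩

/-- Lifts with initial points in a given sheet exist. The principal argument of the initial points is
negative, so that the angles between `2πk` and `2π(k + 1)` are obtained by adding `2π(k + 1)`. -/
theorem exists_isLift (T : FramedStringLink μ) (k : ℤ) : ∃ K, T.IsLift k K := by
  have h : ∀ i, ∃ κ : ℝ → E3, ContinuousOn κ (Icc 0 2) ∧
      (∀ t ∈ Icc (0 : ℝ) 2, coverMap (κ t) = T.closedStrand i t) ∧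
      κ 0 1 ∈ Ioo (2 * Real.pi * (k : ℝ)) (2 * Real.pi * ((k : ℝ) + 1)) := by
    intro i
    set w : ℂ := ⟨endX μ i - 1 / 2, -1 / 2⟩ with hw
    have hw0 : w ≠ 0 := fun h => by
      have := congrArg Complex.im h
      norm_num [hw] at this
    have h1 : w.arg < 0 := Complex.arg_neg_iff.2 (by norm_num [hw])
    have h2 := Complex.neg_pi_lt_arg w
    have hp : w.arg + 2 * Real.pi * ((k : ℝ) + 1) = w.arg + ((k + 1 : ℤ) : ℝ) * (2 * Real.pi) := by
      push_cast; ring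
    obtain ⟨A, hA, h0⟩ := (isSmoothFamily_const T).exists_familyLift i
      (q₀ := !₂[Real.log ‖w‖, w.arg + 2 * Real.pi * ((k : ℝ) + 1), 1 / 2]) (by
        have e0 := Complex.norm_mul_cos_arg w
        have e1 := Complex.norm_mul_sin_arg w
        apply E3.ext
        · simp only [coverMap_apply_zero, Matrix.cons_val_zero,
            Matrix.cons_val_one]
          rw [hp, Real.cos_add_int_mul_two_pi, Real.exp_log (norm_pos_iff.2 hw0), e0]
          simp [hw]
        · simp only [coverMap_apply_one, Matrix.cons_val_zero,
            Matrix.cons_val_one]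
          rw [hp, Real.sin_add_int_mul_two_pi, Real.exp_log (norm_pos_iff.2 hw0), e1]
          norm_num [hw]
        · rfl)
    have z0 : (0 : ℝ) ∈ Icc (0 : ℝ) 1 := ⟨le_rfl, zero_le_one⟩
    refine ⟨fun t => A (0, t), hA.slice z0, fun t ht => hA.cover (0, t) ⟨z0, ht⟩, ?_⟩
    dsimp only
    rw [h0 0 z0]
    have hpi := Real.pi_pos
    constructor <;> simp only [Matrix.cons_val_one, Matrix.cons_val_zero] <;>
      nlinarith
  choose K hK using h
  exact ⟨K, hK⟩

/-- Distinct translates of lifted components are disjoint. -/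
theorem lift_ne_deckTranslate {T : FramedStringLink μ} (hT : T.LiftClosed) {K : Fin μ → ℝ → E3}
    (hK : ∀ i, ContinuousOn (K i) (Icc 0 2))
    (hc : ∀ i, ∀ t ∈ Icc (0 : ℝ) 2, coverMap (K i t) = T.closedStrand i t) {i j : Fin μ} {m : ℤ}
    (hm : ¬(i = j ∧ m = 0)) {s t : ℝ} (hs : s ∈ Icc (0 : ℝ) 2) (ht : t ∈ Icc (0 : ℝ) 2) :
    K i s ≠ deckTranslate m (K j t) := by
  intro h
  have h' := congrArg coverMap h
  rw [coverMap_deckTranslate, hc i s hs, hc j t ht] at h'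
  obtain ⟨rfl, hst⟩ := T.closedStrand_injective hs ht h'
  have e : K i s = K i t := by
    have := hT i (K i) (hK i) (hc i)
    rcases hst with rfl | ⟨rfl, rfl⟩ | ⟨rfl, rfl⟩
    · rfl
    · exact this.symm
    · exact this
  rw [e] at h
  exact hm ⟨rfl, deckTranslate_eq_self h.symm⟩

end FramedStringLink

/-! ### Uniform separation of a loop from its parallels -/

section Separation

theorem IsCompact.exists_pos_le_norm {X : Type*} [TopologicalSpace X] {K : Set X}
    (hK : IsCompact K) {f : X → E3} (hf : ContinuousOn f K) (h0 : ∀ x ∈ K, f x ≠ 0) :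
    ∃ c > 0, ∀ x ∈ K, c ≤ ‖f x‖ := by
  rcases K.eq_empty_or_nonempty with rfl | hne
  · exact ⟨1, one_pos, by simp⟩
  obtain ⟨x, hx, hmin⟩ := hK.exists_isMinOn hne hf.norm
  exact ⟨‖f x‖, norm_pos_iff.2 (h0 x hx), fun y hy => hmin hy⟩

/-- If the cone spanned by `X x`, `Y x` and the line of `Z x` is non-degenerate for all `x` in a
compact set, then the norm of the combinations is uniformly bounded below. -/
theorem IsCompact.exists_cone_bound {B : Type*} [TopologicalSpace B] {K : Set B}
    (hK : IsCompact K) {X Y Z : B → E3} (hX : ContinuousOn X K) (hY : ContinuousOn Y K)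
    (hZ : ContinuousOn Z K)
    (h : ∀ x ∈ K, ∀ p q e : ℝ, 0 ≤ p → 0 ≤ q → p • X x + q • Y x + e • Z x = 0 →
      p = 0 ∧ q = 0 ∧ e = 0) :
    ∃ c > 0, ∀ x ∈ K, ∀ p q e : ℝ, 0 ≤ p → 0 ≤ q →
      c * (p + q + |e|) ≤ ‖p • X x + q • Y x + e • Z x‖ := by
  obtain ⟨S, hSc, hS⟩ : ∃ S : Set (ℝ × ℝ × ℝ), IsCompact S ∧
      ∀ v, v ∈ S ↔ 0 ≤ v.1 ∧ 0 ≤ v.2.1 ∧ v.1 + v.2.1 + |v.2.2| = 1 := by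
    refine ⟨{v | 0 ≤ v.1} ∩ ({v | 0 ≤ v.2.1} ∩ {v | v.1 + v.2.1 + |v.2.2| = 1}), ?_,
      fun v => Iff.rfl⟩
    have k1 : IsClosed {v : ℝ × ℝ × ℝ | 0 ≤ v.1} := isClosed_le continuous_const continuous_fst
    have k2 : IsClosed {v : ℝ × ℝ × ℝ | 0 ≤ v.2.1} :=
      isClosed_le continuous_const (continuous_fst.comp continuous_snd)
    have k3 : IsClosed {v : ℝ × ℝ × ℝ | v.1 + v.2.1 + |v.2.2| = 1} :=
      isClosed_eq ((continuous_fst.add (continuous_fst.comp continuous_snd)).add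
        (continuous_snd.comp continuous_snd).abs) continuous_const
    refine Metric.isCompact_of_isClosed_isBounded (k1.inter (k2.inter k3)) ?_
    refine (isCompact_Icc (a := ((-1 : ℝ), (-1 : ℝ), (-1 : ℝ)))
      (b := ((1 : ℝ), (1 : ℝ), (1 : ℝ)))).isBounded.subset fun v hv => ?_
    obtain ⟨h1 : 0 ≤ v.1, h2 : 0 ≤ v.2.1, h3 : v.1 + v.2.1 + |v.2.2| = 1⟩ := hv
    have h4 := abs_nonneg v.2.2
    have h5 := neg_abs_le v.2.2
    have h6 := le_abs_self v.2.2
    exact ⟨⟨by linarith, by dsimp; linarith, by dsimp; linarith⟩,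
      ⟨by linarith, by dsimp; linarith, by dsimp; linarith⟩⟩
  obtain ⟨c, hc, hb⟩ := (hK.prod hSc).exists_pos_le_norm
    (f := fun y : B × ℝ × ℝ × ℝ => y.2.1 • X y.1 + y.2.2.1 • Y y.1 + y.2.2.2 • Z y.1) (by
      have m : MapsTo (Prod.fst : B × ℝ × ℝ × ℝ → B) (K ×ˢ S) K := fun y hy => hy.1
      have hX' := hX.comp continuousOn_fst m
      have hY' := hY.comp continuousOn_fst m
      have hZ' := hZ.comp continuousOn_fst m
      have p1 : Continuous fun y : B × ℝ × ℝ × ℝ => y.2.1 := continuous_fst.comp continuous_snd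
      have p2 : Continuous fun y : B × ℝ × ℝ × ℝ => y.2.2.1 :=
        continuous_fst.comp (continuous_snd.comp continuous_snd)
      have p3 : Continuous fun y : B × ℝ × ℝ × ℝ => y.2.2.2 :=
        continuous_snd.comp (continuous_snd.comp continuous_snd)
      exact ((p1.continuousOn.smul hX').add (p2.continuousOn.smul hY')).add
        (p3.continuousOn.smul hZ')) (by
      rintro ⟨x, p, q, e⟩ ⟨hx, hpqe⟩ h0
      obtain ⟨hp, hq, h1⟩ := (hS _).1 hpqe
      obtain ⟨rfl, rfl, rfl⟩ := h x hx p q e hp hq h0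
      simp at h1)
  refine ⟨c, hc, fun x hx p q e hp hq => ?_⟩
  set N := p + q + |e| with hN
  have hN0 : 0 ≤ N := by positivity
  rcases hN0.eq_or_lt with h0 | h0
  · rw [← h0, mul_zero]; exact norm_nonneg _
  have := hb (x, N⁻¹ * p, N⁻¹ * q, N⁻¹ * e) ⟨hx, (hS _).2 ⟨by dsimp; positivity,
    by dsimp; positivity, by
    dsimp
    rw [abs_mul, abs_of_pos (inv_pos.2 h0), ← mul_add, ← mul_add, ← hN, inv_mul_cancel₀ h0.ne']⟩⟩
  dsimp only at this
  rw [mul_smul, mul_smul, mul_smul, ← smul_add, ← smul_add, norm_smul, Real.norm_eq_abs,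
    abs_of_pos (inv_pos.2 h0), ← div_eq_inv_mul, le_div_iff₀ h0] at this
  exact this

/-- Uniform differentiability of the curves of a homotopy. -/
theorem exists_uniform_curveDeriv {A : ℝ × ℝ → E3} {a b : ℝ} (hab : a < b)
    (hA : ContDiffOn ℝ ∞ A (patch a b)) {η : ℝ} (hη : 0 < η) :
    ∃ δ > 0, ∀ u ∈ Icc (0 : ℝ) 1, ∀ s ∈ Icc a b, ∀ t ∈ Icc a b, |s - t| ≤ δ →
      ‖A (u, s) - A (u, t) - (s - t) • curveDeriv a b A (u, t)‖ ≤ η * |s - t| := by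
  have hK : IsCompact (patch a b) := isCompact_Icc.prod isCompact_Icc
  have hu := hK.uniformContinuousOn_of_continuous (contDiffOn_curveDeriv hab hA).continuousOn
  obtain ⟨δ, hδ, h⟩ := Metric.uniformContinuousOn_iff_le.1 hu η hη
  refine ⟨δ, hδ, fun u hu s hs t ht hst => ?_⟩
  have hsub : uIcc t s ⊆ Icc a b := uIcc_subset_Icc ht hs
  have hd : ∀ x ∈ uIcc t s, HasDerivWithinAt
      (fun x => A (u, x) - x • curveDeriv a b A (u, t))
      (curveDeriv a b A (u, x) - curveDeriv a b A (u, t)) (uIcc t s) x := fun x hx => by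
    have h1 := (hasDerivWithinAt_curveDeriv hA ⟨hu, hsub hx⟩).mono hsub
    have h2 := ((hasDerivAt_id x).smul_const (curveDeriv a b A (u, t))).hasDerivWithinAt
      (s := uIcc t s)
    rw [one_smul] at h2
    exact h1.sub h2
  have hb := (convex_uIcc t s).norm_image_sub_le_of_norm_hasDerivWithin_le (C := η) hd
    (fun x hx => by
      rw [← dist_eq_norm]
      refine h (u, x) ⟨hu, hsub hx⟩ (u, t) ⟨hu, ht⟩ ?_
      rw [dist_prod_same_left, Real.dist_eq]
      rcases mem_uIcc.1 hx with h' | h'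
      · refine le_trans ?_ hst
        rw [abs_of_nonneg (by linarith [h'.1]), abs_of_nonneg (by linarith [h'.1, h'.2])]
        linarith [h'.2]
      · refine le_trans ?_ hst
        rw [abs_of_nonpos (by linarith [h'.2]), abs_of_nonpos (by linarith [h'.1, h'.2])]
        linarith [h'.1]) left_mem_uIcc right_mem_uIcc
  rw [Real.norm_eq_abs] at hb
  refine le_trans (le_of_eq ?_) hb
  congr 1
  rw [sub_smul]
  abel

theorem eventually_gt_zero_of_exists {P : ℝ → Prop}
    (hmono : ∀ c c', 0 < c' → c' ≤ c → P c → P c') (h : ∃ c > 0, P c) :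
    ∀ᶠ c in 𝓝[>] (0 : ℝ), P c := by
  obtain ⟨c, hc, hP⟩ := h
  filter_upwards [Ioo_mem_nhdsGT hc] with c' hc' using hmono c c' hc'.1 hc'.2.le hP

variable {A V : ℝ × ℝ → E3}

/-- Separation of a curve from its parallels, for nearby parameters in the same piece. -/
theorem eventually_separated_piece {a b : ℝ} (hab : a < b) (hA : ContDiffOn ℝ ∞ A (patch a b))
    (hV : ContinuousOn V (patch a b))
    (h : ∀ p ∈ patch a b, ∀ x e : ℝ, x • curveDeriv a b A p + e • V p = 0 → x = 0 ∧ e = 0) :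
    ∀ᶠ c in 𝓝[>] (0 : ℝ), ∀ u ∈ Icc (0 : ℝ) 1, ∀ s ∈ Icc a b, ∀ t ∈ Icc a b, |s - t| ≤ c →
      ∀ e : ℝ, c * (|s - t| + |e|) ≤ ‖A (u, s) - A (u, t) - e • V (u, t)‖ := by
  refine eventually_gt_zero_of_exists (fun c c' h0 hc hP u hu s hs t ht hst e =>
    le_trans ?_ (hP u hu s hs t ht (hst.trans hc) e)) ?_
  · gcongr
  have hK : IsCompact (patch a b) := isCompact_Icc.prod isCompact_Icc
  have hτ := (contDiffOn_curveDeriv hab hA).continuousOn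
  obtain ⟨c, hc, hb⟩ := hK.exists_cone_bound hτ hτ hV (fun x hx p q e hp hq h0 => by
    rw [← add_smul] at h0
    obtain ⟨h1, h2⟩ := h x hx _ _ h0
    exact ⟨by linarith, by linarith, h2⟩)
  have hb' : ∀ x ∈ patch a b, ∀ p e : ℝ,
      c * (|p| + |e|) ≤ ‖p • curveDeriv a b A x - e • V x‖ := fun x hx p e => by
    rcases le_total 0 p with hp | hp
    · have := hb x hx p 0 (-e) hp le_rfl
      rw [abs_neg, add_zero, zero_smul, add_zero, neg_smul, ← sub_eq_add_neg] at this
      rwa [abs_of_nonneg hp]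
    · have := hb x hx (-p) 0 e (by linarith) le_rfl
      rw [add_zero, zero_smul, add_zero, neg_smul] at this
      rwa [abs_of_nonpos hp, ← norm_neg, neg_sub, sub_eq_add_neg, add_comm (e • V x)]
  obtain ⟨δ, hδ, hd⟩ := exists_uniform_curveDeriv hab hA (half_pos hc)
  refine ⟨min (c / 2) δ, by positivity, fun u hu s hs t ht hst e => ?_⟩
  have h1 := hb' (u, t) ⟨hu, ht⟩ (s - t) e
  have h2 := hd u hu s hs t ht (hst.trans (min_le_right _ _))
  have h3 := norm_sub_norm_le ((s - t) • curveDeriv a b A (u, t) - e • V (u, t))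
    (A (u, s) - A (u, t) - e • V (u, t))
  rw [norm_sub_rev (_ - _) (A (u, s) - A (u, t) - e • V (u, t)),
    show A (u, s) - A (u, t) - e • V (u, t) -
    ((s - t) • curveDeriv a b A (u, t) - e • V (u, t)) =
      A (u, s) - A (u, t) - (s - t) • curveDeriv a b A (u, t) by abel] at h3
  have h4 : min (c / 2) δ * (|s - t| + |e|) ≤ c / 2 * (|s - t| + |e|) := by
    gcongr; exact min_le_left _ _
  have h5 : 0 ≤ c / 2 * |e| := by positivity
  nlinarith

/-- Separation of a curve from its parallels, for parameters on different sides of a corner, where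
the piece `[a,b]` with corner `x` and the piece `[a',b']` with corner `x'` are joined. The sign `σ`
tells which of the two pieces comes first. -/
theorem eventually_separated_corner {a b a' b' x x' σ : ℝ} (hab : a < b) (hab' : a' < b')
    (hA : ContDiffOn ℝ ∞ A (patch a b)) (hA' : ContDiffOn ℝ ∞ A (patch a' b'))
    (hV : ContinuousOn V (patch a' b')) (hx : x ∈ Icc a b) (hx' : x' ∈ Icc a' b')
    (hσ : |σ| = 1) (hs : ∀ s ∈ Icc a b, s - x = σ * |s - x|)
    (ht : ∀ t ∈ Icc a' b', t - x' = -(σ * |t - x'|))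
    (hAx : ∀ u ∈ Icc (0 : ℝ) 1, A (u, x) = A (u, x'))
    (h : ∀ u ∈ Icc (0 : ℝ) 1, ∀ p q e : ℝ, 0 ≤ p → 0 ≤ q →
      p • curveDeriv a b A (u, x) + q • curveDeriv a' b' A (u, x') + e • V (u, x') = 0 →
        p = 0 ∧ q = 0 ∧ e = 0) :
    ∀ᶠ c in 𝓝[>] (0 : ℝ), ∀ u ∈ Icc (0 : ℝ) 1, ∀ s ∈ Icc a b, ∀ t ∈ Icc a' b', |s - x| ≤ c →
      |t - x'| ≤ c → ∀ e : ℝ,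
        c * (|s - x| + |t - x'| + |e|) ≤ ‖A (u, s) - A (u, t) - e • V (u, t)‖ := by
  refine eventually_gt_zero_of_exists (fun c c' h0 hc hP u hu s hs t ht hsx htx e =>
    le_trans ?_ (hP u hu s hs t ht (hsx.trans hc) (htx.trans hc) e)) ?_
  · gcongr
  have hs1 : ContinuousOn (fun u : ℝ => curveDeriv a b A (u, x)) (Icc 0 1) :=
    (contDiffOn_curveDeriv hab hA).continuousOn.comp (f := fun u : ℝ => (u, x)) (by fun_prop)
      fun u hu => ⟨hu, hx⟩
  have hs2 : ContinuousOn (fun u : ℝ => curveDeriv a' b' A (u, x')) (Icc 0 1) :=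
    (contDiffOn_curveDeriv hab' hA').continuousOn.comp (f := fun u : ℝ => (u, x')) (by fun_prop)
      fun u hu => ⟨hu, hx'⟩
  have hs3 : ContinuousOn (fun u : ℝ => V (u, x')) (Icc 0 1) :=
    hV.comp (f := fun u : ℝ => (u, x')) (by fun_prop) fun u hu => ⟨hu, hx'⟩
  obtain ⟨c, hc, hb⟩ := isCompact_Icc.exists_cone_bound hs1 hs2 hs3 h
  obtain ⟨δ, hδ, hd⟩ := exists_uniform_curveDeriv hab hA (half_pos hc)
  obtain ⟨δ', hδ', hd'⟩ := exists_uniform_curveDeriv hab' hA' (half_pos hc)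
  have hK : IsCompact (patch a' b') := isCompact_Icc.prod isCompact_Icc
  obtain ⟨δ'', hδ'', hd''⟩ := Metric.uniformContinuousOn_iff_le.1
    (hK.uniformContinuousOn_of_continuous hV) _ (half_pos hc)
  refine ⟨min (c / 2) (min δ (min δ' δ'')), by positivity, fun u hu s hss t htt hsx htx e => ?_⟩
  have m1 := min_le_left (c / 2) (min δ (min δ' δ''))
  have m2 := (min_le_right (c / 2) (min δ (min δ' δ''))).trans (min_le_left _ _)
  have m3 := (min_le_right (c / 2) (min δ (min δ' δ''))).trans
    ((min_le_right _ _).trans (min_le_left _ _))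
  have m4 := (min_le_right (c / 2) (min δ (min δ' δ''))).trans
    ((min_le_right _ _).trans (min_le_right _ _))
  have h1 := hb u hu |s - x| |t - x'| (-(σ * e)) (abs_nonneg _) (abs_nonneg _)
  rw [abs_neg, abs_mul, hσ, one_mul] at h1
  have h2 := hd u hu s hss x hx (hsx.trans m2)
  have h3 := hd' u hu t htt x' hx' (htx.trans m3)
  have h4 : ‖V (u, t) - V (u, x')‖ ≤ c / 2 := by
    rw [← dist_eq_norm]
    refine hd'' (u, t) ⟨hu, htt⟩ (u, x') ⟨hu, hx'⟩ ?_
    rw [dist_prod_same_left, Real.dist_eq]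
    exact htx.trans m4
  have h4' : ‖e • (V (u, t) - V (u, x'))‖ ≤ c / 2 * |e| := by
    rw [norm_smul, Real.norm_eq_abs, mul_comm]; gcongr
  set X := curveDeriv a b A (u, x)
  set Y := curveDeriv a' b' A (u, x')
  -- The two sides of the corner are traversed in opposite directions, so that the linearised
  -- difference is, up to the sign `σ`, an element of the cone.
  have e1 : (s - x) • X - (t - x') • Y - e • V (u, x') =
      σ • (|s - x| • X + |t - x'| • Y + (-(σ * e)) • V (u, x')) := by
    have hσ2 : σ * σ = 1 := by rw [← abs_mul_abs_self, hσ, one_mul]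
    rw [smul_add, smul_add, smul_smul, smul_smul, smul_smul, ← hs s hss,
      show σ * |t - x'| = -(t - x') by rw [ht t htt, neg_neg, ← ht t htt],
      show σ * -(σ * e) = -e by linear_combination (-e) * hσ2, neg_smul, neg_smul]
    abel
  have e2 : ‖(s - x) • X - (t - x') • Y - e • V (u, x')‖ =
      ‖|s - x| • X + |t - x'| • Y + (-(σ * e)) • V (u, x')‖ := by
    rw [e1, norm_smul, Real.norm_eq_abs, hσ, one_mul]
  rw [← e2] at h1
  have e3 : (s - x) • X - (t - x') • Y - e • V (u, x') = (A (u, s) - A (u, t) - e • V (u, t)) -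
      (A (u, s) - A (u, x) - (s - x) • X) + (A (u, t) - A (u, x') - (t - x') • Y) +
      e • (V (u, t) - V (u, x')) := by
    rw [hAx u hu, smul_sub]; abel
  have h5 := norm_add₃_le (a := (A (u, s) - A (u, t) - e • V (u, t)) -
      (A (u, s) - A (u, x) - (s - x) • X)) (b := A (u, t) - A (u, x') - (t - x') • Y)
      (c := e • (V (u, t) - V (u, x')))
  rw [← e3] at h5
  have h6 := norm_sub_le (A (u, s) - A (u, t) - e • V (u, t)) (A (u, s) - A (u, x) - (s - x) • X)
  have h7 : min (c / 2) (min δ (min δ' δ'')) * (|s - x| + |t - x'| + |e|) ≤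
      c / 2 * (|s - x| + |t - x'| + |e|) := by gcongr
  linarith

/-- A loop with a transverse framing, throughout a homotopy. At the corners it is required that
the cone spanned by the one-sided velocities contains no non-trivial multiple of the framing and no
line. -/
structure IsFramedLoopHomotopy (A V : ℝ × ℝ → E3) : Prop where
  loop : IsLoopHomotopy A
  continuousOn : ContinuousOn V (patch 0 2)
  framing_closed : ∀ u ∈ Icc (0 : ℝ) 1, V (u, 2) = V (u, 0)
  injective : ∀ u ∈ Icc (0 : ℝ) 1, ∀ s ∈ Icc (0 : ℝ) 2, ∀ t ∈ Icc (0 : ℝ) 2,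
    A (u, s) = A (u, t) → circDist s t = 0
  left : ∀ p ∈ patch 0 1, ∀ x e : ℝ, x • curveDeriv 0 1 A p + e • V p = 0 → x = 0 ∧ e = 0
  right : ∀ p ∈ patch 1 2, ∀ x e : ℝ, x • curveDeriv 1 2 A p + e • V p = 0 → x = 0 ∧ e = 0
  corner_one : ∀ u ∈ Icc (0 : ℝ) 1, ∀ p q e : ℝ, 0 ≤ p → 0 ≤ q →
    p • curveDeriv 0 1 A (u, 1) + q • curveDeriv 1 2 A (u, 1) + e • V (u, 1) = 0 →
      p = 0 ∧ q = 0 ∧ e = 0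
  corner_zero : ∀ u ∈ Icc (0 : ℝ) 1, ∀ p q e : ℝ, 0 ≤ p → 0 ≤ q →
    p • curveDeriv 0 1 A (u, 0) + q • curveDeriv 1 2 A (u, 2) + e • V (u, 0) = 0 →
      p = 0 ∧ q = 0 ∧ e = 0

/-- A framed loop is separated from its parallels, uniformly throughout a homotopy. -/
theorem IsFramedLoopHomotopy.exists_separated (h : IsFramedLoopHomotopy A V) :
    ∃ c > 0, ∃ ε₀ > 0, ∀ u ∈ Icc (0 : ℝ) 1, ∀ s ∈ Icc (0 : ℝ) 2, ∀ t ∈ Icc (0 : ℝ) 2,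
      ∀ e : ℝ, |e| ≤ ε₀ → c * (circDist s t + |e|) ≤ ‖A (u, s) - A (u, t) - e • V (u, t)‖ := by
  have hV1 : ContinuousOn V (patch 0 1) := h.continuousOn.mono fun p hp =>
    ⟨hp.1, hp.2.1, by linarith [hp.2.2]⟩
  have hV2 : ContinuousOn V (patch 1 2) := h.continuousOn.mono fun p hp =>
    ⟨hp.1, by linarith [hp.2.1], hp.2.2⟩
  have c1 := eventually_separated_piece zero_lt_one h.loop.left hV1 h.left
  have c2 := eventually_separated_piece one_lt_two h.loop.right hV2 h.right
  have z0 : (0 : ℝ) ∈ Icc (0 : ℝ) 1 := ⟨le_rfl, zero_le_one⟩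
  have z1 : (1 : ℝ) ∈ Icc (0 : ℝ) 1 := ⟨zero_le_one, le_rfl⟩
  have y1 : (1 : ℝ) ∈ Icc (1 : ℝ) 2 := ⟨le_rfl, one_le_two⟩
  have y2 : (2 : ℝ) ∈ Icc (1 : ℝ) 2 := ⟨one_le_two, le_rfl⟩
  have sw : ∀ {X Y Z : E3}, (∀ p q e : ℝ, 0 ≤ p → 0 ≤ q → p • X + q • Y + e • Z = 0 →
      p = 0 ∧ q = 0 ∧ e = 0) → ∀ p q e : ℝ, 0 ≤ p → 0 ≤ q → p • Y + q • X + e • Z = 0 →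
      p = 0 ∧ q = 0 ∧ e = 0 := fun hX p q e hp hq h0 => by
    obtain ⟨h1, h2, h3⟩ := hX q p e hq hp (by rw [← h0]; abel)
    exact ⟨h2, h1, h3⟩
  -- The corner at `1`, in both orders of the parameters.
  have c3 := eventually_separated_corner (σ := -1) zero_lt_one one_lt_two h.loop.left h.loop.right
    hV2 z1 y1 (by simp) (fun s hs => by rw [abs_of_nonpos (by linarith [hs.2])]; ring)
    (fun t ht => by rw [abs_of_nonneg (by linarith [ht.1])]; ring) (fun _ _ => rfl) h.corner_one
  have c4 := eventually_separated_corner (σ := 1) one_lt_two zero_lt_one h.loop.right h.loop.left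
    hV1 y1 z1 (by simp) (fun s hs => by rw [abs_of_nonneg (by linarith [hs.1])]; ring)
    (fun t ht => by rw [abs_of_nonpos (by linarith [ht.2])]; ring) (fun _ _ => rfl)
    fun u hu => sw (h.corner_one u hu)
  -- The corner at `0`, which is also `2`.
  have c5 := eventually_separated_corner (σ := 1) zero_lt_one one_lt_two h.loop.left h.loop.right
    hV2 z0 y2 (by simp) (fun s hs => by rw [abs_of_nonneg (by linarith [hs.1])]; ring)
    (fun t ht => by rw [abs_of_nonpos (by linarith [ht.2])]; ring)
    (fun u hu => (h.loop.closed u hu).symm) fun u hu => by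
      rw [h.framing_closed u hu]; exact h.corner_zero u hu
  have c6 := eventually_separated_corner (σ := -1) one_lt_two zero_lt_one h.loop.right h.loop.left
    hV1 y2 z0 (by simp) (fun s hs => by rw [abs_of_nonpos (by linarith [hs.2])]; ring)
    (fun t ht => by rw [abs_of_nonneg (by linarith [ht.1])]; ring)
    (fun u hu => h.loop.closed u hu) fun u hu => sw (h.corner_zero u hu)
  have c7 : ∀ᶠ c in 𝓝[>] (0 : ℝ), 0 < c ∧ c < 1 / 2 := Ioo_mem_nhdsGT (by norm_num)
  obtain ⟨c, c1, c2, c3, c4, c5, c6, hc, hc1⟩ :=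
    (c1.and (c2.and (c3.and (c4.and (c5.and (c6.and c7)))))).exists
  -- For parameters at distance at least `c` on the circle, injectivity and compactness apply.
  set K : Set (ℝ × ℝ × ℝ) := Icc 0 1 ×ˢ ((Icc 0 2 ×ˢ Icc 0 2) ∩ {p | c ≤ circDist p.1 p.2})
    with hK
  have hKc : IsCompact K := isCompact_Icc.prod
    ((isCompact_Icc.prod isCompact_Icc).inter_right (isClosed_le continuous_const
      continuous_circDist))
  have hAc := h.loop.continuousOn
  obtain ⟨m, hm, hmb⟩ := hKc.exists_pos_le_norm (f := fun y => A (y.1, y.2.1) - A (y.1, y.2.2))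
    ((hAc.comp (f := fun y : ℝ × ℝ × ℝ => (y.1, y.2.1)) (by fun_prop)
      fun y hy => ⟨hy.1, hy.2.1.1⟩).sub
      (hAc.comp (f := fun y : ℝ × ℝ × ℝ => (y.1, y.2.2)) (by fun_prop)
        fun y hy => ⟨hy.1, hy.2.1.2⟩)) (by
    rintro ⟨u, s, t⟩ ⟨hu, ⟨hs, ht⟩, hst⟩ h0
    have := h.injective u hu s hs t ht (sub_eq_zero.1 h0)
    rw [mem_ofPred_eq] at hst
    dsimp only at hst
    linarith)
  obtain ⟨M, hM⟩ := (isCompact_Icc.prod isCompact_Icc).exists_bound_of_continuousOn h.continuousOn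
  have hM0 : 0 < |M| + 1 := by positivity
  refine ⟨min c (m / 4), by positivity, min 1 (m / (2 * (|M| + 1))), by positivity,
    fun u hu s hs t ht e he => ?_⟩
  have hcm := min_le_left c (m / 4)
  have hd0 := circDist_nonneg hs ht
  suffices hh : c * (circDist s t + |e|) ≤ ‖A (u, s) - A (u, t) - e • V (u, t)‖ ∨
      m / 4 * (circDist s t + |e|) ≤ ‖A (u, s) - A (u, t) - e • V (u, t)‖ by
    rcases hh with hh | hh <;> refine le_trans ?_ hh <;> gcongr
    exact min_le_right _ _
  rcases le_or_gt c (circDist s t) with hfar | hnear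
  · right
    have h1 := hmb (u, s, t) ⟨hu, ⟨hs, ht⟩, hfar⟩
    have h2 := hM (u, t) ⟨hu, ht⟩
    have h3 := norm_sub_norm_le (A (u, s) - A (u, t)) (e • V (u, t))
    have h4 : ‖e • V (u, t)‖ ≤ m / 2 := by
      rw [norm_smul, Real.norm_eq_abs]
      calc |e| * ‖V (u, t)‖ ≤ m / (2 * (|M| + 1)) * (|M| + 1) := by
            gcongr
            · exact he.trans (min_le_right _ _)
            · linarith [le_abs_self M]
        _ = m / 2 := by field_simp
    have h5 := circDist_le_one s t
    have h6 := he.trans (min_le_left _ _)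
    dsimp only at h1
    have h7 : m / 4 * (circDist s t + |e|) ≤ m / 4 * 2 := by gcongr; linarith
    linarith
  · left
    rcases le_or_gt |s - t| 1 with hst | hst
    · rw [circDist_of_le_one hst] at hnear ⊢
      have := abs_lt.1 hnear
      rcases le_total s 1 with s1 | s1 <;> rcases le_total t 1 with t1 | t1
      · exact c1 u hu s ⟨hs.1, s1⟩ t ⟨ht.1, t1⟩ hnear.le e
      · have k := c3 u hu s ⟨hs.1, s1⟩ t ⟨t1, ht.2⟩
          (by rw [abs_le]; constructor <;> linarith) (by rw [abs_le]; constructor <;> linarith) e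
        rwa [show |s - 1| + |t - 1| = |s - t| by
          rw [abs_of_nonpos (by linarith), abs_of_nonneg (by linarith),
            abs_of_nonpos (by linarith)]; ring] at k
      · have k := c4 u hu s ⟨s1, hs.2⟩ t ⟨ht.1, t1⟩
          (by rw [abs_le]; constructor <;> linarith) (by rw [abs_le]; constructor <;> linarith) e
        rwa [show |s - 1| + |t - 1| = |s - t| by
          rw [abs_of_nonneg (by linarith), abs_of_nonpos (by linarith),
            abs_of_nonneg (by linarith)]; ring] at k
      · exact c2 u hu s ⟨s1, hs.2⟩ t ⟨t1, ht.2⟩ hnear.le e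
    · have hd : circDist s t = 2 - |s - t| := min_eq_right (by linarith)
      rw [hd] at hnear ⊢
      rcases lt_abs.1 hst with k1 | k1
      · rw [abs_of_pos (by linarith)] at hnear ⊢
        have k := c6 u hu s ⟨by linarith [ht.1], hs.2⟩ t ⟨ht.1, by linarith [hs.2]⟩
          (by rw [abs_le]; constructor <;> linarith [hs.2, ht.1])
          (by rw [abs_le]; constructor <;> linarith [hs.2, ht.1]) e
        rwa [show |s - 2| + |t - 0| = 2 - (s - t) by
          rw [abs_of_nonpos (by linarith [hs.2]), abs_of_nonneg (by linarith [ht.1])]; ring] at k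
      · rw [abs_of_neg (by linarith)] at hnear ⊢
        have k := c5 u hu s ⟨hs.1, by linarith [ht.2]⟩ t ⟨by linarith [hs.1], ht.2⟩
          (by rw [abs_le]; constructor <;> linarith [ht.2, hs.1])
          (by rw [abs_le]; constructor <;> linarith [ht.2, hs.1]) e
        rwa [show |s - 0| + |t - 2| = 2 - -(s - t) by
          rw [abs_of_nonneg (by linarith [hs.1]), abs_of_nonpos (by linarith [ht.2])]; ring] at k

end Separation

/-! ### Lifted tangent vectors -/

theorem liftVector_add (q v w : E3) : liftVector q (v + w) = liftVector q v + liftVector q w := by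
  apply E3.ext <;> simp [liftVector] <;> ring

theorem liftVector_smul (q : E3) (x : ℝ) (v : E3) : liftVector q (x • v) = x • liftVector q v := by
  apply E3.ext <;> simp [liftVector] <;> ring

theorem liftVector_ez (q : E3) : liftVector q ez = ez := by
  apply E3.ext <;> simp [liftVector, ez]

theorem liftVector_eq_zero {q v : E3} (h : liftVector q v = 0) : v = 0 := by
  have h0 := congrArg (fun p : E3 => p 0) h
  have h1 := congrArg (fun p : E3 => p 1) h
  have h2 := congrArg (fun p : E3 => p 2) h
  have hc := Real.sin_sq_add_cos_sq (q 1)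
  simp only [liftVector, Matrix.cons_val_zero, Matrix.cons_val_one, Matrix.cons_val,
    PiLp.zero_apply, mul_eq_zero, Real.exp_ne_zero, false_or] at h0 h1 h2
  apply E3.ext
  · simp only [PiLp.zero_apply]
    linear_combination (-v 0) * hc + Real.cos (q 1) * h0 - Real.sin (q 1) * h1
  · simp only [PiLp.zero_apply]
    linear_combination (-v 1) * hc + Real.sin (q 1) * h0 + Real.cos (q 1) * h1
  · exact h2

theorem HasDerivWithinAt.coord {f : ℝ → E3} {f' : E3} {S : Set ℝ} {x : ℝ}
    (h : HasDerivWithinAt f f' S x) (i : Fin 3) :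
    HasDerivWithinAt (fun y => f y i) (f' i) S x :=
  ((EuclideanSpace.proj (𝕜 := ℝ) i).hasFDerivAt (x := f x)).comp_hasDerivWithinAt x h

/-- The velocity of a lifted curve is the lift of the velocity. -/
theorem eq_liftVector_of_coverMap_eq {κ C : ℝ → E3} {τ v : E3} {S : Set ℝ} {t : ℝ}
    (hS : UniqueDiffWithinAt ℝ S t) (ht : t ∈ S) (hκ : HasDerivWithinAt κ τ S t)
    (hC : HasDerivWithinAt C v S t) (h : ∀ s ∈ S, coverMap (κ s) = C s) :
    τ = liftVector (κ t) v := by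
  have hu : ∀ k : Fin 3, ∀ w : ℝ, HasDerivWithinAt (fun s => coverMap (κ s) k) w S t → v k = w :=
    fun k w hw => hS.eq_deriv _ ((hC.coord k).congr (fun s hs => by rw [h s hs])
      (by rw [h t ht])) hw
  have v0 := hu 0 _ (((hκ.coord 0).exp.mul (hκ.coord 1).cos).const_add (1 / 2))
  have v1 := hu 1 _ (((hκ.coord 0).exp.mul (hκ.coord 1).sin).const_add (1 / 2))
  have v2 := hu 2 _ (hκ.coord 2)
  have hc := Real.sin_sq_add_cos_sq (κ t 1)
  have he : Real.exp (κ t 0) * Real.exp (-κ t 0) = 1 := by rw [← Real.exp_add]; simp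
  apply E3.ext
  · simp only [liftVector, Matrix.cons_val_zero]
    rw [v0, v1]
    linear_combination (-(τ 0 * (Real.exp (κ t 0) * Real.exp (-κ t 0)))) * hc - τ 0 * he
  · simp only [liftVector, Matrix.cons_val_one, Matrix.cons_val_zero]
    rw [v0, v1]
    linear_combination (-(τ 1 * (Real.exp (κ t 0) * Real.exp (-κ t 0)))) * hc - τ 1 * he
  · exact v2.symm

theorem ContinuousOn.liftVector {X : Type*} [TopologicalSpace X] {S : Set X} {κ v : X → E3}
    (hκ : ContinuousOn κ S) (hv : ContinuousOn v S) :
    ContinuousOn (fun x => _root_.liftVector (κ x) (v x)) S := by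
  have k0 := E3.continuousOn_coord hκ 0
  have k1 := E3.continuousOn_coord hκ 1
  have w0 := E3.continuousOn_coord hv 0
  have w1 := E3.continuousOn_coord hv 1
  have w2 := E3.continuousOn_coord hv 2
  refine (PiLp.continuous_toLp 2 _).comp_continuousOn (continuousOn_pi.2 fun k => ?_)
  have c1 : ContinuousOn (fun x => Real.cos (κ x 1)) S := Real.continuous_cos.comp_continuousOn k1
  have s1 : ContinuousOn (fun x => Real.sin (κ x 1)) S := Real.continuous_sin.comp_continuousOn k1
  have e0 : ContinuousOn (fun x => Real.exp (-κ x 0)) S :=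
    Real.continuous_exp.comp_continuousOn k0.neg
  fin_cases k
  · exact e0.mul ((c1.mul w0).add (s1.mul w1))
  · exact e0.mul ((s1.neg.mul w0).add (c1.mul w1))
  · exact w2

/-- The derivative is non-negative where difference quotients are. -/
theorem HasDerivWithinAt.nonneg_of_mul_sub_nonneg {f : ℝ → ℝ} {f' : ℝ} {S : Set ℝ} {t : ℝ}
    (h : HasDerivWithinAt f f' S t) (hS : UniqueDiffWithinAt ℝ S t)
    (hf : ∀ x ∈ S, 0 ≤ (x - t) * (f x - f t)) : 0 ≤ f' := by
  have hne : (𝓝[S \ {t}] t).NeBot := by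
    rw [← accPt_principal_iff_nhdsWithin]; exact uniqueDiffWithinAt_iff_accPt.1 hS
  refine ge_of_tendsto (hasDerivWithinAt_iff_tendsto_slope.1 h) ?_
  filter_upwards [self_mem_nhdsWithin] with x hx
  have h0 : x - t ≠ 0 := sub_ne_zero.2 hx.2
  have := hf x hx.1
  rw [slope_def_field, show (f x - f t) / (x - t) = ((x - t) * (f x - f t)) / (x - t) ^ 2 by
    field_simp]
  positivity

namespace FramedStringLink

variable {μ : ℕ}

section Closed

variable (D : FramedStringLink μ)

theorem hasDerivWithinAt_strand (i : Fin μ) {t : ℝ} (ht : t ∈ Icc (0 : ℝ) 1) :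
    HasDerivWithinAt (D.strand i) (velocity (D.strand i) t) (Icc 0 1) t :=
  (((D.smooth_strand i).differentiableOn (by simp)) t ht).hasDerivWithinAt

theorem velocity_zero_nonneg (i : Fin μ) : 0 ≤ velocity (D.strand i) 0 1 := by
  have z0 : (0 : ℝ) ∈ Icc (0 : ℝ) 1 := ⟨le_rfl, zero_le_one⟩
  refine ((D.hasDerivWithinAt_strand i z0).coord 1).nonneg_of_mul_sub_nonneg
    (uniqueDiffOn_Icc zero_lt_one 0 z0) fun x hx => ?_
  rw [D.strand_zero]
  simpa using mul_nonneg hx.1 (D.strand_mem_unit i hx 1).1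

theorem velocity_one_nonneg (i : Fin μ) : 0 ≤ velocity (D.strand i) 1 1 := by
  have z1 : (1 : ℝ) ∈ Icc (0 : ℝ) 1 := ⟨zero_le_one, le_rfl⟩
  refine ((D.hasDerivWithinAt_strand i z1).coord 1).nonneg_of_mul_sub_nonneg
    (uniqueDiffOn_Icc zero_lt_one 1 z1) fun x hx => ?_
  rw [D.strand_one]
  simpa using mul_nonneg_of_nonpos_of_nonpos (sub_nonpos.2 hx.2)
    (sub_nonpos.2 (D.strand_mem_unit i hx 1).2)

theorem independent_velocity (i : Fin μ) {t : ℝ} (ht : t ∈ Icc (0 : ℝ) 1) {x e : ℝ}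
    (h : x • velocity (D.strand i) t + e • D.framing i t = 0) : x = 0 ∧ e = 0 :=
  LinearIndependent.pair_iff.1 (D.immersed_framed i t ht) x e h

theorem closedFraming_of_le (i : Fin μ) {t : ℝ} (h : t ≤ 1) :
    D.closedFraming i t = D.framing i t := if_pos h

theorem closedFraming_of_ge (i : Fin μ) {t : ℝ} (h : 1 ≤ t) : D.closedFraming i t = ez := by
  rcases h.eq_or_lt with rfl | h
  · rw [D.closedFraming_of_le i le_rfl, D.framing_one]
  · exact if_neg (not_le.2 h)

theorem hasDerivWithinAt_arc (i : Fin μ) (t : ℝ) :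
    HasDerivWithinAt (fun s => closingArc μ i (s - 1)) (deriv (closingArc μ i) (t - 1))
      (Icc 1 2) t :=
  ((((contDiff_closingArc i).differentiable (by simp)) (t - 1)).hasDerivAt.comp_sub_const
    t 1).hasDerivWithinAt

/-- A closing arc is immersed and horizontal. -/
theorem independent_arc (i : Fin μ) (u : ℝ) {x e : ℝ}
    (h : x • deriv (closingArc μ i) u + e • ez = 0) : x = 0 ∧ e = 0 := by
  have hd := (((contDiff_closingArc i).differentiable (by simp)) u).hasDerivAt
  have ha : HasDerivAt (arcAngle μ i) (2 * Real.pi - 2 * arcStart μ i) u := by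
    have h := ((hasDerivAt_id u).mul_const
      (2 * Real.pi - 2 * arcStart μ i)).const_add (arcStart μ i)
    rw [one_mul] at h
    exact h
  have h0 := (hd.coord 0).unique (ha.cos.const_mul (arcRadius μ i))
  have h1 := (hd.coord 1).unique ((ha.sin.const_mul (arcRadius μ i)).const_add (1 / 2))
  have h2 := (hd.coord 2).unique (hasDerivAt_const u (1 / 2 : ℝ))
  have e0 := congrArg (fun p : E3 => p 0) h
  have e1 := congrArg (fun p : E3 => p 1) h
  have e2 := congrArg (fun p : E3 => p 2) h
  simp only [PiLp.add_apply, PiLp.smul_apply, smul_eq_mul, PiLp.zero_apply, ez_apply_zero,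
    ez_apply_one, ez_apply_two, h0, h1, h2] at e0 e1 e2
  have hc := Real.sin_sq_add_cos_sq (arcAngle μ i u)
  have hx : x * (arcRadius μ i * (2 * Real.pi - 2 * arcStart μ i)) = 0 := by
    linear_combination (-(x * (arcRadius μ i * (2 * Real.pi - 2 * arcStart μ i)))) * hc -
      Real.sin (arcAngle μ i u) * e0 + Real.cos (arcAngle μ i u) * e1
  refine ⟨(mul_eq_zero.1 hx).resolve_right
    (mul_pos (arcRadius_pos i) (arcAngle_slope_pos i)).ne', by linarith⟩

end Closed

variable {F : ℝ → FramedStringLink μ} {i : Fin μ} {A : ℝ × ℝ → E3}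

/-- The lift of the framing of the closed components along a lifted family. -/
def liftedFraming (F : ℝ → FramedStringLink μ) (i : Fin μ) (A : ℝ × ℝ → E3) (p : ℝ × ℝ) : E3 :=
  liftVector (A p) ((F p.1).closedFraming i p.2)

theorem IsFamilyLift.curveDeriv_left (hA : IsFamilyLift F i A) (hF : IsSmoothFamily F) {u t : ℝ}
    (hu : u ∈ Icc (0 : ℝ) 1) (ht : t ∈ Icc (0 : ℝ) 1) :
    curveDeriv 0 1 A (u, t) = liftVector (A (u, t)) (velocity ((F u).strand i) t) :=
  eq_liftVector_of_coverMap_eq (uniqueDiffOn_Icc zero_lt_one t ht) ht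
    (hasDerivWithinAt_curveDeriv (hA.left hF) ⟨hu, ht⟩) ((F u).hasDerivWithinAt_strand i ht)
    fun s hs => by
      rw [hA.cover (u, s) ⟨hu, hs.1, by linarith [hs.2]⟩, (F u).closedStrand_of_le i hs.2]

theorem IsFamilyLift.curveDeriv_right (hA : IsFamilyLift F i A) (hF : IsSmoothFamily F) {u t : ℝ}
    (hu : u ∈ Icc (0 : ℝ) 1) (ht : t ∈ Icc (1 : ℝ) 2) :
    curveDeriv 1 2 A (u, t) = liftVector (A (u, t)) (deriv (closingArc μ i) (t - 1)) :=
  eq_liftVector_of_coverMap_eq (uniqueDiffOn_Icc one_lt_two t ht) ht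
    (hasDerivWithinAt_curveDeriv (hA.right hF) ⟨hu, ht⟩) (hasDerivWithinAt_arc i t)
    fun s hs => by
      rw [hA.cover (u, s) ⟨hu, by linarith [hs.1], hs.2⟩, (F u).closedStrand_of_ge i hs.1]

/-- At a corner of a closed component the one-sided velocities do not span a line: the
`y`-coordinate increases along the closing arc and does not decrease along the string. -/
theorem corner_independent {v w f : E3} (hv : 0 ≤ v 1) (hw : 0 < w 1) (hf : f = ez)
    (h : ∀ x e : ℝ, x • v + e • f = 0 → x = 0 ∧ e = 0) {p q e : ℝ} (hp : 0 ≤ p) (hq : 0 ≤ q)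
    (h0 : p • v + q • w + e • f = 0) : p = 0 ∧ q = 0 ∧ e = 0 := by
  have h1 := congrArg (fun p : E3 => p 1) h0
  simp only [hf, PiLp.add_apply, PiLp.smul_apply, smul_eq_mul, PiLp.zero_apply, ez_apply_one,
    mul_zero, add_zero] at h1
  have hq0 : q = 0 := by
    have hpv := mul_nonneg hp hv
    have hqw := mul_nonneg hq hw.le
    exact (mul_eq_zero.1 (show q * w 1 = 0 by linarith)).resolve_right hw.ne'
  rw [hq0, zero_smul, add_zero] at h0
  obtain ⟨h2, h3⟩ := h p e h0
  exact ⟨h2, hq0, h3⟩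

theorem IsFamilyLift.isFramedLoopHomotopy (hA : IsFamilyLift F i A) (hF : IsSmoothFamily F)
    {v : ℝ} (hv : v ∈ Icc (0 : ℝ) 1) (h : (F v).LiftClosed) :
    IsFramedLoopHomotopy A (liftedFraming F i A) := by
  have hl := hA.isLoopHomotopy hF hv h
  have z0 : (0 : ℝ) ∈ Icc (0 : ℝ) 1 := ⟨le_rfl, zero_le_one⟩
  have z1 : (1 : ℝ) ∈ Icc (0 : ℝ) 1 := ⟨zero_le_one, le_rfl⟩
  have y1 : (1 : ℝ) ∈ Icc (1 : ℝ) 2 := ⟨le_rfl, one_le_two⟩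
  have y2 : (2 : ℝ) ∈ Icc (1 : ℝ) 2 := ⟨one_le_two, le_rfl⟩
  refine ⟨hl, patch_union_continuousOn ?_ ?_, fun u hu => ?_, fun u hu s hs t ht he => ?_,
    ?_, ?_, ?_, ?_⟩
  · exact ContinuousOn.liftVector (hA.left hF).continuousOn
      ((hF.framing i).continuousOn.congr fun p hp => (F p.1).closedFraming_of_le i hp.2.2)
  · exact ContinuousOn.liftVector (hA.right hF).continuousOn
      ((continuousOn_const (c := ez)).congr fun p hp => (F p.1).closedFraming_of_ge i hp.2.1)
  · simp only [liftedFraming]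
    rw [(F u).closedFraming_of_ge i one_le_two, (F u).closedFraming_of_le i zero_le_one,
      (F u).framing_zero, hl.closed u hu]
  · have hc := congrArg coverMap he
    rw [hA.cover (u, s) ⟨hu, hs⟩, hA.cover (u, t) ⟨hu, ht⟩] at hc
    obtain ⟨-, hst⟩ := (F u).closedStrand_injective hs ht hc
    rcases hst with rfl | ⟨rfl, rfl⟩ | ⟨rfl, rfl⟩
    · exact circDist_self s
    · norm_num [circDist]
    · norm_num [circDist]
  · rintro ⟨u, t⟩ ⟨hu, ht⟩ x e h0
    rw [hA.curveDeriv_left hF hu ht, liftedFraming, ← liftVector_smul, ← liftVector_smul,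
      ← liftVector_add, (F u).closedFraming_of_le i ht.2] at h0
    exact (F u).independent_velocity i ht (liftVector_eq_zero h0)
  · rintro ⟨u, t⟩ ⟨hu, ht⟩ x e h0
    rw [hA.curveDeriv_right hF hu ht, liftedFraming, ← liftVector_smul, ← liftVector_smul,
      ← liftVector_add, (F u).closedFraming_of_ge i ht.1] at h0
    exact independent_arc i _ (liftVector_eq_zero h0)
  · intro u hu p q e hp hq h0
    rw [hA.curveDeriv_left hF hu z1, hA.curveDeriv_right hF hu y1, liftedFraming,
      ← liftVector_smul, ← liftVector_smul, ← liftVector_smul, ← liftVector_add, ← liftVector_add,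
      (F u).closedFraming_of_le i le_rfl] at h0
    exact corner_independent ((F u).velocity_one_nonneg i)
      (deriv_closingArc_pos i (Or.inl (by norm_num))) ((F u).framing_one i)
      (fun x e => (F u).independent_velocity i z1) hp hq (liftVector_eq_zero h0)
  · intro u hu p q e hp hq h0
    rw [hA.curveDeriv_left hF hu z0, hA.curveDeriv_right hF hu y2, hl.closed u hu, liftedFraming,
      ← liftVector_smul, ← liftVector_smul, ← liftVector_smul, ← liftVector_add, ← liftVector_add,
      (F u).closedFraming_of_le i zero_le_one] at h0
    exact corner_independent ((F u).velocity_zero_nonneg i)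
      (deriv_closingArc_pos i (Or.inr (by norm_num))) ((F u).framing_zero i)
      (fun x e => (F u).independent_velocity i z0) hp hq (liftVector_eq_zero h0)

end FramedStringLink

/-! ### Invariance of the equivariant linking matrix -/

theorem gaussIntegral_congr {α α' β β' : ℝ → E3} (hα : EqOn α α' (Icc 0 2))
    (hβ : EqOn β β' (Icc 0 2)) : gaussIntegral α β = gaussIntegral α' β' := by
  have hd : ∀ {γ γ' : ℝ → E3}, EqOn γ γ' (Icc 0 2) → ∀ s ∈ Ioo (0 : ℝ) 2,
      deriv γ s = deriv γ' s := fun h s hs =>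
    (h.eventuallyEq_of_mem (Icc_mem_nhds hs.1 hs.2)).deriv_eq
  have key : ∀ f g : ℝ → ℝ, (∀ s ∈ Ioo (0 : ℝ) 2, f s = g s) →
      ∫ s in (0 : ℝ)..2, f s = ∫ s in (0 : ℝ)..2, g s := fun f g h => by
    rw [intervalIntegral.integral_of_le zero_le_two, intervalIntegral.integral_of_le zero_le_two,
      integral_Ioc_eq_integral_Ioo, integral_Ioc_eq_integral_Ioo]
    exact setIntegral_congr_fun measurableSet_Ioo h
  rw [gaussIntegral_eq, gaussIntegral_eq]
  congr 1
  refine key _ _ fun s hs => key _ _ fun t ht => ?_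
  rw [hα (Ioo_subset_Icc_self hs), hβ (Ioo_subset_Icc_self ht), hd hα s hs, hd hβ t ht]

theorem IsLinkingNumber.congr {α α' β β' : ℝ → E3} {n : ℤ} (h : IsLinkingNumber α β n)
    (hα : EqOn α α' (Icc 0 2)) (hβ : EqOn β β' (Icc 0 2)) : IsLinkingNumber α' β' n := by
  have z0 : (0 : ℝ) ∈ Icc (0 : ℝ) 2 := ⟨le_rfl, zero_le_two⟩
  have z2 : (2 : ℝ) ∈ Icc (0 : ℝ) 2 := ⟨zero_le_two, le_rfl⟩
  obtain ⟨h1, h2, h3, h4⟩ := h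
  refine ⟨by rw [← hα z0, ← hα z2, h1], by rw [← hβ z0, ← hβ z2, h2], fun s hs t ht => ?_, ?_⟩
  · rw [← hα hs, ← hβ ht]; exact h3 s hs t ht
  · rw [← gaussIntegral_congr hα hβ, h4]

theorem IsFramedSelfLinkingNumber.congr {α α' v v' : ℝ → E3} {n : ℤ}
    (h : IsFramedSelfLinkingNumber α v n) (hα : EqOn α α' (Icc 0 2)) (hv : EqOn v v' (Icc 0 2)) :
    IsFramedSelfLinkingNumber α' v' n := by
  obtain ⟨ε₀, h0, h⟩ := h
  exact ⟨ε₀, h0, fun ε h1 h2 => (h ε h1 h2).congr hα fun t ht => by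
    dsimp only; rw [hα ht, hv ht]⟩

theorem ContDiffOn.liftVector {E : Type*} [NormedAddCommGroup E] [NormedSpace ℝ E] {S : Set E}
    {κ v : E → E3} (hκ : ContDiffOn ℝ ∞ κ S) (hv : ContDiffOn ℝ ∞ v S) :
    ContDiffOn ℝ ∞ (fun x => _root_.liftVector (κ x) (v x)) S := by
  have k := contDiffOn_euclidean.1 hκ
  have w := contDiffOn_euclidean.1 hv
  have e0 : ContDiffOn ℝ ∞ (fun x => Real.exp (-κ x 0)) S := (k 0).neg.exp
  rw [contDiffOn_euclidean]
  intro j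
  fin_cases j
  · exact e0.mul (((k 1).cos.mul (w 0)).add ((k 1).sin.mul (w 1)))
  · exact e0.mul (((k 1).sin.neg.mul (w 0)).add ((k 1).cos.mul (w 1)))
  · exact w 2

namespace FramedStringLink

variable {μ : ℕ} {F : ℝ → FramedStringLink μ} {A B : ℝ × ℝ → E3} {i j : Fin μ}

theorem IsFamilyLift.isLoopHomotopy_parallel (hA : IsFamilyLift F i A) (hF : IsSmoothFamily F)
    {v : ℝ} (hv : v ∈ Icc (0 : ℝ) 1) (h : (F v).LiftClosed) (ε : ℝ) :
    IsLoopHomotopy fun p => A p + ε • liftedFraming F i A p := by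
  have hf := hA.isFramedLoopHomotopy hF hv h
  refine ⟨?_, ?_, fun u hu => ?_⟩
  · exact (hA.left hF).add ((contDiffOn_const (c := ε)).smul (ContDiffOn.liftVector (hA.left hF)
      ((hF.framing i).congr fun p hp => (F p.1).closedFraming_of_le i hp.2.2)))
  · exact (hA.right hF).add ((contDiffOn_const (c := ε)).smul (ContDiffOn.liftVector (hA.right hF)
      ((contDiffOn_const (c := ez)).congr fun p hp => (F p.1).closedFraming_of_ge i hp.2.1)))
  · rw [hf.loop.closed u hu, hf.framing_closed u hu]

/-- The self-linking number of a lifted component is invariant under isotopy: small parallels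
remain disjoint from the curve during the isotopy. -/
theorem IsFamilyLift.isFramedSelfLinkingNumber (hA : IsFamilyLift F i A) (hF : IsSmoothFamily F)
    (h : (F 0).LiftClosed) {n : ℤ}
    (hn : IsFramedSelfLinkingNumber (fun t => A (0, t)) (fun t => liftedFraming F i A (0, t)) n) :
    IsFramedSelfLinkingNumber (fun t => A (1, t)) (fun t => liftedFraming F i A (1, t)) n := by
  have z0 : (0 : ℝ) ∈ Icc (0 : ℝ) 1 := ⟨le_rfl, zero_le_one⟩
  have z1 : (1 : ℝ) ∈ Icc (0 : ℝ) 1 := ⟨zero_le_one, le_rfl⟩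
  have hf := hA.isFramedLoopHomotopy hF z0 h
  obtain ⟨c, hc, ε₁, h1, hs⟩ := hf.exists_separated
  obtain ⟨ε₀, h0, hn⟩ := hn
  refine ⟨min ε₀ ε₁, by positivity, fun ε hε hlt => ?_⟩
  have hp := hA.isLoopHomotopy_parallel hF z0 h ε
  have hdis : ∀ u ∈ Icc (0 : ℝ) 1, ∀ s ∈ Icc (0 : ℝ) 2, ∀ t ∈ Icc (0 : ℝ) 2,
      A (u, s) ≠ A (u, t) + ε • liftedFraming F i A (u, t) := fun u hu s hs' t ht he => by
    have k := hs u hu s hs' t ht ε (by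
      rw [abs_of_pos hε]; exact (hlt.trans_le (min_le_right _ _)).le)
    rw [he, add_sub_cancel_left, sub_self, norm_zero] at k
    have : 0 < c * (circDist s t + |ε|) :=
      mul_pos hc (add_pos_of_nonneg_of_pos (circDist_nonneg hs' ht) (abs_pos.2 hε.ne'))
    linarith
  refine ⟨hf.loop.closed 1 z1, hp.closed 1 z1, hdis 1 z1, ?_⟩
  rw [← (hn ε hε (hlt.trans_le (min_le_left _ _))).2.2.2]
  exact (hf.loop.gaussIntegral_eq hp hdis).symm

theorem _root_.IsLoopHomotopy.deckTranslate (hB : IsLoopHomotopy B) (m : ℤ) :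
    IsLoopHomotopy fun p => _root_.deckTranslate m (B p) := by
  simp only [deckTranslate_eq_add]
  exact ⟨hB.left.add contDiffOn_const, hB.right.add contDiffOn_const, fun u hu => by
    rw [hB.closed u hu]⟩

theorem IsFamilyLift.isLinkingNumber {A : Fin μ → ℝ × ℝ → E3} (hA : ∀ i, IsFamilyLift F i (A i))
    (hF : IsSmoothFamily F) (h : (F 0).LiftClosed) {m : ℤ} (hm : ¬(i = j ∧ m = 0)) {n : ℤ}
    (hn : IsLinkingNumber (fun t => A i (0, t)) (fun t => deckTranslate m (A j (0, t))) n) :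
    IsLinkingNumber (fun t => A i (1, t)) (fun t => deckTranslate m (A j (1, t))) n := by
  have z0 : (0 : ℝ) ∈ Icc (0 : ℝ) 1 := ⟨le_rfl, zero_le_one⟩
  have z1 : (1 : ℝ) ∈ Icc (0 : ℝ) 1 := ⟨zero_le_one, le_rfl⟩
  have hi := (hA i).isLoopHomotopy hF z0 h
  have hj := ((hA j).isLoopHomotopy hF z0 h).deckTranslate m
  have hdis : ∀ u ∈ Icc (0 : ℝ) 1, ∀ s ∈ Icc (0 : ℝ) 2, ∀ t ∈ Icc (0 : ℝ) 2,
      A i (u, s) ≠ deckTranslate m (A j (u, t)) := fun u hu s hs t ht =>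
    lift_ne_deckTranslate (hF.liftClosed z0 hu h) (fun i => (hA i).slice hu)
      (fun i t ht => (hA i).cover (u, t) ⟨hu, ht⟩) hm hs ht
  exact ⟨hi.closed 1 z1, hj.closed 1 z1, hdis 1 z1, by
    rw [← hn.2.2.2]; exact (hi.gaussIntegral_eq hj hdis).symm⟩

/-- The equivariant linking matrix is an isotopy invariant. -/
theorem IsEquivariantLinkingMatrix.of_isotopic {T T' : FramedStringLink μ} (hT : T.LiftClosed)
    (hiso : T.Isotopic T') {k : ℤ} {K' : Fin μ → ℝ → E3} (hK' : T'.IsLift k K') :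
    ∃ K, T.IsLift k K ∧ ∀ L, T.IsEquivariantLinkingMatrix K L →
      T'.IsEquivariantLinkingMatrix K' L := by
  obtain ⟨F, hs, hf, h0, h1⟩ := hiso
  have hF : IsSmoothFamily F := ⟨hs, hf⟩
  have z0 : (0 : ℝ) ∈ Icc (0 : ℝ) 1 := ⟨le_rfl, zero_le_one⟩
  have z1 : (1 : ℝ) ∈ Icc (0 : ℝ) 1 := ⟨zero_le_one, le_rfl⟩
  have y0 : (0 : ℝ) ∈ Icc (0 : ℝ) 2 := ⟨le_rfl, zero_le_two⟩
  have hcl : (F 0).LiftClosed := hT.congr fun i t ht => ((h0 i t ht).1).symm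
  have hstart : ∀ i, ∃ A, IsFamilyLift F i A ∧ ∀ u ∈ Icc (0 : ℝ) 1, A (u, 0) = K' i 0 := fun i =>
    hF.exists_familyLift i (by rw [(hK' i).2.1 0 y0, closedStrand_zero])
  choose A hA hA0 using hstart
  have hA1 : ∀ i, EqOn (fun t => A i (1, t)) (K' i) (Icc 0 2) := fun i =>
    eqOn_of_coverMap_eq isPreconnected_Icc ((hA i).slice z1) (hK' i).1
      (fun t ht => by
        rw [(hA i).cover (1, t) ⟨z1, ht⟩, (hK' i).2.1 t ht,
          closedStrand_congr (fun i t ht => (h1 i t ht).1) i ht.1]) y0 (hA0 i 1 z1)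
  have hcf : ∀ {S S' : FramedStringLink μ},
      (∀ i, ∀ t ∈ Icc (0 : ℝ) 1, S.framing i t = S'.framing i t) → ∀ i, ∀ t ∈ Icc (0 : ℝ) 2,
      S.closedFraming i t = S'.closedFraming i t := fun h i t ht => by
    unfold closedFraming
    split_ifs with hle
    · exact h i t ⟨ht.1, hle⟩
    · rfl
  refine ⟨fun i t => A i (0, t),
    fun i => ⟨(hA i).slice z0, fun t ht => ?_, ?_⟩, fun L hL i j m => ⟨fun hm => ?_, ?_⟩⟩
  · rw [(hA i).cover (0, t) ⟨z0, ht⟩, closedStrand_congr (fun i t ht => (h0 i t ht).1) i ht.1]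
  · dsimp only; rw [hA0 i 0 z0]; exact (hK' i).2.2
  · exact (IsFamilyLift.isLinkingNumber hA hF hcl hm ((hL i j m).1 hm)).congr (hA1 i)
      fun t ht => by dsimp only; rw [← hA1 j ht]
  · rintro ⟨rfl, rfl⟩
    have hn := (hL i i 0).2 ⟨rfl, rfl⟩
    refine ((hA i).isFramedSelfLinkingNumber hF hcl
      (hn.congr (fun _ _ => rfl) fun t ht => ?_)).congr (hA1 i) fun t ht => ?_
    · simp only [liftedFraming]
      rw [hcf (fun i t ht => (h0 i t ht).2) i t ht]
    · simp only [liftedFraming]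
      rw [← hA1 i ht, hcf (fun i t ht => (h1 i t ht).2) i t ht]

end FramedStringLink

/-! ### Sheets of the cover and intersections with the disc -/

/-- The number of the sheet `2πk ≤ θ < 2π(k + 1)` of the cover that contains a point. -/
def sheet (q : E3) : ℤ := ⌊q 1 / (2 * Real.pi)⌋

theorem sheet_eq_iff {q : E3} {k : ℤ} :
    sheet q = k ↔ 2 * Real.pi * (k : ℝ) ≤ q 1 ∧ q 1 < 2 * Real.pi * ((k : ℝ) + 1) := by
  have h : 0 < 2 * Real.pi := by positivity
  rw [sheet, Int.floor_eq_iff, le_div_iff₀ h, div_lt_iff₀ h, mul_comm, mul_comm _ (2 * Real.pi)]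

theorem sheet_deckTranslate (m : ℤ) (q : E3) : sheet (deckTranslate m q) = sheet q + m := by
  have h : 2 * Real.pi ≠ 0 := by positivity
  rw [sheet, sheet, deckTranslate_apply_one, add_div, mul_div_cancel_left₀ _ h,
    Int.floor_add_intCast]

/-- The sheet is locally constant away from the lifts of the half-plane that contains the disc. -/
theorem eventually_sheet_eq {X : Type*} [TopologicalSpace X] {S : Set X} {κ : X → E3} {x : X}
    (hκ : ContinuousWithinAt κ S x) (h : ∀ k : ℤ, κ x 1 ≠ 2 * Real.pi * (k : ℝ)) :
    ∀ᶠ y in 𝓝[S] x, sheet (κ y) = sheet (κ x) := by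
  obtain ⟨h1, h2⟩ := sheet_eq_iff.1 (rfl : sheet (κ x) = sheet (κ x))
  have hc : Tendsto (fun y => κ y 1) (𝓝[S] x) (𝓝 (κ x 1)) :=
    ((EuclideanSpace.proj (𝕜 := ℝ) (1 : Fin 3)).continuous.tendsto (κ x)).comp hκ
  filter_upwards [hc.eventually_const_lt (lt_of_le_of_ne h1 (h _).symm),
    hc.eventually_lt_const h2] with y k1 k2 using sheet_eq_iff.2 ⟨k1.le, k2⟩

/-- A function that is locally constant off a finite set, with the same value on both sides of each
point of the set, is constant. -/
theorem eq_of_eventually_const_off_finite {S : Set ℝ} (hS : S.Finite) {a b : ℝ} (hab : a < b)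
    {φ : ℝ → ℤ} (h : ∀ t ∈ Icc a b, ∃ c : ℤ, ∀ᶠ s in 𝓝[Icc a b \ S] t, φ s = c) {s t : ℝ}
    (hs : s ∈ Icc a b \ S) (ht : t ∈ Icc a b \ S) : φ s = φ t := by
  choose! c hc using h
  have hne : ∀ x ∈ Icc a b, (𝓝[Icc a b \ S] x).NeBot := fun x hx => by
    have h1 : AccPt x (𝓟 (Icc a b)) :=
      uniqueDiffWithinAt_iff_accPt.1 (uniqueDiffOn_Icc hab x hx)
    rw [accPt_principal_iff_nhdsWithin] at h1
    have h2 : (S \ {x})ᶜ ∈ 𝓝 x :=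
      (hS.subset sdiff_subset).isClosed.isOpen_compl.mem_nhds (by simp)
    refine NeBot.mono h1 (le_inf inf_le_left (le_principal_iff.2 ?_))
    filter_upwards [self_mem_nhdsWithin, mem_nhdsWithin_of_mem_nhds h2] with y hy hy'
    exact ⟨hy.1, fun hyS => hy' ⟨hyS, hy.2⟩⟩
  have hcont : ContinuousOn c (Icc a b) := by
    intro x hx
    have hev := eventually_eventually_nhdsWithin.2 (hc x hx)
    have h3 : ∀ᶠ y in 𝓝 x, ∀ᶠ s in 𝓝[Icc a b \ S] y, φ s = c x := by
      have := hc x hx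
      rw [eventually_nhdsWithin_iff] at this
      filter_upwards [eventually_eventually_nhds.2 this] with y hy
      exact eventually_nhdsWithin_iff.2 hy
    refine tendsto_nhds_of_eventually_eq ?_
    filter_upwards [mem_nhdsWithin_of_mem_nhds h3, self_mem_nhdsWithin] with y hy hyI
    have := hne y hyI
    obtain ⟨z, h4, h5⟩ := (hy.and (hc y hyI)).exists
    exact h5.symm.trans h4
  have hv : ∀ x ∈ Icc a b \ S, φ x = c x := fun x hx => (hc x hx.1).self_of_nhdsWithin hx
  rw [hv s hs, hv t ht, isPreconnected_Icc.constant hcont hs.1 ht.1]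

namespace FramedStringLink

variable {μ : ℕ} {D : FramedStringLink μ} {i : Fin μ} {κ : ℝ → E3}

theorem mem_meridionalDisc_iff {t : ℝ} (ht : t ∈ Icc (0 : ℝ) 1)
    (h : coverMap (κ t) = D.strand i t) :
    D.strand i t ∈ meridionalDisc ↔ ∃ k : ℤ, κ t 1 = 2 * Real.pi * (k : ℝ) := by
  have h0 : D.strand i t 0 = 1 / 2 + Real.exp (κ t 0) * Real.cos (κ t 1) := by rw [← h]; rfl
  have h1 : D.strand i t 1 = 1 / 2 + Real.exp (κ t 0) * Real.sin (κ t 1) := by rw [← h]; rfl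
  have he := Real.exp_pos (κ t 0)
  have hsc := Real.sin_sq_add_cos_sq (κ t 1)
  constructor
  · rintro ⟨d0, -, d1, -⟩
    have hsin : Real.sin (κ t 1) = 0 :=
      (mul_eq_zero.1 (show Real.exp (κ t 0) * Real.sin (κ t 1) = 0 by linarith)).resolve_left he.ne'
    have hcos : 0 < Real.cos (κ t 1) := pos_of_mul_pos_right (by linarith) he.le
    rw [hsin] at hsc
    have : Real.cos (κ t 1) = 1 := by nlinarith
    obtain ⟨k, hk⟩ := (Real.cos_eq_one_iff _).1 this
    exact ⟨k, by rw [← hk]; ring⟩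
  · rintro ⟨k, hk⟩
    have hc1 : Real.cos (κ t 1) = 1 := (Real.cos_eq_one_iff _).2 ⟨k, by rw [hk]; ring⟩
    have hs0 : Real.sin (κ t 1) = 0 := by
      rw [hc1] at hsc; nlinarith
    rw [hc1] at h0
    rw [hs0] at h1
    have hout := (D.mem_solidTorus i t ht).2
    refine ⟨?_, (D.strand_mem_unit i ht 0).2, by linarith, D.strand_mem_unit i ht 2⟩
    by_contra hlt
    exact hout ⟨by linarith, not_le.1 hlt, by linarith, by linarith⟩

theorem finsum_disc_eq {S : Finset ℝ}
    (hS : ∀ t, t ∈ S ↔ t ∈ Icc (0 : ℝ) 1 ∧ D.strand i t ∈ meridionalDisc) {a b : ℝ} (ha : 0 ≤ a)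
    (hb : b ≤ 1) : D.discIntersection i a b =
      ∑ t ∈ S with a < t ∧ t < b, (SignType.sign (velocity (D.strand i) t 1) : ℤ) := by
  have h : {t ∈ Ioo a b | D.strand i t ∈ meridionalDisc} = ↑{t ∈ S | a < t ∧ t < b} := by
    ext t
    simp only [Finset.coe_filter, hS]
    exact ⟨fun h => ⟨⟨⟨by linarith [h.1.1], by linarith [h.1.2]⟩, h.2⟩, h.1⟩,
      fun h => ⟨h.2, h.1.2⟩⟩
  rw [discIntersection, h, finsum_mem_coe_finset]

theorem mem_Ioo_of_mem_disc {t : ℝ} (ht : t ∈ Icc (0 : ℝ) 1)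
    (h : D.strand i t ∈ meridionalDisc) : t ∈ Ioo (0 : ℝ) 1 := by
  have h1 : D.strand i t 1 = 1 / 2 := h.2.2.1
  refine ⟨lt_of_le_of_ne ht.1 ?_, lt_of_le_of_ne ht.2 ?_⟩
  · rintro rfl
    rw [D.strand_zero] at h1
    norm_num at h1
  · rintro rfl
    rw [D.strand_one] at h1
    norm_num at h1

theorem IsDiagram.discIntersection_add (hD : D.IsDiagram) {s : ℝ} (hs : s ∈ Icc (0 : ℝ) 1)
    (h : D.strand i s ∉ meridionalDisc) :
    D.discIntersection i 0 s + D.discIntersection i s 1 = D.discIntersection i 0 1 := by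
  classical
  have hS : ∀ t, t ∈ (hD.finite_disc i).toFinset ↔
    t ∈ Icc (0 : ℝ) 1 ∧ D.strand i t ∈ meridionalDisc := fun t => by simp
  rw [finsum_disc_eq hS le_rfl hs.2, finsum_disc_eq hS hs.1 le_rfl, finsum_disc_eq hS le_rfl le_rfl,
    ← Finset.sum_union]
  · congr 1
    ext t
    simp only [Finset.mem_union, Finset.mem_filter, hS]
    constructor
    · rintro (⟨h1, h2⟩ | ⟨h1, h2⟩)
      · exact ⟨h1, h2.1, by linarith [hs.2]⟩
      · exact ⟨h1, by linarith [hs.1], h2.2⟩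
    · rintro ⟨h1, h2⟩
      rcases lt_trichotomy t s with hl | rfl | hl
      · exact Or.inl ⟨h1, h2.1, hl⟩
      · exact absurd h1.2 h
      · exact Or.inr ⟨h1, hl, h2.2⟩
  · rw [Finset.disjoint_filter]
    intro t _ h1 h2
    linarith [h1.2, h2.1]

/-- Near a lift of the half-plane that contains the disc, the sheet is determined by the sign of
`y - 1/2`. -/
theorem sheet_of_sin_pos {q : E3} {n : ℤ} (h : |q 1 - 2 * Real.pi * (n : ℝ)| < Real.pi)
    (hs : 0 < Real.sin (q 1)) : sheet q = n := by
  have hp := Real.pi_pos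
  rw [abs_lt] at h
  rw [sheet_eq_iff]
  refine ⟨?_, by linarith [h.2]⟩
  by_contra hlt
  have e : Real.sin (q 1) = Real.sin (q 1 - 2 * Real.pi * (n : ℝ)) := by
    rw [show 2 * Real.pi * (n : ℝ) = n * (2 * Real.pi) by ring, Real.sin_sub_int_mul_two_pi]
  rw [e] at hs
  exact absurd hs (Real.sin_neg_of_neg_of_neg_pi_lt (by linarith) h.1).le.not_gt

theorem sheet_of_sin_neg {q : E3} {n : ℤ} (h : |q 1 - 2 * Real.pi * (n : ℝ)| < Real.pi)
    (hs : Real.sin (q 1) < 0) : sheet q = n - 1 := by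
  have hp := Real.pi_pos
  rw [abs_lt] at h
  rw [sheet_eq_iff]
  push_cast
  refine ⟨by linarith [h.1], ?_⟩
  by_contra hlt
  have e : Real.sin (q 1) = Real.sin (q 1 - 2 * Real.pi * (n : ℝ)) := by
    rw [show 2 * Real.pi * (n : ℝ) = n * (2 * Real.pi) by ring, Real.sin_sub_int_mul_two_pi]
  rw [e] at hs
  exact absurd hs (Real.sin_nonneg_of_nonneg_of_le_pi (by linarith) h.2.le).not_gt

/-- The sheet changes by the algebraic intersection with the meridional disc. -/
theorem IsDiagram.sheet_eq (hD : D.IsDiagram) (hκ : ContinuousOn κ (Icc 0 2))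
    (hc : ∀ t ∈ Icc (0 : ℝ) 2, coverMap (κ t) = D.closedStrand i t) {s : ℝ}
    (hs : s ∈ Icc (0 : ℝ) 1) (h : D.strand i s ∉ meridionalDisc) :
    sheet (κ s) = sheet (κ 0) + D.discIntersection i 0 s := by
  classical
  have hmem : ∀ {t : ℝ}, t ∈ Icc (0 : ℝ) 1 → t ∈ Icc (0 : ℝ) 2 := fun ht =>
    ⟨ht.1, by linarith [ht.2]⟩
  have hc' : ∀ t ∈ Icc (0 : ℝ) 1, coverMap (κ t) = D.strand i t := fun t ht => by
    rw [hc t (hmem ht), D.closedStrand_of_le i ht.2]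
  set S := (hD.finite_disc i).toFinset with hSdef
  have hS : ∀ t, t ∈ S ↔ t ∈ Icc (0 : ℝ) 1 ∧ D.strand i t ∈ meridionalDisc := fun t => by
    simp [hSdef]
  set σ : ℝ → ℤ := fun t => (SignType.sign (velocity (D.strand i) t 1) : ℤ) with hσ
  have hdi : ∀ t ∈ Icc (0 : ℝ) 1, D.discIntersection i 0 t = ∑ x ∈ S with 0 < x ∧ x < t, σ x :=
    fun t ht => finsum_disc_eq hS le_rfl ht.2
  have z0 : (0 : ℝ) ∈ Icc (0 : ℝ) 1 := ⟨le_rfl, zero_le_one⟩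
  have h0S : (0 : ℝ) ∉ S := fun h0 =>
    lt_irrefl _ (mem_Ioo_of_mem_disc z0 ((hS 0).1 h0).2).1
  have h00 : D.discIntersection i 0 0 = 0 := by
    rw [hdi 0 z0]
    refine Finset.sum_eq_zero fun x hx => ?_
    have := (Finset.mem_filter.1 hx).2
    linarith [this.1, this.2]
  -- Points of `S` other than `t` do not accumulate at `t`.
  have hgap : ∀ t : ℝ, ∀ᶠ y in 𝓝 t, ∀ x ∈ S, x ≠ t → (x < y ↔ x < t) := fun t => by
    rw [Filter.eventually_all_finset]
    intro x _
    by_cases hx : x = t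
    · exact Eventually.of_forall fun y hy => absurd hx hy
    rcases lt_or_gt_of_ne hx with hl | hl
    · filter_upwards [lt_mem_nhds hl] with y hy _ using iff_of_true hy hl
    · filter_upwards [gt_mem_nhds hl] with y hy _ using iff_of_false hy.not_gt hl.not_gt
  have key := eq_of_eventually_const_off_finite (S := ↑S) S.finite_toSet zero_lt_one
    (φ := fun t => sheet (κ t) - D.discIntersection i 0 t) (fun t ht => ?_)
    (s := s) (t := 0) ⟨hs, fun hsS => h ((hS s).1 hsS).2⟩ ⟨z0, h0S⟩
  · simp only [h00] at key
    linarith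
  have hκt : ContinuousWithinAt κ (Icc 0 1 \ S) t :=
    (hκ t (hmem ht)).mono fun x hx => hmem hx.1
  by_cases htS : t ∈ S
  · obtain ⟨-, hdisc⟩ := (hS t).1 htS
    obtain ⟨n, hn⟩ := (mem_meridionalDisc_iff ht (hc' t ht)).1 hdisc
    have htI := mem_Ioo_of_mem_disc ht hdisc
    have hnear : ∀ᶠ y in 𝓝[Icc 0 1 \ S] t, |κ y 1 - 2 * Real.pi * (n : ℝ)| < Real.pi := by
      have ht1 : Tendsto (fun y => κ y 1) (𝓝[Icc 0 1 \ S] t) (𝓝 (κ t 1)) :=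
        ((EuclideanSpace.proj (𝕜 := ℝ) (1 : Fin 3)).continuous.tendsto (κ t)).comp hκt
      rw [hn] at ht1
      have := (ht1.sub_const (2 * Real.pi * (n : ℝ))).abs
      rw [sub_self, abs_zero] at this
      exact this.eventually_lt_const Real.pi_pos
    have hd : HasDerivAt (fun y => D.strand i y 1) (velocity (D.strand i) t 1) t :=
      ((D.hasDerivWithinAt_strand i ht).coord 1).hasDerivAt (Icc_mem_nhds htI.1 htI.2)
    have hy : D.strand i t 1 = 1 / 2 := hdisc.2.2.1
    have hsin : ∀ y ∈ Icc (0 : ℝ) 1,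
        D.strand i y 1 - 1 / 2 = Real.exp (κ y 0) * Real.sin (κ y 1) := fun y hy => by
      rw [← hc' y hy]; simp
    have hne := hD.transverse_disc i t ht hdisc
    have hslope := hasDerivAt_iff_tendsto_slope.1 hd
    -- Near `t` the sign of `y - 1/2` is that of its derivative times the increment of the
    -- parameter.
    have hsgn : ∀ᶠ y in 𝓝[Icc 0 1 \ S] t,
        0 < velocity (D.strand i) t 1 * ((y - t) * Real.sin (κ y 1)) := by
      have h1 : ∀ᶠ y in 𝓝[≠] t, 0 < velocity (D.strand i) t 1 *
          slope (fun y => D.strand i y 1) t y :=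
        (hslope.const_mul _).eventually_const_lt (mul_self_pos.2 hne)
      have h2 : 𝓝[Icc 0 1 \ S] t ≤ 𝓝[≠] t := nhdsWithin_mono _ fun y hy hyt => by
        rw [mem_singleton_iff] at hyt
        exact hy.2 (hyt ▸ htS)
      filter_upwards [h2 h1, self_mem_nhdsWithin] with y hy1 hy2
      have hyt : y - t ≠ 0 := sub_ne_zero.2 fun e => hy2.2 (e ▸ htS)
      rw [slope_def_field, hy, hsin y hy2.1] at hy1
      have hpos : 0 < (y - t) ^ 2 * Real.exp (-κ y 0) := by positivity
      have := mul_pos hy1 hpos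
      have he : Real.exp (κ y 0) * Real.exp (-κ y 0) = 1 := by rw [← Real.exp_add]; simp
      have e2 : velocity (D.strand i) t 1 * (Real.exp (κ y 0) * Real.sin (κ y 1) / (y - t)) *
          ((y - t) ^ 2 * Real.exp (-κ y 0)) =
          velocity (D.strand i) t 1 * ((y - t) * Real.sin (κ y 1)) *
            (Real.exp (κ y 0) * Real.exp (-κ y 0)) := by
        field_simp
      rw [e2, he, mul_one] at this
      exact this
    set f₀ := ∑ x ∈ S with 0 < x ∧ x < t, σ x with hf₀
    have hleft : ∀ᶠ y in 𝓝 t, y < t → ∑ x ∈ S with 0 < x ∧ x < y, σ x = f₀ := by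
      filter_upwards [hgap t] with y hy hlt
      refine Finset.sum_congr (Finset.filter_congr fun x hx => ?_) fun _ _ => rfl
      by_cases hxt : x = t
      · rw [hxt]; exact ⟨fun h => absurd h.2 hlt.not_gt, fun h => absurd h.2 (lt_irrefl _)⟩
      · rw [hy x hx hxt]
    have hright : ∀ᶠ y in 𝓝 t, t < y → ∑ x ∈ S with 0 < x ∧ x < y, σ x = f₀ + σ t := by
      filter_upwards [hgap t] with y hy hlt
      rw [hf₀, add_comm, ← Finset.sum_insert (by simp)]
      refine Finset.sum_congr ?_ fun _ _ => rfl
      ext x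
      simp only [Finset.mem_insert, Finset.mem_filter]
      by_cases hxt : x = t
      · rw [hxt]; exact ⟨fun _ => Or.inl rfl, fun _ => ⟨htS, htI.1, hlt⟩⟩
      · constructor
        · rintro ⟨h1, h2, h3⟩; exact Or.inr ⟨h1, h2, (hy x h1 hxt).1 h3⟩
        · rintro (h1 | ⟨h1, h2, h3⟩)
          · exact absurd h1 hxt
          · exact ⟨h1, h2, (hy x h1 hxt).2 h3⟩
    rcases lt_or_gt_of_ne hne with hv | hv
    · have hσt : σ t = -1 := by simp [hσ, sign_neg hv]
      refine ⟨n - f₀, ?_⟩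
      filter_upwards [hnear, hsgn, mem_nhdsWithin_of_mem_nhds hleft,
        mem_nhdsWithin_of_mem_nhds hright, self_mem_nhdsWithin] with y y1 y2 y3 y4 y5
      have y6 : (y - t) * Real.sin (κ y 1) < 0 := by
        by_contra hge
        exact absurd y2 (mul_nonpos_of_nonpos_of_nonneg hv.le (not_lt.1 hge)).not_gt
      rw [hdi y y5.1]
      rcases lt_or_gt_of_ne (show y ≠ t from fun e => y5.2 (e ▸ htS)) with hl | hl
      · rw [y3 hl, sheet_of_sin_pos y1 (pos_of_mul_neg_right y6 (by linarith))]
      · rw [y4 hl, hσt, sheet_of_sin_neg y1 (neg_of_mul_neg_right y6 (by linarith))]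
        ring
    · have hσt : σ t = 1 := by simp [hσ, sign_pos hv]
      refine ⟨n - 1 - f₀, ?_⟩
      filter_upwards [hnear, hsgn, mem_nhdsWithin_of_mem_nhds hleft,
        mem_nhdsWithin_of_mem_nhds hright, self_mem_nhdsWithin] with y y1 y2 y3 y4 y5
      have y6 : 0 < (y - t) * Real.sin (κ y 1) := pos_of_mul_pos_right y2 hv.le
      rw [hdi y y5.1]
      rcases lt_or_gt_of_ne (show y ≠ t from fun e => y5.2 (e ▸ htS)) with hl | hl
      · rw [y3 hl, sheet_of_sin_neg y1 (neg_of_mul_pos_right y6 (by linarith))]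
      · rw [y4 hl, hσt, sheet_of_sin_pos y1 (pos_of_mul_pos_right y6 (by linarith))]
        ring
  · refine ⟨sheet (κ t) - D.discIntersection i 0 t, ?_⟩
    have hsh := eventually_sheet_eq hκt fun k hk =>
      htS ((hS t).2 ⟨ht, (mem_meridionalDisc_iff ht (hc' t ht)).2 ⟨k, hk⟩⟩)
    filter_upwards [hsh, mem_nhdsWithin_of_mem_nhds (hgap t), self_mem_nhdsWithin] with y y1 y2 y3
    rw [y1, hdi y y3.1, hdi t ht]
    congr 1
    refine Finset.sum_congr (Finset.filter_congr fun x hx => ?_) fun _ _ => rfl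
    rw [y2 x hx fun e => htS (e ▸ hx)]

/-- A lifted closing arc stays in one sheet. -/
theorem sheet_arc (hκ : ContinuousOn κ (Icc 0 2))
    (hc : ∀ t ∈ Icc (0 : ℝ) 2, coverMap (κ t) = D.closedStrand i t) :
    sheet (κ 2) = sheet (κ 1) := by
  refine eq_of_eventually_const_off_finite (S := ∅) finite_empty one_lt_two
    (φ := fun t => sheet (κ t)) (fun t ht => ⟨sheet (κ t), ?_⟩) (by norm_num) (by norm_num)
  refine eventually_sheet_eq ((hκ t ⟨by linarith [ht.1], ht.2⟩).mono fun x hx =>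
    ⟨by linarith [hx.1.1], hx.1.2⟩) fun k hk => ?_
  have hct := hc t ⟨by linarith [ht.1], ht.2⟩
  rw [D.closedStrand_of_ge i ht.1] at hct
  have hk' : κ t 1 = k * (2 * Real.pi) := by rw [hk]; ring
  have h0 : closingArc μ i (t - 1) 0 = 1 / 2 + Real.exp (κ t 0) := by
    rw [← hct, coverMap_apply_zero, (Real.cos_eq_one_iff _).2 ⟨k, hk'.symm⟩, mul_one]
  have h1 : closingArc μ i (t - 1) 1 = 1 / 2 := by
    rw [← hct, coverMap_apply_one, hk', ← zero_add ((k : ℝ) * _), Real.sin_add_int_mul_two_pi]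
    simp
  have := closingArc_neg_of_eq_half i ⟨by linarith [ht.1], by linarith [ht.2]⟩ h1
  linarith [Real.exp_pos (κ t 0)]

theorem strand_one_notMem_disc (D : FramedStringLink μ) (i : Fin μ) :
    D.strand i 1 ∉ meridionalDisc := fun h =>
  lt_irrefl _ (mem_Ioo_of_mem_disc (D := D) ⟨zero_le_one, le_rfl⟩ h).2

/-- The lifts of the components of the closure of a diagram are closed if and only if the components
have algebraic intersection zero with the meridional disc. -/
theorem IsDiagram.liftClosed_iff (hD : D.IsDiagram) :
    D.LiftClosed ↔ ∀ i, D.discIntersection i 0 1 = 0 := by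
  have z1 : (1 : ℝ) ∈ Icc (0 : ℝ) 1 := ⟨zero_le_one, le_rfl⟩
  constructor
  · intro h i
    obtain ⟨K, hK⟩ := D.exists_isLift 0
    have h1 := hD.sheet_eq (hK i).1 (hK i).2.1 z1 (D.strand_one_notMem_disc i)
    rw [← sheet_arc (hK i).1 (hK i).2.1, h i (K i) (hK i).1 (hK i).2.1] at h1
    linarith
  · intro h i κ hκ hc
    have h1 := hD.sheet_eq hκ hc z1 (D.strand_one_notMem_disc i)
    rw [← sheet_arc hκ hc, h i, add_zero] at h1
    obtain ⟨m, hm⟩ := coverMap_eq_iff.1 (show coverMap (κ 0) = coverMap (κ 2) by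
      rw [hc 0 ⟨le_rfl, zero_le_two⟩, hc 2 ⟨zero_le_two, le_rfl⟩, closedStrand_two_eq_zero])
    rw [hm, sheet_deckTranslate] at h1
    rw [hm, show m = 0 by linarith, deckTranslate_zero]

end FramedStringLink

namespace FramedStringLink

variable {μ : ℕ} {D : FramedStringLink μ}

/-! ### Double points of a diagram and of its lift -/

theorem doublePoints_swap {a b : Fin μ × ℝ} (h : (a, b) ∈ D.doublePoints) :
    (b, a) ∈ D.doublePoints :=
  ⟨h.2.1, h.1, h.2.2.1.symm, h.2.2.2.1.symm, h.2.2.2.2.symm⟩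

theorem strand_y_eq_zero {i : Fin μ} {t : ℝ} (ht : t ∈ Icc (0 : ℝ) 1)
    (h : D.strand i t 1 = 0) : t = 0 := by
  by_contra h0
  have hpos := lt_of_le_of_ne ht.1 (Ne.symm h0)
  rcases ht.2.eq_or_lt with rfl | h1
  · rw [D.strand_one] at h
    norm_num at h
  · exact (D.strand_y_mem_Ioo i ⟨hpos, h1⟩).1.ne' h

theorem strand_y_eq_one {i : Fin μ} {t : ℝ} (ht : t ∈ Icc (0 : ℝ) 1)
    (h : D.strand i t 1 = 1) : t = 1 := by
  by_contra h0
  have hlt := lt_of_le_of_ne ht.2 h0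
  rcases ht.1.eq_or_lt with rfl | h1
  · rw [D.strand_zero] at h
    norm_num at h
  · exact (D.strand_y_mem_Ioo i ⟨h1, hlt⟩).2.ne h

/-- Double points are interior points of the strings. -/
theorem doublePoints_mem_Ioo {a b : Fin μ × ℝ} (h : (a, b) ∈ D.doublePoints) :
    a.2 ∈ Ioo (0 : ℝ) 1 := by
  obtain ⟨i, s⟩ := a
  obtain ⟨j, t⟩ := b
  obtain ⟨hs, ht, hne, h0 : D.strand i s 0 = D.strand j t 0,
    h1 : D.strand i s 1 = D.strand j t 1⟩ := h
  refine ⟨lt_of_le_of_ne hs.1 ?_, lt_of_le_of_ne hs.2 ?_⟩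
  · rintro rfl
    have e1 : D.strand i 0 1 = 0 := by rw [D.strand_zero]; simp
    obtain rfl := strand_y_eq_zero ht (h1.symm.trans e1)
    rw [D.strand_zero, D.strand_zero] at h0
    obtain rfl : i = j := endX_injective (by simpa using h0)
    exact hne rfl
  · rintro rfl
    have e1 : D.strand i 1 1 = 1 := by rw [D.strand_one]; simp
    obtain rfl := strand_y_eq_one ht (h1.symm.trans e1)
    rw [D.strand_one, D.strand_one] at h0
    obtain rfl : i = j := endX_injective (by simpa using h0)
    exact hne rfl

theorem IsDiagram.finite_pairs (hD : D.IsDiagram) (i j : Fin μ) :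
    {c : ℝ × ℝ | ((i, c.1), (j, c.2)) ∈ D.doublePoints}.Finite :=
  hD.finite_doublePoints.preimage (f := fun c : ℝ × ℝ => ((i, c.1), (j, c.2)))
    fun c _ c' _ h => by
      simp only [Prod.mk.injEq, true_and] at h
      exact Prod.ext h.1 h.2

/-- The double points of the projections of the strings `i` and `j`, as ordered pairs of
parameters. -/
def IsDiagram.pairs (hD : D.IsDiagram) (i j : Fin μ) : Finset (ℝ × ℝ) :=
  (hD.finite_pairs i j).toFinset

theorem IsDiagram.mem_pairs (hD : D.IsDiagram) {i j : Fin μ} {c : ℝ × ℝ} :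
    c ∈ hD.pairs i j ↔ ((i, c.1), (j, c.2)) ∈ D.doublePoints := by
  simp [IsDiagram.pairs]

/-- The double points with exponent `m`. -/
def IsDiagram.levelPairs (hD : D.IsDiagram) (i j : Fin μ) (m : ℤ) : Finset (ℝ × ℝ) :=
  {c ∈ hD.pairs i j | D.crossingExponent i j c = m}

theorem IsDiagram.mem_levelPairs (hD : D.IsDiagram) {i j : Fin μ} {m : ℤ} {c : ℝ × ℝ} :
    c ∈ hD.levelPairs i j m ↔
      ((i, c.1), (j, c.2)) ∈ D.doublePoints ∧ D.crossingExponent i j c = m := by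
  rw [levelPairs, Finset.mem_filter, hD.mem_pairs]

section Lift

variable {K : Fin μ → ℝ → E3} {k : ℤ}

theorem IsLift.isFamilyLift (hK : D.IsLift k K) (i : Fin μ) :
    IsFamilyLift (fun _ => D) i fun p => K i p.2 :=
  ⟨(hK i).1.comp continuousOn_snd fun _ hp => hp.2, fun p hp => (hK i).2.1 p.2 hp.2⟩

theorem IsLift.isSmoothLoop (hK : D.IsLift k K) (hcl : D.LiftClosed) (i : Fin μ) :
    IsSmoothLoop (K i) :=
  ((hK.isFamilyLift i).isLoopHomotopy (isSmoothFamily_const D) (v := 0) ⟨le_rfl, zero_le_one⟩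
    hcl).isSmoothLoop (u := 0) ⟨le_rfl, zero_le_one⟩

theorem IsLift.deriv_eq (hK : D.IsLift k K) (i : Fin μ) {s : ℝ} (hs : s ∈ Ioo (0 : ℝ) 1) :
    deriv (K i) s = liftVector (K i s) (velocity (D.strand i) s) := by
  have hF := isSmoothFamily_const D
  have z0 : (0 : ℝ) ∈ Icc (0 : ℝ) 1 := ⟨le_rfl, zero_le_one⟩
  rw [← (hK.isFamilyLift i).curveDeriv_left hF z0 (Ioo_subset_Icc_self hs)]
  exact deriv_eq_curveDeriv ((hK.isFamilyLift i).left hF) z0 hs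

theorem IsLift.sheet_zero (hK : D.IsLift k K) (i : Fin μ) : sheet (K i 0) = k :=
  sheet_eq_iff.2 ⟨(hK i).2.2.1.le, (hK i).2.2.2⟩

theorem IsLift.coverMap_strand (hK : D.IsLift k K) (i : Fin μ) {s : ℝ} (hs : s ∈ Icc (0 : ℝ) 1) :
    coverMap (K i s) = D.strand i s := by
  rw [(hK i).2.1 s ⟨hs.1, by linarith [hs.2]⟩, D.closedStrand_of_le i hs.2]

/-- Over a double point the sheets differ by the exponent. -/
theorem IsLift.doublePoint (hK : D.IsLift k K) (hD : D.IsDiagram) (hcl : D.LiftClosed)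
    {i j : Fin μ} {s t : ℝ} (h : ((i, s), (j, t)) ∈ D.doublePoints) :
    K i s 0 = K j t 0 ∧
      K i s 1 = K j t 1 + 2 * Real.pi * (D.crossingExponent i j (s, t) : ℝ) := by
  have hs := h.1
  have ht := h.2.1
  dsimp only at hs ht
  have h0 : D.strand i s 0 = D.strand j t 0 := h.2.2.2.1
  have h1 : D.strand i s 1 = D.strand j t 1 := h.2.2.2.2
  rw [← hK.coverMap_strand i hs, ← hK.coverMap_strand j ht] at h0 h1
  obtain ⟨e0, m, hm⟩ := coverMap_planar_eq h0.symm h1.symm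
  refine ⟨e0.symm, ?_⟩
  have hds : D.strand i s ∉ meridionalDisc := hD.double_notMem_disc _ h
  have hdt : D.strand j t ∉ meridionalDisc := hD.double_notMem_disc _ (doublePoints_swap h)
  have s1 := hD.sheet_eq (hK i).1 (hK i).2.1 hs hds
  have s2 := hD.sheet_eq (hK j).1 (hK j).2.1 ht hdt
  have s3 := hD.discIntersection_add ht hdt
  rw [hD.liftClosed_iff.1 hcl j] at s3
  rw [hK.sheet_zero] at s1 s2
  have s4 : sheet (K i s) = sheet (K j t) + m := by
    rw [← sheet_deckTranslate]
    unfold sheet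
    rw [hm, deckTranslate_apply_one]
  rw [hm, show m = D.crossingExponent i j (s, t) by
    simp only [crossingExponent]; linarith]

/-- The planar double points of a lift and a translated lift. -/
theorem IsLift.planar_eq (hK : D.IsLift k K) (hD : D.IsDiagram) (hcl : D.LiftClosed)
    {i j : Fin μ} {m : ℤ} {s t : ℝ} (hs : s ∈ Icc (0 : ℝ) 2) (ht : t ∈ Icc (0 : ℝ) 2)
    (h0 : K i s 0 = K j t 0) (h1 : K i s 1 = K j t 1 + 2 * Real.pi * (m : ℝ)) :
    (s, t) ∈ hD.levelPairs i j m ∨ i = j ∧ m = 0 ∧ circDist s t = 0 := by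
  have h2π : 2 * Real.pi ≠ 0 := by positivity
  have hclosed : ∀ i, K i 2 = K i 0 := fun i => hcl i (K i) (hK i).1 (hK i).2.1
  have c0 : D.closedStrand i s 0 = D.closedStrand j t 0 := by
    rw [← (hK i).2.1 s hs, ← (hK j).2.1 t ht, ← coverMap_deckTranslate m (K j t),
      coverMap_apply_zero, coverMap_apply_zero, deckTranslate_apply_zero, deckTranslate_apply_one,
      h0, h1]
  have c1 : D.closedStrand i s 1 = D.closedStrand j t 1 := by
    rw [← (hK i).2.1 s hs, ← (hK j).2.1 t ht, ← coverMap_deckTranslate m (K j t),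
      coverMap_apply_one, coverMap_apply_one, deckTranslate_apply_zero, deckTranslate_apply_one,
      h0, h1]
  have hm0 : K i s = K j t → m = 0 := fun e => by
    rw [e] at h1
    have := (mul_eq_zero.1 (show 2 * Real.pi * (m : ℝ) = 0 by linarith)).resolve_left h2π
    exact_mod_cast this
  by_cases hsI : s ∈ Ioo (1 : ℝ) 2
  · obtain ⟨rfl, rfl⟩ := D.eq_of_arc_planar hsI ht c0 c1
    exact Or.inr ⟨rfl, hm0 rfl, circDist_self s⟩
  by_cases htI : t ∈ Ioo (1 : ℝ) 2
  · obtain ⟨rfl, rfl⟩ := D.eq_of_arc_planar htI hs c0.symm c1.symm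
    exact Or.inr ⟨rfl, hm0 rfl, circDist_self t⟩
  obtain ⟨s', hs', es, cs⟩ := D.exists_strand_param i hs hsI
  obtain ⟨t', ht', et, ct⟩ := D.exists_strand_param j ht htI
  rw [es, et] at c0 c1
  by_cases hne : (i, s') = (j, t')
  · right
    obtain ⟨rfl, rfl⟩ := Prod.mk.inj hne
    refine ⟨rfl, ?_⟩
    rcases cs with rfl | ⟨rfl, rfl⟩ <;> rcases ct with rfl | ⟨rfl, h⟩
    · exact ⟨hm0 rfl, circDist_self _⟩
    · subst h; exact ⟨hm0 (hclosed i).symm, by norm_num [circDist]⟩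
    · exact ⟨hm0 (hclosed i), by norm_num [circDist]⟩
    · exact ⟨hm0 rfl, circDist_self _⟩
  · left
    have hdp : ((i, s'), (j, t')) ∈ D.doublePoints := ⟨hs', ht', hne, c0, c1⟩
    have hsI' := doublePoints_mem_Ioo hdp
    have htI' := doublePoints_mem_Ioo (doublePoints_swap hdp)
    have e1 : s' = s := cs.resolve_right fun h => hsI'.1.ne' h.2
    have e2 : t' = t := ct.resolve_right fun h => htI'.1.ne' h.2
    subst e1 e2
    refine hD.mem_levelPairs.2 ⟨hdp, ?_⟩
    have h3 := (hK.doublePoint hD hcl hdp).2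
    rw [h1, add_right_inj, mul_right_inj' h2π] at h3
    exact_mod_cast h3.symm

/-- The covering preserves the orientation of planar frames. -/
theorem IsLift.planarDet_eq (hK : D.IsLift k K) (hD : D.IsDiagram) (hcl : D.LiftClosed)
    {i j : Fin μ} {s t : ℝ} (h : ((i, s), (j, t)) ∈ D.doublePoints) :
    planarDet (deriv (K i) s) (deriv (K j) t) =
      Real.exp (-K i s 0) ^ 2 * D.projDet (i, s) (j, t) := by
  obtain ⟨h0, h1⟩ := hK.doublePoint hD hcl h
  rw [hK.deriv_eq i (doublePoints_mem_Ioo h), hK.deriv_eq j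
    (doublePoints_mem_Ioo (doublePoints_swap h))]
  set e := D.crossingExponent i j (s, t)
  have h1' : K i s 1 = K j t 1 + (e : ℝ) * (2 * Real.pi) := by rw [h1]; ring
  have hc : Real.cos (K i s 1) = Real.cos (K j t 1) := by
    rw [h1', Real.cos_add_int_mul_two_pi]
  have hs : Real.sin (K i s 1) = Real.sin (K j t 1) := by
    rw [h1', Real.sin_add_int_mul_two_pi]
  have hsc := Real.sin_sq_add_cos_sq (K i s 1)
  simp only [planarDet, projDet, liftVector, Matrix.cons_val_zero, Matrix.cons_val_one, ← h0,
    ← hc, ← hs]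
  linear_combination (Real.exp (-K i s 0) ^ 2 * (velocity (D.strand i) s 0 *
    velocity (D.strand j) t 1 - velocity (D.strand i) s 1 * velocity (D.strand j) t 0)) * hsc

theorem IsLift.sign_eq (hK : D.IsLift k K) (hD : D.IsDiagram) (hcl : D.LiftClosed)
    {i j : Fin μ} {s t : ℝ} (h : ((i, s), (j, t)) ∈ D.doublePoints) :
    (SignType.sign ((K i s 2 - K j t 2) * planarDet (deriv (K i) s) (deriv (K j) t)) : ℤ) =
      D.crossingSign i j (s, t) := by
  have z : ∀ (i : Fin μ) (s : ℝ), s ∈ Icc (0 : ℝ) 1 → K i s 2 = D.strand i s 2 := fun i s hs => by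
    rw [← hK.coverMap_strand i hs, coverMap_apply_two]
  rw [hK.planarDet_eq hD hcl h, z i s h.1, z j t h.2.1, crossingSign, mul_left_comm, sign_mul,
    sign_pos (by positivity), one_mul]

theorem deriv_deckTranslate (m : ℤ) (β : ℝ → E3) (t : ℝ) :
    deriv (fun t => deckTranslate m (β t)) t = deriv β t := by
  simp only [deckTranslate_eq_add, deriv_add_const]

/-- The sum of the signs of the double points with exponent `m`. -/
def IsDiagram.signSum (hD : D.IsDiagram) (i j : Fin μ) (m : ℤ) : ℤ :=
  ∑ c ∈ hD.levelPairs i j m, D.crossingSign i j c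

/-- The linking number of a lift and a translated lift is half a sum of crossing signs. -/
theorem IsLift.gaussIntegral_eq (hK : D.IsLift k K) (hD : D.IsDiagram) (hcl : D.LiftClosed)
    {i j : Fin μ} {m : ℤ} (hm : ¬(i = j ∧ m = 0)) :
    gaussIntegral (K i) (fun t => deckTranslate m (K j t)) = 1 / 2 * (hD.signSum i j m : ℝ) ∧
      Even (hD.signSum i j m) := by
  have hi := hK.isSmoothLoop hcl i
  have hj : IsSmoothLoop fun t => deckTranslate m (K j t) := by
    simp only [deckTranslate_eq_add]; exact (hK.isSmoothLoop hcl j).add_const _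
  have hdis : ∀ s ∈ Icc (0 : ℝ) 2, ∀ t ∈ Icc (0 : ℝ) 2, K i s ≠ deckTranslate m (K j t) :=
    fun s hs t ht => lift_ne_deckTranslate hcl (fun i => (hK i).1) (fun i => (hK i).2.1) hm hs ht
  have hC : ∀ s ∈ Icc (0 : ℝ) 2, ∀ t ∈ Icc (0 : ℝ) 2, K i s 0 = deckTranslate m (K j t) 0 →
      K i s 1 = deckTranslate m (K j t) 1 → (s, t) ∈ hD.levelPairs i j m :=
    fun s hs t ht h0 h1 => (hK.planar_eq hD hcl hs ht h0 h1).resolve_right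
      fun h => hm ⟨h.1, h.2.1⟩
  have hC' : ∀ c ∈ hD.levelPairs i j m, c ∈ Ioo (0 : ℝ) 1 ×ˢ Ioo (0 : ℝ) 1 ∧
      K i c.1 0 = deckTranslate m (K j c.2) 0 ∧ K i c.1 1 = deckTranslate m (K j c.2) 1 ∧
      planarDet (deriv (K i) c.1) (deriv (fun t => deckTranslate m (K j t)) c.2) ≠ 0 := by
    intro c hc
    obtain ⟨h, rfl⟩ := hD.mem_levelPairs.1 hc
    obtain ⟨e0, e1⟩ := hK.doublePoint hD hcl h
    refine ⟨⟨doublePoints_mem_Ioo h, doublePoints_mem_Ioo (doublePoints_swap h)⟩, e0, e1, ?_⟩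
    rw [deriv_deckTranslate, hK.planarDet_eq hD hcl h]
    exact mul_ne_zero (by positivity) (hD.transverse _ h)
  have hsum : ∀ c ∈ hD.levelPairs i j m, (SignType.sign ((K i c.1 2 - deckTranslate m (K j c.2) 2) *
      planarDet (deriv (K i) c.1) (deriv (fun t => deckTranslate m (K j t)) c.2)) : ℤ) =
      D.crossingSign i j c := fun c hc => by
    rw [deriv_deckTranslate, deckTranslate_apply_two,
      hK.sign_eq hD hcl (hD.mem_levelPairs.1 hc).1]
  have key := hi.gaussIntegral_eq_sum_sign hj hdis _ hC hC'
  have hev := hi.even_sum_sign hj hdis _ hC hC'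
  rw [Finset.sum_congr rfl hsum] at hev
  refine ⟨?_, hev⟩
  rw [key, IsDiagram.signSum]
  push_cast
  congr 1
  refine Finset.sum_congr rfl fun c hc => ?_
  rw [← hsum c hc]
  norm_cast

/-- Changing strands at the second passage instead of the first reverses the sign of the exponent,
because the algebraic intersection of the whole string is zero. -/
theorem IsDiagram.crossingExponent_swap (hD : D.IsDiagram) (hcl : D.LiftClosed) {i : Fin μ}
    {s t : ℝ} (h : ((i, s), (i, t)) ∈ D.doublePoints) :
    D.crossingExponent i i (t, s) = -D.crossingExponent i i (s, t) := by
  have s1 := hD.discIntersection_add h.1 (hD.double_notMem_disc _ h)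
  have s2 := hD.discIntersection_add h.2.1 (hD.double_notMem_disc _ (doublePoints_swap h))
  simp only [hD.liftClosed_iff.1 hcl] at s1 s2
  simp only [crossingExponent]
  linarith

theorem crossingSign_swap (D : FramedStringLink μ) (i : Fin μ) (s t : ℝ) :
    D.crossingSign i i (t, s) = D.crossingSign i i (s, t) := by
  simp only [crossingSign, projDet]
  congr 2
  ring

/-- The self-crossings with exponent `m`, where the first passage comes first. -/
def IsDiagram.upperPairs (hD : D.IsDiagram) (i : Fin μ) (m : ℤ) : Finset (ℝ × ℝ) :=
  {c ∈ hD.levelPairs i i m | c.1 < c.2}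

/-- Double points of a string are counted by the order of the two passages. -/
theorem IsDiagram.signSum_self (hD : D.IsDiagram) (hcl : D.LiftClosed) (i : Fin μ) (m : ℤ) :
    hD.signSum i i m = ∑ c ∈ hD.upperPairs i m, D.crossingSign i i c +
      ∑ c ∈ hD.upperPairs i (-m), D.crossingSign i i c := by
  rw [signSum, ← Finset.sum_filter_add_sum_filter_not _ (fun c : ℝ × ℝ => c.1 < c.2)]
  congr 1
  refine Finset.sum_nbij' Prod.swap Prod.swap ?_ ?_ (fun _ _ => rfl) (fun _ _ => rfl) ?_
  · intro c hc
    obtain ⟨hc, hlt⟩ := Finset.mem_filter.1 hc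
    obtain ⟨h, hm⟩ := hD.mem_levelPairs.1 hc
    have hne : c.1 ≠ c.2 := fun e => h.2.2.1 (by rw [e])
    refine Finset.mem_filter.2 ⟨hD.mem_levelPairs.2 ⟨doublePoints_swap h, ?_⟩,
      lt_of_le_of_ne (not_lt.1 hlt) hne.symm⟩
    rw [Prod.swap, hD.crossingExponent_swap hcl h, ← hm]
  · intro c hc
    obtain ⟨hc, hlt⟩ := Finset.mem_filter.1 hc
    obtain ⟨h, hm⟩ := hD.mem_levelPairs.1 hc
    refine Finset.mem_filter.2 ⟨hD.mem_levelPairs.2 ⟨doublePoints_swap h, ?_⟩, hlt.not_gt⟩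
    rw [Prod.swap, hD.crossingExponent_swap hcl h, hm, neg_neg]
  · rintro ⟨s, t⟩ _
    exact (D.crossingSign_swap i s t).symm

theorem IsDiagram.closedFraming_eq (hD : D.IsDiagram) (i : Fin μ) {t : ℝ} (ht : 0 ≤ t) :
    D.closedFraming i t = ez := by
  rcases le_total t 1 with h1 | h1
  · rw [D.closedFraming_of_le i h1, hD.blackboard i t ⟨ht, h1⟩]
  · exact D.closedFraming_of_ge i h1

/-- The planar double points of a lifted component are the self-crossings with exponent zero. That the
projection is immersed, also at the corners, follows from the separation from vertical parallels. -/
theorem IsLift.hasPlanarDoublePoints (hK : D.IsLift k K) (hD : D.IsDiagram) (hcl : D.LiftClosed)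
    (i : Fin μ) : HasPlanarDoublePoints (K i) (hD.levelPairs i i 0) := by
  have z0 : (0 : ℝ) ∈ Icc (0 : ℝ) 1 := ⟨le_rfl, zero_le_one⟩
  have hex : ∀ c ∈ hD.levelPairs i i 0, K i c.1 0 = K i c.2 0 ∧ K i c.1 1 = K i c.2 1 :=
    fun c hc => by
      obtain ⟨h, hm⟩ := hD.mem_levelPairs.1 hc
      have := hK.doublePoint hD hcl h
      rw [hm] at this
      simpa using this
  refine ⟨?_, fun s hs t ht h0 h1 => ?_, fun c hc => ?_, fun c hc => (hex c hc).1,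
    fun c hc => (hex c hc).2, fun c hc h2 => ?_, fun c hc => ?_⟩
  · -- In the bound for the parallels, take the height `K i s 2 - K i t 2`, which cancels the
    -- vertical part of the difference.
    obtain ⟨c, hc, ε₀, hε₀, hsep⟩ := ((hK.isFamilyLift i).isFramedLoopHomotopy
      (isSmoothFamily_const D) z0 hcl).exists_separated
    obtain ⟨Λ, hΛ, hlip, -⟩ := (hK.isSmoothLoop hcl i).exists_self_bounds
    refine ⟨c, hc, ε₀ / Λ, by positivity, fun s hs t ht hst => ?_⟩
    have hd0 := circDist_nonneg hs ht
    have he : |K i s 2 - K i t 2| ≤ ε₀ := by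
      have h1 := hlip s hs t ht
      have h2 : |(K i s - K i t) 2| ≤ ‖K i s - K i t‖ := PiLp.norm_apply_le (K i s - K i t) 2
      rw [PiLp.sub_apply] at h2
      calc _ ≤ Λ * circDist s t := h2.trans h1
        _ ≤ Λ * (ε₀ / Λ) := by gcongr
        _ = ε₀ := by field_simp
    have h := hsep 0 z0 s hs t ht _ he
    have hV : liftedFraming (fun _ => D) i (fun p => K i p.2) (0, t) = ez := by
      simp only [liftedFraming]
      rw [hD.closedFraming_eq i ht.1, liftVector_ez]
    rw [hV] at h
    dsimp only at h
    have h' : c * circDist s t ≤ ‖K i s - K i t - (K i s 2 - K i t 2) • ez‖ :=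
      le_trans (by gcongr; linarith [abs_nonneg (K i s 2 - K i t 2)]) h
    have h'' := pow_le_pow_left₀ (by positivity) h' 2
    rw [norm_sq_eq_coords] at h''
    simpa [diffCoord, ez] using h''
  · rcases hK.planar_eq hD hcl (m := 0) hs ht h0 (by simpa using h1) with h | h
    · exact Or.inl h
    · exact Or.inr h.2.2
  · obtain ⟨h, -⟩ := hD.mem_levelPairs.1 hc
    exact ⟨doublePoints_mem_Ioo h, doublePoints_mem_Ioo (doublePoints_swap h)⟩
  · obtain ⟨h, -⟩ := hD.mem_levelPairs.1 hc
    have e := E3.ext (hex c hc).1 (hex c hc).2 h2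
    have e' := congrArg coverMap e
    rw [hK.coverMap_strand i h.1, hK.coverMap_strand i h.2.1] at e'
    exact h.2.2.1 (by rw [(D.injective i i c.1 h.1 c.2 h.2.1 e').2])
  · obtain ⟨h, -⟩ := hD.mem_levelPairs.1 hc
    rw [hK.planarDet_eq hD hcl h]
    exact mul_ne_zero (by positivity) (hD.transverse _ h)

/-- The self-linking number of a lift is half the sum of the signs of the double points of its
projection. -/
theorem IsLift.isFramedSelfLinkingNumber (hK : D.IsLift k K) (hD : D.IsDiagram)
    (hcl : D.LiftClosed) (i : Fin μ) {n : ℤ} (hn : hD.signSum i i 0 = 2 * n) :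
    IsFramedSelfLinkingNumber (K i) (fun t => liftVector (K i t) (D.closedFraming i t)) n := by
  have hα := hK.isSmoothLoop hcl i
  have h := hK.hasPlanarDoublePoints hD hcl i
  have hev : ∀ᶠ ε in 𝓝[>] (0 : ℝ), 0 < ε ∧
      ∀ c ∈ hD.levelPairs i i 0, ε < |K i c.1 2 - K i c.2 2| := by
    refine (eventually_mem_nhdsWithin (s := Ioi (0 : ℝ))).and
      ((Filter.eventually_all_finset _).2 fun c hc => ?_)
    have : Ioo (0 : ℝ) |K i c.1 2 - K i c.2 2| ∈ 𝓝[>] (0 : ℝ) :=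
      Ioo_mem_nhdsGT (abs_pos.2 (sub_ne_zero.2 (h.ne_two c hc)))
    filter_upwards [this] with ε hε using hε.2
  obtain ⟨ε₀, hε₀, hlt⟩ := hev.exists
  refine ⟨ε₀, hε₀, fun ε hε hεlt => ?_⟩
  have hp : EqOn (fun t => K i t + ε • ez)
      (fun t => K i t + ε • liftVector (K i t) (D.closedFraming i t)) (Icc 0 2) := fun t ht => by
    dsimp only
    rw [hD.closedFraming_eq i ht.1, liftVector_ez]
  have hεC : ∀ c ∈ hD.levelPairs i i 0, ε < |K i c.1 2 - K i c.2 2| := fun c hc =>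
    hεlt.trans (hlt c hc)
  refine IsLinkingNumber.congr (α := K i) ⟨hα.closed, by rw [hα.closed],
    h.ne_parallel hα hε.ne' (by rwa [abs_of_pos hε]), ?_⟩ (fun _ _ => rfl) hp
  rw [h.gaussIntegral_parallel hα hε hεC]
  have hs : ∑ c ∈ hD.levelPairs i i 0, (SignType.sign ((K i c.1 2 - K i c.2 2) *
      planarDet (deriv (K i) c.1) (deriv (K i) c.2)) : ℝ) = (hD.signSum i i 0 : ℝ) := by
    rw [IsDiagram.signSum]
    push_cast
    refine Finset.sum_congr rfl fun c hc => ?_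
    rw [← hK.sign_eq hD hcl (hD.mem_levelPairs.1 hc).1]
    norm_cast
  rw [hs, hn]
  push_cast
  ring

end Lift

end FramedStringLink

namespace FramedStringLink

variable {μ : ℕ} {D T T' : FramedStringLink μ}

/-! ### The winding matrix as the equivariant linking matrix -/

theorem laurent_coeff_C_mul_T {R : Type*} [Semiring R] (a : R) (n m : ℤ) :
    (LaurentPolynomial.C a * LaurentPolynomial.T n).coeff m = if n = m then a else 0 := by
  rw [← LaurentPolynomial.single_eq_C_mul_T, AddMonoidAlgebra.coeff_single, Finsupp.single_apply]

theorem IsDiagram.crossings_eq_of_ne (hD : D.IsDiagram) {i j : Fin μ} (hij : i ≠ j) :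
    D.crossings i j = ↑(hD.pairs i j) := by
  ext c
  rw [Finset.mem_coe, hD.mem_pairs]
  exact ⟨fun h => ⟨h.1, h.2.1, fun e => hij (Prod.mk.inj e).1, h.2.2.2⟩,
    fun h => ⟨h.1, h.2.1, fun e => absurd e hij, h.2.2.2⟩⟩

theorem IsDiagram.crossings_self (hD : D.IsDiagram) (i : Fin μ) :
    D.crossings i i = ↑{c ∈ hD.pairs i i | c.1 < c.2} := by
  ext c
  rw [Finset.mem_coe, Finset.mem_filter, hD.mem_pairs]
  exact ⟨fun h => ⟨⟨h.1, h.2.1, fun e => (h.2.2.1 rfl).ne (Prod.mk.inj e).2, h.2.2.2⟩, h.2.2.1 rfl⟩,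
    fun h => ⟨h.1.1, h.1.2.1, fun _ => h.2, h.1.2.2.2⟩⟩

/-- In `hD.signSum i i m` a self-crossing appears for both orders of the passages, with opposite
exponents; these are the two terms of the diagonal entry. -/
theorem IsDiagram.windingMatrix_coeff (hD : D.IsDiagram) (hcl : D.LiftClosed) (i j : Fin μ)
    (m : ℤ) : (D.windingMatrix i j).coeff m = 1 / 2 * (hD.signSum i j m : ℚ) := by
  by_cases hij : i = j
  · subst hij
    have hu : ∀ n, hD.upperPairs i n =
        {c ∈ {c ∈ hD.pairs i i | c.1 < c.2} | D.crossingExponent i i c = n} := fun n => by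
      rw [upperPairs, levelPairs, Finset.filter_comm]
    simp only [windingMatrix, Matrix.of_apply, ne_eq, not_true_eq_false, if_false]
    rw [hD.crossings_self]
    generalize ({c ∈ hD.pairs i i | c.1 < c.2} : Finset (ℝ × ℝ)) = P at hu ⊢
    rw [finsum_mem_coe_finset, AddMonoidAlgebra.coeff_sum,
      Finsupp.finsetSum_apply, hD.signSum_self hcl, hu, hu, Finset.sum_filter, Finset.sum_filter]
    push_cast
    rw [← Finset.sum_add_distrib, Finset.mul_sum]
    refine Finset.sum_congr rfl fun c _ => ?_
    rw [mul_add, AddMonoidAlgebra.coeff_add, Finsupp.add_apply, laurent_coeff_C_mul_T,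
      laurent_coeff_C_mul_T, mul_add]
    simp only [neg_eq_iff_eq_neg]
    congr 1 <;> split_ifs <;> simp
  · simp only [windingMatrix, Matrix.of_apply, ne_eq, hij, not_false_eq_true, if_true]
    rw [hD.crossings_eq_of_ne hij, finsum_mem_coe_finset, AddMonoidAlgebra.coeff_sum,
      Finsupp.finsetSum_apply, signSum, levelPairs, Finset.sum_filter]
    push_cast
    rw [Finset.mul_sum]
    refine Finset.sum_congr rfl fun c _ => ?_
    rw [laurent_coeff_C_mul_T]
    split_ifs <;> simp

theorem IsDiagram.even_signSum (hD : D.IsDiagram) (hcl : D.LiftClosed) (i j : Fin μ) (m : ℤ) :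
    Even (hD.signSum i j m) := by
  by_cases h : i = j ∧ m = 0
  · obtain ⟨rfl, rfl⟩ := h
    rw [hD.signSum_self hcl, neg_zero]
    exact ⟨_, rfl⟩
  · obtain ⟨K, hK⟩ := D.exists_isLift 0
    exact (hK.gaussIntegral_eq hD hcl h).2

/-- The winding matrix of a diagram is its equivariant linking matrix. -/
theorem IsLift.exists_matrix {K : Fin μ → ℝ → E3} {k : ℤ} (hK : D.IsLift k K) (hD : D.IsDiagram)
    (hcl : D.LiftClosed) :
    ∃ L : Matrix (Fin μ) (Fin μ) (LaurentPolynomial ℤ), D.IsEquivariantLinkingMatrix K L ∧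
      ∀ (i j : Fin μ) (m : ℤ), (D.windingMatrix i j).coeff m = (((L i j).coeff m : ℤ) : ℚ) := by
  classical
  have hex : ∀ i j m, ∃ n : ℤ, hD.signSum i j m = 2 * n := fun i j m => by
    obtain ⟨n, hn⟩ := hD.even_signSum hcl i j m
    exact ⟨n, by rw [hn]; ring⟩
  choose n hn using hex
  have h0 : ∀ i j m, m ∉ (hD.pairs i j).image (D.crossingExponent i j) → n i j m = 0 :=
    fun i j m hm => by
      have : hD.signSum i j m = 0 := by
        refine Finset.sum_eq_zero fun c hc => absurd ?_ hm
        obtain ⟨h1, h2⟩ := Finset.mem_filter.1 hc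
        exact Finset.mem_image.2 ⟨c, h1, h2⟩
      have := hn i j m
      omega
  refine ⟨Matrix.of fun i j => ∑ m ∈ (hD.pairs i j).image (D.crossingExponent i j),
    LaurentPolynomial.C (n i j m) * LaurentPolynomial.T m, ?_⟩
  have hcoeff : ∀ i j m, (Matrix.of (fun i j => ∑ m ∈ (hD.pairs i j).image (D.crossingExponent i j),
      LaurentPolynomial.C (n i j m) * LaurentPolynomial.T m) i j).coeff m = n i j m :=
    fun i j m => by
      rw [Matrix.of_apply, AddMonoidAlgebra.coeff_sum, Finsupp.finsetSum_apply]
      simp only [laurent_coeff_C_mul_T, Finset.sum_ite_eq']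
      split_ifs with h
      · rfl
      · exact (h0 i j m h).symm
  refine ⟨fun i j m => ⟨fun hm => ?_, ?_⟩, fun i j m => ?_⟩
  · rw [hcoeff]
    have hl := hK.isSmoothLoop hcl
    refine ⟨(hl i).closed, by dsimp only; rw [(hl j).closed], fun s hs t ht =>
      lift_ne_deckTranslate hcl (fun i => (hK i).1) (fun i => (hK i).2.1) hm hs ht, ?_⟩
    rw [(hK.gaussIntegral_eq hD hcl hm).1, hn]
    push_cast
    ring
  · rintro ⟨rfl, rfl⟩
    rw [hcoeff]
    exact hK.isFramedSelfLinkingNumber hD hcl i (hn i i 0)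
  · rw [hcoeff, hD.windingMatrix_coeff hcl, hn]
    push_cast
    ring

/-- The equivariant linking matrix of a lift is unique. -/
theorem IsEquivariantLinkingMatrix.unique {K : Fin μ → ℝ → E3}
    {L L' : Matrix (Fin μ) (Fin μ) (LaurentPolynomial ℤ)} (h : T.IsEquivariantLinkingMatrix K L)
    (h' : T.IsEquivariantLinkingMatrix K L') (i j : Fin μ) (m : ℤ) :
    (L i j).coeff m = (L' i j).coeff m := by
  by_cases hm : i = j ∧ m = 0
  · obtain ⟨ε₁, p1, h1⟩ := (h i j m).2 hm
    obtain ⟨ε₂, p2, h2⟩ := (h' i j m).2 hm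
    have hlt : min ε₁ ε₂ / 2 < min ε₁ ε₂ := half_lt_self (lt_min p1 p2)
    have e1 := (h1 (min ε₁ ε₂ / 2) (half_pos (lt_min p1 p2))
      (hlt.trans_le (min_le_left _ _))).2.2.2
    have e2 := (h2 (min ε₁ ε₂ / 2) (half_pos (lt_min p1 p2))
      (hlt.trans_le (min_le_right _ _))).2.2.2
    exact_mod_cast e1.symm.trans e2
  · exact_mod_cast ((h i j m).1 hm).2.2.2.symm.trans ((h' i j m).1 hm).2.2.2

theorem Isotopic.liftClosed_iff (h : T.Isotopic T') : T.LiftClosed ↔ T'.LiftClosed := by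
  obtain ⟨F, hs, hf, h0, h1⟩ := h
  have hF : IsSmoothFamily F := ⟨hs, hf⟩
  have z0 : (0 : ℝ) ∈ Icc (0 : ℝ) 1 := ⟨le_rfl, zero_le_one⟩
  have z1 : (1 : ℝ) ∈ Icc (0 : ℝ) 1 := ⟨zero_le_one, le_rfl⟩
  constructor
  · intro hT
    exact (hF.liftClosed z0 z1 (hT.congr fun i t ht => ((h0 i t ht).1).symm)).congr
      fun i t ht => (h1 i t ht).1
  · intro hT
    exact (hF.liftClosed z1 z0 (hT.congr fun i t ht => ((h1 i t ht).1).symm)).congr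
      fun i t ht => (h0 i t ht).1

/-- The winding matrix of a diagram of `T` is the equivariant linking matrix of `T`. -/
theorem IsDiagramOf.exists_matrix (hDT : D.IsDiagramOf T) (hcl : D.LiftClosed)
    {K : Fin μ → ℝ → E3} {k : ℤ} (hK : T.IsLift k K) :
    ∃ L : Matrix (Fin μ) (Fin μ) (LaurentPolynomial ℤ), T.IsEquivariantLinkingMatrix K L ∧
      ∀ (i j : Fin μ) (m : ℤ), (D.windingMatrix i j).coeff m = (((L i j).coeff m : ℤ) : ℚ) := by
  obtain ⟨K₀, hK₀, hL⟩ := IsEquivariantLinkingMatrix.of_isotopic hcl hDT.2 hK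
  obtain ⟨L, h1, h2⟩ := hK₀.exists_matrix hDT.1 hcl
  exact ⟨L, hL L h1, h2⟩

theorem IsDiagramOf.windingMatrix_eq {D' : FramedStringLink μ} (hiso : T.Isotopic T')
    (hD : D.IsDiagramOf T) (hD' : D'.IsDiagramOf T') (hcl : D.LiftClosed) :
    D.windingMatrix = D'.windingMatrix := by
  have hT : T.LiftClosed := hD.2.liftClosed_iff.1 hcl
  have hT' : T'.LiftClosed := hiso.liftClosed_iff.1 hT
  have hcl' : D'.LiftClosed := hD'.2.liftClosed_iff.2 hT'
  obtain ⟨K', hK'⟩ := T'.exists_isLift 0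
  obtain ⟨K, hK, hKK⟩ := IsEquivariantLinkingMatrix.of_isotopic hT hiso hK'
  obtain ⟨L, h1, h2⟩ := hD.exists_matrix hcl hK
  obtain ⟨L', h1', h2'⟩ := hD'.exists_matrix hcl' hK'
  ext i j m
  rw [h2, h2', (hKK L h1).unique h1' i j m]

end FramedStringLink

end

end

theorem mainTheorem9 (μ : ℕ) (T : FramedStringLink μ) (hT : T.IsSpecial) :
    (∀ k : ℤ, (∃ K : Fin μ → ℝ → E3, T.IsLift k K) ∧
      ∀ K : Fin μ → ℝ → E3, T.IsLift k K →
        ∀ D : FramedStringLink μ, D.IsDiagramOf T →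
          ∃ L : Matrix (Fin μ) (Fin μ) (LaurentPolynomial ℤ),
            T.IsEquivariantLinkingMatrix K L ∧
            ∀ (i j : Fin μ) (m : ℤ),
              (D.windingMatrix i j).coeff m = (((L i j).coeff m : ℤ) : ℚ)) ∧
    (∀ T' : FramedStringLink μ, T.Isotopic T' →
      ∀ D D' : FramedStringLink μ, D.IsDiagramOf T → D'.IsDiagramOf T' →
        D.windingMatrix = D'.windingMatrix) := by
  have hcl : ∀ D : FramedStringLink μ, D.IsDiagramOf T → D.LiftClosed := fun D hD =>
    hD.1.liftClosed_iff.2 (hT D hD)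
  exact ⟨fun k => ⟨T.exists_isLift k, fun K hK D hD => hD.exists_matrix (hcl D hD) hK⟩,
    fun T' hiso D D' hD hD' => hD.windingMatrix_eq hiso hD' (hcl D hD)⟩
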